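/- **Setting.** Let $n\in\{1,2,3\}$, $p\in(n,\infty)$, $T>0$, and let $\Omega\subseteq\mathbb R^n$ be a bounded Lipschitz domain. Let $\Gamma_D,\Gamma_N\subseteq\partial\Omega$ be disjoint, non-empty, relatively open in $\partial\Omega$, each with finitely many path-connected components, with $\overline{\Gamma_D}\cup\overline{\Gamma_N}=\partial\Omega$. Let $f\in C^1([0,1];\mathbb R_+)$ (with $\mathbb R_+=[0,\infty)$), and let $h\in C^1([0,1];\mathbb R)$ with $h\ge\eta$ and $h'\ge0$ on $[0,1]$ for some constant $\eta>0$. Let $\mathbf C=(\mathbf C_{ijlk})$ be a constant fourth order tensor with $\mathbf C_{ijlk}=\mathbf C_{jilk}=\mathbf C_{lkij}$ and $e:\mathbf Ce\ge c_0|e|^2$ for all $e\in\mathbb R^{n\times n}_{\mathrm{sym}}$, with a constant $c_0>0$. Put $$W(e,z)=\tfrac12h(z)\,\mathbf Ce:e,\qquad W_{,e}(e,z)=h(z)\,\mathbf Ce,\qquad W_{,z}(e,z)=\tfrac12h'(z)\,\mathbf Ce:e,\qquad \varepsilon(u)=\tfrac12(\nabla u+(\nabla u)^{\mathrm T}).$$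 Let $W^{1,p}_\pm(\Omega)$ be the set of $\zeta\in W^{1,p}(\Omega)$ with $\pm\zeta\ge0$ a.e., and let $H^1_{\Gamma_D}(\Omega;\mathbb R^n)$ be the space of $\zeta\in H^1(\Omega;\mathbb R^n)$ with $\zeta=0$ on $\Gamma_D$ in the sense of traces. **Data and functions.** Let $u^0\in H^1(\Omega;\mathbb R^n)$, $v^0\in L^2(\Omega;\mathbb R^n)$, $z^0\in W^{1,p}(\Omega)$ with $0\le z^0\le1$ a.e. in $\Omega$, $\ell\in L^2(0,T;L^2(\Omega;\mathbb R^n))$, $b\in H^1(0,T;H^1(\Omega;\mathbb R^n))\cap H^2(0,T;L^2(\Omega;\mathbb R^n))$, and $$u\in L^2(0,T;H^2(\Omega;\mathbb R^n))\cap H^1(0,T;H^1(\Omega;\mathbb R^n))\cap H^2(0,T;L^2(\Omega;\mathbb R^n)),$$ $$z\in L^p(0,T;W^{2,p}(\Omega))\cap W^{1,p}(0,T;W^{1,p}(\Omega)),\qquad \xi,\varphi\in L^2(0,T;L^2(\Omega)).$$ Values at individual times are those of the continuous representatives in time. Assume: * $u(0)=u^0$, $\partial_tu(0)=v^0$, $z(0)=z^0$,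 and $u=b$ on $\Gamma_D\times(0,T)$ in the sense of traces, for a.e. $t$; * for all $\zeta\in H^1_{\Gamma_D}(\Omega;\mathbb R^n)$ and a.e. $t\in(0,T)$, $$\int_\Omega\partial_{tt}u\cdot\zeta\,dx+\int_\Omega W_{,e}(\varepsilon(u),z):\varepsilon(\zeta)\,dx=\int_\Omega\ell\cdot\zeta\,dx;$$ * for all $\zeta\in W^{1,p}(\Omega)$ and a.e. $t\in(0,T)$, $$0=\int_\Omega\Big((\partial_tz)\zeta+|\nabla z|^{p-2}\nabla z\cdot\nabla\zeta+W_{,z}(\varepsilon(u),z)\zeta+f'(z)\zeta\Big)dx+\int_\Omega\xi\zeta\,dx+\int_\Omega\varphi\zeta\,dx;$$ * $\int_\Omega\varphi(t)\zeta\,dx\le0$ for all $\zeta\in W^{1,p}_-(\Omega)$ and a.e. $t\in(0,T)$, and $\partial_tz\le0$ a.e. in $\Omega\times(0,T)$; * $\int_\Omega\xi(t)(\zeta-z(t))\,dx\le0$ for all $\zeta\in W^{1,p}_+(\Omega)$ and a.e. $t\in(0,T)$, and $z\ge0$ a.e. in $\Omega\times(0,T)$. **Energies.** Define $$\mathcal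 F(t)=\int_\Omega\Big(\tfrac1p|\nabla z(t)|^p+W(\varepsilon(u(t)),z(t))+f(z(t))\Big)dx,\qquad \mathcal K(t)=\int_\Omega\tfrac12|\partial_tu(t)|^2dx,\qquad \mathcal D(0,t)=\int_0^t\!\!\int_\Omega|\partial_tz|^2dx\,ds,$$ $$\begin{aligned}\mathcal W_{ext}(0,t)={}&\int_0^t\!\!\int_\Omega W_{,e}(\varepsilon(u),z):\varepsilon(\partial_tb)\,dx\,ds-\int_0^t\!\!\int_\Omega\partial_tu\cdot\partial_{tt}b\,dx\,ds\\&+\int_\Omega\partial_tu(t)\cdot\partial_tb(t)\,dx-\int_\Omega\partial_tu(0)\cdot\partial_tb(0)\,dx+\int_0^t\!\!\int_\Omega\ell\cdot\partial_t(u-b)\,dx\,ds.\end{aligned}$$ **Claim.** If for a.e. $t\in(0,T)$ $$\mathcal F(t)+\mathcal K(t)+\mathcal D(0,t)\le\mathcal F(0)+\mathcal K(0)+\mathcal W_{ext}(0,t),$$ then for a.e. $t\in(0,T)$ $$\mathcal F(t)+\mathcal K(t)+\mathcal D(0,t)=\mathcal F(0)+\mathcal K(0)+\mathcal W_{ext}(0,t).$$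 -/

import Mathlib

open MeasureTheory Set Filter Topology
open scoped ENNReal ContDiff MeasureTheory

noncomputable section

namespace Damage

/-- Euclidean space `ℝⁿ`. -/
abbrev Eu (n : ℕ) : Type := EuclideanSpace ℝ (Fin n)

/-! ### The domain and its boundary -/

/-- A bounded Lipschitz domain: a bounded, connected, open set which, near every boundary point and
after a choice of a vertical direction `ν`, is the strict epigraph of a Lipschitz function `γ` of the
component orthogonal to `ν`. -/
structure IsBoundedLipschitzDomain {n : ℕ} (Ω : Set (Eu n)) : Prop where
  isOpen : IsOpen Ω
  isConnected : IsConnected Ω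
  isBounded : Bornology.IsBounded Ω
  lipschitz_boundary : ∀ x ∈ frontier Ω, ∃ (ν : Eu n) (K : NNReal) (γ : Eu n → ℝ) (r : ℝ),
    ‖ν‖ = 1 ∧ LipschitzWith K γ ∧ 0 < r ∧
      ∀ y ∈ Metric.ball x r, y ∈ Ω ↔ γ (y - inner ℝ ν y • ν) < inner ℝ ν y

/-- A part of the boundary that is non-empty, relatively open in `∂Ω` and has finitely many
path-connected components. -/
structure IsBoundaryPart {n : ℕ} (Ω Γ : Set (Eu n)) : Prop where
  nonempty : Γ.Nonempty
  relOpen : ∃ U : Set (Eu n), IsOpen U ∧ Γ = U ∩ frontier Ω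
  finite_components : Finite (ZerothHomotopy Γ)

/-- The assumptions on the Dirichlet part `ΓD` and the Neumann part `ΓN` of the boundary. -/
structure IsBoundarySplitting {n : ℕ} (Ω ΓD ΓN : Set (Eu n)) : Prop where
  dirichlet : IsBoundaryPart Ω ΓD
  neumann : IsBoundaryPart Ω ΓN
  disjoint : ΓD ∩ ΓN = ∅
  cover : closure ΓD ∪ closure ΓN = frontier Ω

/-! ### Sobolev spaces -/

section Sobolev

variable {n : ℕ} {F : Type*} [NormedAddCommGroup F] [NormedSpace ℝ F]

/-- `g` is the weak partial derivative `∂ᵢ v` on `Ω`: for all `η ∈ C_c^∞(Ω)`,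
`∫_Ω (∂ᵢ η) v = - ∫_Ω η g`. -/
def IsWeakPartial (Ω : Set (Eu n)) (i : Fin n) (v g : Eu n → F) : Prop :=
  ∀ η : Eu n → ℝ, ContDiff ℝ ∞ η → HasCompactSupport η → tsupport η ⊆ Ω →
    ∫ x in Ω, (fderiv ℝ η x (EuclideanSpace.single i 1)) • v x = - ∫ x in Ω, η x • g x

lemma memLp_test (Ω : Set (Eu n)) {ψ : Eu n → ℝ} (hc : Continuous ψ) (hs : HasCompactSupport ψ)
    (q : ℝ≥0∞) : MemLp ψ q (volume.restrict Ω) :=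
  (hc.memLp_of_hasCompactSupport hs).mono_measure Measure.restrict_le_self

lemma integrable_test_smul (Ω : Set (Eu n)) (p : ℝ≥0∞) [Fact (1 ≤ p)] {ψ : Eu n → ℝ}
    (hc : Continuous ψ) (hs : HasCompactSupport ψ) (v : Lp F p (volume.restrict Ω)) :
    Integrable (fun x => ψ x • v x) (volume.restrict Ω) := by
  have : ENNReal.HolderConjugate p (ENNReal.conjExponent p) :=
    ENNReal.HolderConjugate.conjExponent (Fact.out)
  have : ENNReal.HolderTriple (ENNReal.conjExponent p) p 1 :=
    (inferInstance : ENNReal.HolderConjugate (ENNReal.conjExponent p) p)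
  exact memLp_one_iff_integrable.1 ((Lp.memLp v).smul (memLp_test Ω hc hs (ENNReal.conjExponent p)))

lemma continuous_test_integral (Ω : Set (Eu n)) (p : ℝ≥0∞) [Fact (1 ≤ p)] {ψ : Eu n → ℝ}
    (hc : Continuous ψ) (hs : HasCompactSupport ψ) :
    Continuous (fun v : Lp F p (volume.restrict Ω) => ∫ x in Ω, ψ x • v x) := by
  have : ENNReal.HolderConjugate p (ENNReal.conjExponent p) :=
    ENNReal.HolderConjugate.conjExponent (Fact.out)
  have : ENNReal.HolderTriple (ENNReal.conjExponent p) p 1 :=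
    (inferInstance : ENNReal.HolderConjugate (ENNReal.conjExponent p) p)
  have : Fact (1 ≤ ENNReal.conjExponent p) := ⟨ENNReal.HolderConjugate.one_le _ p⟩
  have hm := memLp_test Ω hc hs (ENNReal.conjExponent p)
  let B := (ContinuousLinearMap.lsmul ℝ ℝ : ℝ →L[ℝ] F →L[ℝ] F)
  have h1 : Continuous (fun v : Lp F p (volume.restrict Ω) =>
      ∫ x in Ω, (B.holder 1 (hm.toLp ψ) v) x) :=
    continuous_integral.comp ((B.holderL (volume.restrict Ω) _ p 1 (hm.toLp ψ)).continuous) |> fun h => by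
      simpa [Function.comp_def] using h
  refine h1.congr fun v => integral_congr_ae ?_
  filter_upwards [B.coeFn_holder (r := 1) (hm.toLp ψ) v, hm.coeFn_toLp] with x hx hx'
  rw [hx, hx']
  rfl

lemma IsWeakPartial.congr_ae {Ω : Set (Eu n)} {i : Fin n} {v g v' g' : Eu n → F}
    (h : IsWeakPartial Ω i v g) (hv : v' =ᵐ[volume.restrict Ω] v)
    (hg : g' =ᵐ[volume.restrict Ω] g) : IsWeakPartial Ω i v' g' := by
  intro η h1 h2 h3
  have e1 : ∫ x in Ω, (fderiv ℝ η x (EuclideanSpace.single i 1)) • v' x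
      = ∫ x in Ω, (fderiv ℝ η x (EuclideanSpace.single i 1)) • v x :=
    integral_congr_ae (hv.mono fun x hx => by simp only [hx])
  have e2 : ∫ x in Ω, η x • g' x = ∫ x in Ω, η x • g x :=
    integral_congr_ae (hg.mono fun x hx => by simp only [hx])
  rw [e1, e2, h η h1 h2 h3]

lemma continuous_partial {η : Eu n → ℝ} (h : ContDiff ℝ ∞ η) (i : Fin n) :
    Continuous fun x => fderiv ℝ η x (EuclideanSpace.single i 1) :=
  (h.continuous_fderiv (by simp)).clm_apply continuous_const

lemma compactSupport_partial {η : Eu n → ℝ} (h : HasCompactSupport η) (i : Fin n) :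
    HasCompactSupport fun x => fderiv ℝ η x (EuclideanSpace.single i 1) :=
  h.fderiv_apply ℝ _

lemma integral_test_add (Ω : Set (Eu n)) (p : ℝ≥0∞) [Fact (1 ≤ p)] {ψ : Eu n → ℝ}
    (hc : Continuous ψ) (hs : HasCompactSupport ψ) (v w : Lp F p (volume.restrict Ω)) :
    ∫ x in Ω, ψ x • (v + w : Lp F p (volume.restrict Ω)) x
      = (∫ x in Ω, ψ x • v x) + ∫ x in Ω, ψ x • w x := by
  rw [← integral_add (integrable_test_smul Ω p hc hs v) (integrable_test_smul Ω p hc hs w)]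
  refine integral_congr_ae ?_
  filter_upwards [Lp.coeFn_add v w] with x hx
  rw [hx, Pi.add_apply, smul_add]

lemma integral_test_const_smul (Ω : Set (Eu n)) (p : ℝ≥0∞) [Fact (1 ≤ p)] (ψ : Eu n → ℝ)
    (c : ℝ) (v : Lp F p (volume.restrict Ω)) :
    ∫ x in Ω, ψ x • (c • v : Lp F p (volume.restrict Ω)) x = c • ∫ x in Ω, ψ x • v x := by
  rw [← integral_smul]
  refine integral_congr_ae ?_
  filter_upwards [Lp.coeFn_smul c v] with x hx
  rw [hx, Pi.smul_apply, smul_comm]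

/-- The Sobolev space `W^{1,p}(Ω; F)`, each element being recorded together with its weak partial
derivatives; the norm is `max (‖v‖_{L^p}, ‖∂₁ v‖_{L^p}, …, ‖∂ₙ v‖_{L^p})`. -/
def sobolevW1 (Ω : Set (Eu n)) (p : ℝ≥0∞) [Fact (1 ≤ p)] (F : Type*) [NormedAddCommGroup F]
    [NormedSpace ℝ F] :
    Submodule ℝ (Lp F p (volume.restrict Ω) × (Fin n → Lp F p (volume.restrict Ω))) where
  carrier := {w | ∀ i, IsWeakPartial Ω i w.1 (w.2 i)}
  zero_mem' := by
    intro i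
    have h : IsWeakPartial Ω i (0 : Eu n → F) (0 : Eu n → F) := by
      intro η _ _ _; simp
    exact h.congr_ae (Lp.coeFn_zero _ _ _) (Lp.coeFn_zero _ _ _)
  add_mem' := by
    intro a b ha hb i η h1 h2 h3
    have e1 := integral_test_add Ω p (continuous_partial h1 i) (compactSupport_partial h2 i) a.1 b.1
    have e2 := integral_test_add Ω p h1.continuous h2 (a.2 i) (b.2 i)
    simp only [Prod.fst_add, Prod.snd_add, Pi.add_apply]
    rw [e1, e2, ha i η h1 h2 h3, hb i η h1 h2 h3, neg_add]
  smul_mem' := by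
    intro c a ha i η h1 h2 h3
    have e1 := integral_test_const_smul Ω p (fun x => fderiv ℝ η x (EuclideanSpace.single i 1)) c a.1
    have e2 := integral_test_const_smul Ω p η c (a.2 i)
    simp only [Prod.smul_fst, Prod.smul_snd, Pi.smul_apply]
    rw [e1, e2, ha i η h1 h2 h3, smul_neg]

lemma isClosed_sobolevW1 (Ω : Set (Eu n)) (p : ℝ≥0∞) [Fact (1 ≤ p)] :
    IsClosed (sobolevW1 Ω p F :
      Set (Lp F p (volume.restrict Ω) × (Fin n → Lp F p (volume.restrict Ω)))) := by
  have : (sobolevW1 Ω p F :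
      Set (Lp F p (volume.restrict Ω) × (Fin n → Lp F p (volume.restrict Ω)))) =
      {w | ∀ i, IsWeakPartial Ω i w.1 (w.2 i)} := rfl
  rw [this]
  simp only [IsWeakPartial, ofPred_forall]
  refine isClosed_iInter fun i => isClosed_iInter fun η => isClosed_iInter fun h1 =>
    isClosed_iInter fun h2 => isClosed_iInter fun _ => isClosed_eq ?_ ?_
  · exact (continuous_test_integral Ω p (continuous_partial h1 i)
      (compactSupport_partial h2 i)).comp continuous_fst
  · exact ((continuous_test_integral Ω p h1.continuous h2).comp
      ((continuous_apply i).comp continuous_snd)).neg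

/-- The type of elements of `W^{1,p}(Ω; F)`. -/
abbrev W1 (Ω : Set (Eu n)) (p : ℝ≥0∞) [Fact (1 ≤ p)] (F : Type*) [NormedAddCommGroup F]
    [NormedSpace ℝ F] : Type _ := ↥(sobolevW1 Ω p F)

instance instCompleteSpaceW1 (Ω : Set (Eu n)) (p : ℝ≥0∞) [Fact (1 ≤ p)] [CompleteSpace F] :
    CompleteSpace (W1 Ω p F) :=
  (isClosed_sobolevW1 Ω p).isComplete.completeSpace_coe

variable {Ω : Set (Eu n)} {p : ℝ≥0∞} [Fact (1 ≤ p)]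

/-- The class in `L^p(Ω; F)` of an element of `W^{1,p}(Ω; F)`. -/
def W1.toLp (w : W1 Ω p F) : Lp F p (volume.restrict Ω) := w.1.1

/-- The weak partial derivative `∂ᵢ w ∈ L^p(Ω; F)`. -/
def W1.partialLp (w : W1 Ω p F) (i : Fin n) : Lp F p (volume.restrict Ω) := w.1.2 i

/-- The Sobolev space `W^{2,p}(Ω; F)`: functions of `W^{1,p}` all of whose weak partial derivatives
lie in `W^{1,p}`; each element is recorded together with these partial derivatives. -/
def sobolevW2 (Ω : Set (Eu n)) (p : ℝ≥0∞) [Fact (1 ≤ p)] (F : Type*) [NormedAddCommGroup F]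
    [NormedSpace ℝ F] : Submodule ℝ (W1 Ω p F × (Fin n → W1 Ω p F)) where
  carrier := {w | ∀ i, (w.2 i).toLp = w.1.partialLp i}
  zero_mem' := fun _ => rfl
  add_mem' := fun ha hb i => congrArg₂ (· + ·) (ha i) (hb i)
  smul_mem' := fun c _ ha i => congrArg (c • ·) (ha i)

end Sobolev

section Traces

variable {n : ℕ} {Ω : Set (Eu n)}

/-- `v ∈ H¹(Ω; ℝⁿ)` has the trace `g` on the boundary part `Γ`: there are functions `φ_k`, smooth up
to the boundary, with `φ_k → v` in `H¹(Ω)` and `φ_k → g` in `L²(Γ)`, where `Γ` carries the surface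
measure. -/
def HasTraceOn (Γ : Set (Eu n)) (v : W1 Ω 2 (Eu n)) (g : Eu n → Eu n) : Prop :=
  ∃ φ : ℕ → Eu n → Eu n, (∀ k, ContDiff ℝ ∞ (φ k)) ∧
    Tendsto (fun k => eLpNorm (fun x => φ k x - v.toLp x) 2 (volume.restrict Ω)) atTop (𝓝 0) ∧
    (∀ i, Tendsto (fun k => eLpNorm
      (fun x => fderiv ℝ (φ k) x (EuclideanSpace.single i 1) - v.partialLp i x) 2
      (volume.restrict Ω)) atTop (𝓝 0)) ∧
    Tendsto (fun k => eLpNorm (fun x => φ k x - g x) 2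
      ((Measure.hausdorffMeasure ((n : ℝ) - 1)).restrict Γ)) atTop (𝓝 0)

/-- `v = 0` on `Γ` in the sense of traces; for `Γ = Γ_D` this is `v ∈ H¹_{Γ_D}(Ω; ℝⁿ)`. -/
def VanishesOn (Γ : Set (Eu n)) (v : W1 Ω 2 (Eu n)) : Prop := HasTraceOn Γ v 0

end Traces

/-! ### Functions of time with values in a Banach space -/

section Time

/-- Lebesgue measure on the time interval `(0, T)`. -/
abbrev timeMeasure (T : ℝ) : Measure ℝ := volume.restrict (Ioo 0 T)

/-- `g ∈ W^{1,q}(0, T; X)` with `∂ₜ g = g'`, where `g` is the (absolutely) continuous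
representative: `g' ∈ L^q(0, T; X)` and `g(t) = g(0) + ∫₀ᵗ g'(s) ds` on `[0, T]`. -/
structure IsW1InTime {X : Type*} [NormedAddCommGroup X] [NormedSpace ℝ X] (T : ℝ) (q : ℝ≥0∞)
    (g g' : ℝ → X) : Prop where
  memLp : MemLp g' q (timeMeasure T)
  eq_integral : ∀ t ∈ Icc 0 T, g t = g 0 + ∫ s in (0 : ℝ)..t, g' s

/-- Elements of `W^{1,q}(0, T; X)`. -/
structure W1InTime (T : ℝ) (q : ℝ≥0∞) (X : Type*) [NormedAddCommGroup X] [NormedSpace ℝ X] where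
  /-- the continuous representative -/
  val : ℝ → X
  /-- the time derivative, an element of `L^q(0, T; X)` -/
  dt : ℝ → X
  isW1 : IsW1InTime T q val dt

/-- Elements `u` of `H¹(0, T; H¹(Ω; ℝⁿ)) ∩ H²(0, T; L²(Ω; ℝⁿ))`. -/
structure HypPath {n : ℕ} (Ω : Set (Eu n)) (T : ℝ) where
  /-- `u`, as a continuous function with values in `H¹` -/
  val : ℝ → W1 Ω 2 (Eu n)
  /-- `∂ₜ u`, as an element of `L²(0, T; H¹)` -/
  dt : ℝ → W1 Ω 2 (Eu n)
  /-- `∂ₜ u`, as a continuous function with values in `L²` -/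
  vel : ℝ → Lp (Eu n) 2 (volume.restrict Ω)
  /-- `∂ₜₜ u`, as an element of `L²(0, T; L²)` -/
  acc : ℝ → Lp (Eu n) 2 (volume.restrict Ω)
  isW1_val : IsW1InTime T 2 val dt
  isW1_vel : IsW1InTime T 2 vel acc
  dt_eq_vel : ∀ᵐ t ∂(timeMeasure T), (dt t).toLp = vel t

/-- `w ∈ L^q(0, T; W^{2,p}(Ω; F))`. -/
def MemLqW2 {n : ℕ} {Ω : Set (Eu n)} {p : ℝ≥0∞} [Fact (1 ≤ p)] {F : Type*} [NormedAddCommGroup F]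
    [NormedSpace ℝ F] (T : ℝ) (q : ℝ≥0∞) (w : ℝ → W1 Ω p F) : Prop :=
  ∃ G : ℝ → ↥(sobolevW2 Ω p F), MemLp G q (timeMeasure T) ∧
    ∀ᵐ t ∂(timeMeasure T), (G t).1.1 = w t

end Time

/-! ### Coefficients and the elastic energy density -/

section Coefficients

variable {n : ℕ}

/-- Components `C i j k l` of a fourth order tensor. -/
abbrev Tensor4 (n : ℕ) : Type := Fin n → Fin n → Fin n → Fin n → ℝ

/-- The product `A : B` of matrices. -/
def frob (A B : Matrix (Fin n) (Fin n) ℝ) : ℝ := ∑ i, ∑ j, A i j * B i j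

/-- The matrix `C e`. -/
def Tensor4.app (C : Tensor4 n) (e : Matrix (Fin n) (Fin n) ℝ) : Matrix (Fin n) (Fin n) ℝ :=
  Matrix.of fun i j => ∑ k, ∑ l, C i j k l * e k l

/-- The symmetry and coercivity assumptions on the stiffness tensor. -/
structure IsStiffnessTensor (C : Tensor4 n) : Prop where
  symm_left : ∀ i j l k, C i j l k = C j i l k
  symm_pair : ∀ i j l k, C i j l k = C l k i j
  coercive : ∃ c₀ : ℝ, 0 < c₀ ∧ ∀ e : Matrix (Fin n) (Fin n) ℝ, e.IsSymm →
    c₀ * frob e e ≤ frob e (C.app e)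

/-- `f ∈ C¹([0,1]; ℝ₊)`; only the values of `f` on `[0,1]` matter. -/
structure IsDamagePotential (f : ℝ → ℝ) : Prop where
  contDiffOn : ContDiffOn ℝ 1 f (Icc 0 1)
  nonneg : ∀ s ∈ Icc (0 : ℝ) 1, 0 ≤ f s

/-- The derivative on `[0,1]` of a function given on `[0,1]`. -/
def deriv01 (f : ℝ → ℝ) (s : ℝ) : ℝ := derivWithin f (Icc 0 1) s

/-- `h ∈ C¹([0,1]; ℝ)`, `h ≥ η > 0` and `h' ≥ 0` on `[0,1]`; only the values of `h` on `[0,1]`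
matter. -/
structure IsDegradation (h : ℝ → ℝ) : Prop where
  contDiffOn : ContDiffOn ℝ 1 h (Icc 0 1)
  lower_bound : ∃ η : ℝ, 0 < η ∧ ∀ s ∈ Icc (0 : ℝ) 1, η ≤ h s
  deriv_nonneg : ∀ s ∈ Icc (0 : ℝ) 1, 0 ≤ deriv01 h s

/-- `W(e, z) = ½ h(z) C e : e`. -/
def elasticW (C : Tensor4 n) (h : ℝ → ℝ) (e : Matrix (Fin n) (Fin n) ℝ) (z : ℝ) : ℝ :=
  1 / 2 * h z * frob (C.app e) e

/-- The partial derivative `W_{,e}(e, z) = h(z) C e`. -/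
def elasticWe (C : Tensor4 n) (h : ℝ → ℝ) (e : Matrix (Fin n) (Fin n) ℝ) (z : ℝ) :
    Matrix (Fin n) (Fin n) ℝ :=
  h z • C.app e

/-- The partial derivative `W_{,z}(e, z) = ½ h'(z) C e : e`. -/
def elasticWz (C : Tensor4 n) (h : ℝ → ℝ) (e : Matrix (Fin n) (Fin n) ℝ) (z : ℝ) : ℝ :=
  1 / 2 * deriv01 h z * frob (C.app e) e

lemma frob_add_left (A B D : Matrix (Fin n) (Fin n) ℝ) :
    frob (A + B) D = frob A D + frob B D := by
  simp [frob, add_mul, Finset.sum_add_distrib]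

lemma frob_smul_left (c : ℝ) (A D : Matrix (Fin n) (Fin n) ℝ) : frob (c • A) D = c * frob A D := by
  simp [frob, Finset.mul_sum, mul_assoc]

lemma frob_comm (A D : Matrix (Fin n) (Fin n) ℝ) : frob A D = frob D A := by
  simp [frob, mul_comm]

lemma Tensor4.app_add_smul (C : Tensor4 n) (e d : Matrix (Fin n) (Fin n) ℝ) (s : ℝ) :
    C.app (e + s • d) = C.app e + s • C.app d := by
  ext i j
  simp only [Tensor4.app, Matrix.of_apply, Matrix.add_apply, Matrix.smul_apply, smul_eq_mul,
    Finset.mul_sum, ← Finset.sum_add_distrib]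
  refine Finset.sum_congr rfl fun k _ => Finset.sum_congr rfl fun l _ => ?_
  ring

lemma Tensor4.frob_app_symm {C : Tensor4 n} (hC : IsStiffnessTensor C)
    (e d : Matrix (Fin n) (Fin n) ℝ) : frob (C.app d) e = frob (C.app e) d := by
  simp only [frob, Tensor4.app, Matrix.of_apply, Finset.sum_mul]
  calc _ = ∑ i, ∑ j, ∑ k, ∑ l, C k l i j * d k l * e i j := by
        simp_rw [fun i j k l => hC.symm_pair i j k l]
    _ = ∑ i, ∑ k, ∑ j, ∑ l, C k l i j * d k l * e i j :=
        Finset.sum_congr rfl fun i _ => Finset.sum_comm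
    _ = ∑ k, ∑ i, ∑ j, ∑ l, C k l i j * d k l * e i j := Finset.sum_comm
    _ = ∑ k, ∑ i, ∑ l, ∑ j, C k l i j * d k l * e i j :=
        Finset.sum_congr rfl fun k _ => Finset.sum_congr rfl fun i _ => Finset.sum_comm
    _ = ∑ k, ∑ l, ∑ i, ∑ j, C k l i j * d k l * e i j :=
        Finset.sum_congr rfl fun k _ => Finset.sum_comm
    _ = _ := by
        refine Finset.sum_congr rfl fun k _ => Finset.sum_congr rfl fun l _ =>
          Finset.sum_congr rfl fun i _ => Finset.sum_congr rfl fun j _ => ?_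
        ring

/-- `elasticWe` is the derivative of `elasticW` with respect to `e`. -/
lemma hasDerivAt_elasticW {C : Tensor4 n} (hC : IsStiffnessTensor C) (h : ℝ → ℝ)
    (e d : Matrix (Fin n) (Fin n) ℝ) (z : ℝ) :
    HasDerivAt (fun s : ℝ => elasticW C h (e + s • d) z) (frob (elasticWe C h e z) d) 0 := by
  have key : (fun s : ℝ => elasticW C h (e + s • d) z) = fun s : ℝ =>
      elasticW C h e z + s * (h z * frob (C.app e) d)
        + s ^ 2 * (1 / 2 * h z * frob (C.app d) d) := by
    funext s
    have h1 : frob (C.app (e + s • d)) (e + s • d) = frob (C.app e) e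
        + 2 * s * frob (C.app e) d + s ^ 2 * frob (C.app d) d := by
      rw [C.app_add_smul, frob_add_left, frob_smul_left, frob_comm (C.app e),
        frob_comm (C.app d), frob_add_left, frob_add_left, frob_smul_left, frob_smul_left,
        frob_comm e, frob_comm d, frob_comm e, frob_comm d, Tensor4.frob_app_symm hC e d]
      ring
    simp only [elasticW, h1]
    ring
  rw [key]
  have h2 := (((hasDerivAt_id (0 : ℝ)).mul_const (h z * frob (C.app e) d)).const_add
    (elasticW C h e z)).add (((hasDerivAt_id (0 : ℝ)).pow 2).mul_const
      (1 / 2 * h z * frob (C.app d) d))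
  refine h2.congr_deriv ?_
  simp [elasticWe, frob_smul_left]

/-- `elasticWz` is the derivative of `elasticW` with respect to `z`. -/
lemma hasDerivWithinAt_elasticW (C : Tensor4 n) {h : ℝ → ℝ} (hh : IsDegradation h)
    (e : Matrix (Fin n) (Fin n) ℝ) {z : ℝ} (hz : z ∈ Icc (0 : ℝ) 1) :
    HasDerivWithinAt (elasticW C h e) (elasticWz C h e z) (Icc 0 1) z := by
  have h1 := ((hh.contDiffOn.differentiableOn one_ne_zero) z hz).hasDerivWithinAt
  exact (h1.const_mul (1 / 2)).mul_const _

end Coefficients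

/-! ### Strain, gradient, energies -/

section Energies

variable {n : ℕ} {Ω : Set (Eu n)} {p : ℝ≥0∞} [Fact (1 ≤ p)] {T : ℝ}

/-- The linearized strain `ε(v) = ½ (∇v + (∇v)ᵀ)` at the point `x`. -/
def strain (v : W1 Ω 2 (Eu n)) (x : Eu n) : Matrix (Fin n) (Fin n) ℝ :=
  Matrix.of fun i j => 1 / 2 * (v.partialLp j x i + v.partialLp i x j)

/-- The gradient `∇z` at the point `x`. -/
def grad (z : W1 Ω p ℝ) (x : Eu n) : Eu n := WithLp.toLp 2 fun i => z.partialLp i x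

/-- The free energy `∫_Ω (1/p |∇z|^p + W(ε(u), z) + f(z)) dx`. -/
def freeEnergy (C : Tensor4 n) (h f : ℝ → ℝ) (u : W1 Ω 2 (Eu n)) (z : W1 Ω p ℝ) : ℝ :=
  ∫ x in Ω, (1 / p.toReal * ‖grad z x‖ ^ p.toReal + elasticW C h (strain u x) (z.toLp x)
    + f (z.toLp x))

/-- The kinetic energy `∫_Ω ½ |v|² dx` of a velocity field `v`. -/
def kineticEnergy (v : Lp (Eu n) 2 (volume.restrict Ω)) : ℝ :=
  ∫ x in Ω, 1 / 2 * ‖v x‖ ^ 2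

/-- The dissipated energy `∫₀ᵗ ∫_Ω |∂ₜ z|² dx ds`. -/
def dissipation (z : W1InTime T p (W1 Ω p ℝ)) (t : ℝ) : ℝ :=
  ∫ s in (0 : ℝ)..t, ∫ x in Ω, |(z.dt s).toLp x| ^ 2

/-- The external work up to time `t`. -/
def externalWork (C : Tensor4 n) (h : ℝ → ℝ) (ℓ : ℝ → Lp (Eu n) 2 (volume.restrict Ω))
    (b u : HypPath Ω T) (z : W1InTime T p (W1 Ω p ℝ)) (t : ℝ) : ℝ :=
  (∫ s in (0 : ℝ)..t, ∫ x in Ω,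
      frob (elasticWe C h (strain (u.val s) x) ((z.val s).toLp x)) (strain (b.dt s) x))
    - (∫ s in (0 : ℝ)..t, ∫ x in Ω, inner ℝ (u.vel s x) (b.acc s x))
    + (∫ x in Ω, inner ℝ (u.vel t x) (b.vel t x))
    - (∫ x in Ω, inner ℝ (u.vel 0 x) (b.vel 0 x))
    + ∫ s in (0 : ℝ)..t, ∫ x in Ω, inner ℝ (ℓ s x) (u.vel s x - b.vel s x)

end Energies

/-! ### The weak conditions -/

/-- The conditions of the weak formulation other than the total energy-dissipation balance. The dual
pairings with `∂ₜₜ u`, `ξ` and `φ` are integrals, since these functions are in `L²(0, T; L²(Ω))`. -/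
structure WeakConditions {n : ℕ} {Ω : Set (Eu n)} {p : ℝ≥0∞} [Fact (1 ≤ p)] {T : ℝ}
    (ΓD : Set (Eu n)) (C : Tensor4 n) (h f : ℝ → ℝ)
    (u₀ : W1 Ω 2 (Eu n)) (v₀ : Lp (Eu n) 2 (volume.restrict Ω)) (z₀ : W1 Ω p ℝ)
    (ℓ : ℝ → Lp (Eu n) 2 (volume.restrict Ω)) (b u : HypPath Ω T) (z : W1InTime T p (W1 Ω p ℝ))
    (ξ φ : ℝ → Lp ℝ 2 (volume.restrict Ω)) : Prop where
  initial_u : u.val 0 = u₀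
  initial_v : u.vel 0 = v₀
  initial_z : z.val 0 = z₀
  dirichlet : ∀ᵐ t ∂(timeMeasure T), VanishesOn ΓD (u.val t - b.val t)
  force_balance : ∀ ζ : W1 Ω 2 (Eu n), VanishesOn ΓD ζ → ∀ᵐ t ∂(timeMeasure T),
    (∫ x in Ω, inner ℝ (u.acc t x) (ζ.toLp x))
      + (∫ x in Ω, frob (elasticWe C h (strain (u.val t) x) ((z.val t).toLp x)) (strain ζ x))
      = ∫ x in Ω, inner ℝ (ℓ t x) (ζ.toLp x)
  damage_law : ∀ ζ : W1 Ω p ℝ, ∀ᵐ t ∂(timeMeasure T),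
    0 = (∫ x in Ω, ((z.dt t).toLp x * ζ.toLp x
            + ‖grad (z.val t) x‖ ^ (p.toReal - 2) * inner ℝ (grad (z.val t) x) (grad ζ x)
            + elasticWz C h (strain (u.val t) x) ((z.val t).toLp x) * ζ.toLp x
            + deriv01 f ((z.val t).toLp x) * ζ.toLp x))
      + (∫ x in Ω, ξ t x * ζ.toLp x) + ∫ x in Ω, φ t x * ζ.toLp x
  phi_le : ∀ ζ : W1 Ω p ℝ, (∀ᵐ x ∂(volume.restrict Ω), ζ.toLp x ≤ 0) →
    ∀ᵐ t ∂(timeMeasure T), ∫ x in Ω, φ t x * ζ.toLp x ≤ 0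
  dt_z_nonpos : ∀ᵐ t ∂(timeMeasure T), ∀ᵐ x ∂(volume.restrict Ω), (z.dt t).toLp x ≤ 0
  xi_le : ∀ ζ : W1 Ω p ℝ, (∀ᵐ x ∂(volume.restrict Ω), 0 ≤ ζ.toLp x) →
    ∀ᵐ t ∂(timeMeasure T), ∫ x in Ω, ξ t x * (ζ.toLp x - (z.val t).toLp x) ≤ 0
  z_nonneg : ∀ᵐ t ∂(timeMeasure T), ∀ᵐ x ∂(volume.restrict Ω), 0 ≤ (z.val t).toLp x

end Damage

end

open Damage

open MeasureTheory Set Filter Topology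
open scoped ENNReal ContDiff MeasureTheory
open Damage

noncomputable section

namespace Damage


/-! ### Calculus for absolutely continuous functions of time with values in a Banach space. -/

section TimeCalculus

/-! Only the inequality opposite to the assumed one has to be proved. Formally it comes from testing
the force balance with `∂ₜ(u - b)` and the damage law with `∂ₜz`. The first test gives an exact
identity for the kinetic energy, after an integration by parts in time (`ae_force_balance_dt`,
`kinetic_balance`). In the second, `⟨φ, ∂ₜz⟩ ≤ 0` since `∂ₜz ≤ 0` is an admissible test function,
and `⟨ξ, ∂ₜz⟩ ≤ 0` since `z(s)`, `s > t`, is admissible in the variational inequality at time `t`.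
Dropping both terms shows that the free energy grows at least at the rate of the stress power minus
`‖∂ₜz‖²` (`freeEnergy_increment_ge`). In the sum of the two results the stress power of `∂ₜu`
cancels.

The difficulty is the term `W_{,z} ∂ₜz`: its weight `½ h'(z) Cε(u):ε(u)` is only in `L¹`, and `∂ₜz`
is handled as an element of `L²`. Signs replace a bound on `∂ₜz`. The functions `z(s)` take values
in `[0,1]`, so the damage law at time `t` can be tested with `z(s)` and `z(t)`, subtracted and
divided by `s - t > 0`. The quotients are nonpositive and the weight is nonnegative; Fatou's lemma
then gives both the integrability of the product and the inequality in the required direction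
(`integrable_and_nonneg_of_hasDerivAt`).

The chain rule for the elastic energy meets the same obstacle. The density `a = Cε(u):ε(u)` is
replaced by the bounded `a / (1 + ε a)`, which makes the energy locally Lipschitz with directional
derivatives, so that `IsW1InTime.chain_rule` applies. As `∂ₜz ≤ 0` and `h' ≥ 0`, truncating can only
raise the `z`-part of the derivative (`le_truncEnergyDeriv`); the lower bound therefore survives the
limit `ε → 0` (`integral_le_fullEnergy_sub`).

Three preparations are needed. The weak conditions hold off a null set of times that depends on the
test function; separability removes this dependence (`ae_forall_of_forall_ae`), so that test
functions may vary with time. The coefficients `h` and `f` are extended from `[0,1]` to bounded `C¹`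
functions on the line. Finally `‖∂ₜz‖²_{L²}` has to be integrable in time
(`integrable_dissipation`): this is immediate for `p ≥ 2`, while `p < 2` forces `n = 1`, where an
`L^∞` bound and the damage law itself provide it. -/

lemma ae_timeMeasure_iff {T : ℝ} {P : ℝ → Prop} :
    (∀ᵐ t ∂(timeMeasure T), P t) ↔ ∀ᵐ t, t ∈ Ioo 0 T → P t :=
  ae_restrict_iff' measurableSet_Ioo

lemma ae_mem_timeMeasure (T : ℝ) : ∀ᵐ t ∂(timeMeasure T), t ∈ Ioo 0 T :=
  ae_restrict_mem measurableSet_Ioo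

lemma intervalIntegrable_iff_timeMeasure {X : Type*} [NormedAddCommGroup X] {T : ℝ} (hT : 0 ≤ T)
    {g : ℝ → X} : IntervalIntegrable g volume 0 T ↔ Integrable g (timeMeasure T) :=
  intervalIntegrable_iff_integrableOn_Ioo_of_le hT

/-- An almost everywhere statement on `(0, T)` passes to a subinterval `(0, t]`. -/
lemma ae_uIoc_of_timeMeasure {T t : ℝ} (ht : t ∈ Icc 0 T) {P : ℝ → Prop}
    (h : ∀ᵐ s ∂(timeMeasure T), P s) : ∀ᵐ s, s ∈ uIoc 0 t → P s := by
  have h1 : ∀ᵐ s : ℝ, s ≠ T := by simp [ae_iff, measure_singleton]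
  filter_upwards [ae_timeMeasure_iff.1 h, h1] with s hs hsT hmem
  rw [uIoc_of_le ht.1] at hmem
  exact hs ⟨hmem.1, lt_of_le_of_ne (hmem.2.trans ht.2) hsT⟩

lemma intervalIntegral_congr_timeMeasure {X : Type*} [NormedAddCommGroup X] [NormedSpace ℝ X]
    {T t : ℝ} (ht : t ∈ Icc 0 T) {f g : ℝ → X} (h : ∀ᵐ s ∂(timeMeasure T), f s = g s) :
    ∫ s in (0 : ℝ)..t, f s = ∫ s in (0 : ℝ)..t, g s :=
  intervalIntegral.integral_congr_ae (ae_uIoc_of_timeMeasure ht h)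

lemma intervalIntegral_mono_timeMeasure {T t : ℝ} (ht : t ∈ Icc 0 T) {f g : ℝ → ℝ}
    (hf : IntervalIntegrable f volume 0 T) (hg : IntervalIntegrable g volume 0 T)
    (h : ∀ᵐ s ∂(timeMeasure T), f s ≤ g s) :
    ∫ s in (0 : ℝ)..t, f s ≤ ∫ s in (0 : ℝ)..t, g s := by
  have hsub : uIcc 0 t ⊆ uIcc 0 T := by
    rw [uIcc_of_le ht.1, uIcc_of_le (ht.1.trans ht.2)]
    exact Icc_subset_Icc le_rfl ht.2
  refine intervalIntegral.integral_mono_ae_restrict ht.1 (hf.mono_set hsub) (hg.mono_set hsub) ?_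
  have h1 : ∀ᵐ s : ℝ, s ≠ 0 := by simp [ae_iff, measure_singleton]
  refine (ae_restrict_iff' measurableSet_Icc).2 ?_
  filter_upwards [ae_uIoc_of_timeMeasure ht h, h1] with s hs hs0 hmem
  refine hs ?_
  rw [uIoc_of_le ht.1]
  exact ⟨lt_of_le_of_ne hmem.1 (Ne.symm hs0), hmem.2⟩

lemma _root_.IntervalIntegrable.mono_Icc {X : Type*} [NormedAddCommGroup X] {T a b : ℝ}
    {g : ℝ → X} (hg : IntervalIntegrable g volume 0 T) (ha : a ∈ Icc 0 T) (hb : b ∈ Icc 0 T) :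
    IntervalIntegrable g volume a b := by
  refine hg.mono_set ?_
  rw [uIcc_of_le (ha.1.trans ha.2)]
  exact uIcc_subset_Icc ha hb

variable {X : Type*} [NormedAddCommGroup X] [NormedSpace ℝ X] {T : ℝ} {q : ℝ≥0∞} {g g' : ℝ → X}

namespace IsW1InTime

lemma integrable (hg : IsW1InTime T q g g') (hq : 1 ≤ q) : Integrable g' (timeMeasure T) :=
  hg.memLp.integrable hq

lemma intervalIntegrable (hg : IsW1InTime T q g g') (hq : 1 ≤ q) (hT : 0 ≤ T) :
    IntervalIntegrable g' volume 0 T :=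
  (intervalIntegrable_iff_timeMeasure hT).2 (hg.integrable hq)

lemma sub_eq_integral (hg : IsW1InTime T q g g') (hq : 1 ≤ q) {s t : ℝ}
    (hs : s ∈ Icc 0 T) (ht : t ∈ Icc 0 T) : g t - g s = ∫ r in s..t, g' r := by
  have hT : 0 ≤ T := hs.1.trans hs.2
  have hi := hg.intervalIntegrable hq hT
  have h0 : (0 : ℝ) ∈ Icc 0 T := ⟨le_rfl, hT⟩
  rw [hg.eq_integral t ht, hg.eq_integral s hs, add_sub_add_left_eq_sub]
  exact intervalIntegral.integral_interval_sub_left (hi.mono_Icc h0 ht) (hi.mono_Icc h0 hs)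

lemma norm_sub_le (hg : IsW1InTime T q g g') (hq : 1 ≤ q) {s t : ℝ}
    (hs : s ∈ Icc 0 T) (ht : t ∈ Icc 0 T) : ‖g t - g s‖ ≤ |∫ r in s..t, ‖g' r‖| := by
  rw [hg.sub_eq_integral hq hs ht]
  exact intervalIntegral.norm_integral_le_abs_integral_norm

lemma continuousOn (hg : IsW1InTime T q g g') (hq : 1 ≤ q) : ContinuousOn g (Icc 0 T) := by
  rcases lt_or_ge T 0 with hT | hT
  · simp [Icc_eq_empty_of_lt hT]
  have h := intervalIntegral.continuousOn_primitive_interval' (hg.intervalIntegrable hq hT)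
    (left_mem_uIcc)
  rw [uIcc_of_le hT] at h
  exact (continuousOn_const.add h).congr hg.eq_integral

lemma exists_bound (hg : IsW1InTime T q g g') (hq : 1 ≤ q) : ∃ R, 0 ≤ R ∧ ∀ t ∈ Icc 0 T, ‖g t‖ ≤ R := by
  obtain ⟨R, hR⟩ := isCompact_Icc.exists_bound_of_continuousOn (hg.continuousOn hq)
  exact ⟨max R 0, le_max_right _ _, fun t ht => (hR t ht).trans (le_max_left _ _)⟩

lemma ae_hasDerivAt [CompleteSpace X] (hg : IsW1InTime T q g g') (hq : 1 ≤ q) :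
    ∀ᵐ t ∂(timeMeasure T), HasDerivAt g (g' t) t := by
  rcases lt_or_ge T 0 with hT | hT
  · simp [timeMeasure, Ioo_eq_empty_of_le hT.le]
  refine ae_timeMeasure_iff.2 ?_
  filter_upwards [(hg.intervalIntegrable hq hT).ae_hasDerivAt_integral] with t ht hmem
  rw [uIcc_of_le hT] at ht
  refine ((ht (Ioo_subset_Icc_self hmem) 0 ⟨le_rfl, hT⟩).const_add (g 0)).congr_of_eventuallyEq ?_
  filter_upwards [Ioo_mem_nhds hmem.1 hmem.2] with s hs
  exact hg.eq_integral s (Ioo_subset_Icc_self hs)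

lemma aestronglyMeasurable (hg : IsW1InTime T q g g') (hq : 1 ≤ q) :
    AEStronglyMeasurable g (timeMeasure T) :=
  ((hg.continuousOn hq).mono Ioo_subset_Icc_self).aestronglyMeasurable measurableSet_Ioo

lemma comp_clm {Y : Type*} [NormedAddCommGroup Y] [NormedSpace ℝ Y] [CompleteSpace X]
    [CompleteSpace Y] (hg : IsW1InTime T q g g') (hq : 1 ≤ q) (L : X →L[ℝ] Y) :
    IsW1InTime T q (fun t => L (g t)) (fun t => L (g' t)) where
  memLp := L.comp_memLp' hg.memLp
  eq_integral t ht := by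
    have hT : 0 ≤ T := ht.1.trans ht.2
    rw [L.intervalIntegral_comp_comm
      ((hg.intervalIntegrable hq hT).mono_Icc ⟨le_rfl, hT⟩ ht), ← map_add, ← hg.eq_integral t ht]

lemma sub (hg : IsW1InTime T q g g') (hq : 1 ≤ q) {k k' : ℝ → X} (hk : IsW1InTime T q k k') :
    IsW1InTime T q (fun t => g t - k t) (fun t => g' t - k' t) where
  memLp := hg.memLp.sub hk.memLp
  eq_integral t ht := by
    have hT : 0 ≤ T := ht.1.trans ht.2
    have h0 : (0 : ℝ) ∈ Icc 0 T := ⟨le_rfl, hT⟩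
    rw [intervalIntegral.integral_sub ((hg.intervalIntegrable hq hT).mono_Icc h0 ht)
      ((hk.intervalIntegrable hq hT).mono_Icc h0 ht), hg.eq_integral t ht, hk.eq_integral t ht]
    abel

lemma prodMk {Y : Type*} [NormedAddCommGroup Y] [NormedSpace ℝ Y] [CompleteSpace X]
    [CompleteSpace Y] {r : ℝ≥0∞} {k k' : ℝ → Y} (hg : IsW1InTime T q g g') (hq : 1 ≤ q)
    (hk : IsW1InTime T r k k') (hr : 1 ≤ r) :
    IsW1InTime T 1 (fun t => (g t, k t)) (fun t => (g' t, k' t)) where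
  memLp := memLp_one_iff_integrable.2 ((hg.integrable hq).prodMk (hk.integrable hr))
  eq_integral t ht := by
    have hT : 0 ≤ T := ht.1.trans ht.2
    have h0 : (0 : ℝ) ∈ Icc 0 T := ⟨le_rfl, hT⟩
    have h1 := (hg.intervalIntegrable hq hT).mono_Icc h0 ht
    have h2 := (hk.intervalIntegrable hr hT).mono_Icc h0 ht
    have h3 : IntervalIntegrable (fun t => (g' t, k' t)) volume 0 t := by
      rw [intervalIntegrable_iff] at h1 h2 ⊢
      exact Integrable.prodMk h1 h2
    refine Prod.ext ?_ ?_
    · have := (ContinuousLinearMap.fst ℝ X Y).intervalIntegral_comp_comm h3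
      simp only [ContinuousLinearMap.coe_fst'] at this
      rw [hg.eq_integral t ht, Prod.fst_add, ← this]
    · have := (ContinuousLinearMap.snd ℝ X Y).intervalIntegral_comp_comm h3
      simp only [ContinuousLinearMap.coe_snd'] at this
      rw [hk.eq_integral t ht, Prod.snd_add, ← this]

/-- Chain rule: `J ∘ g` is the integral of its a.e. derivative when `J` is Lipschitz on balls. -/
lemma chain_rule [CompleteSpace X] (hg : IsW1InTime T q g g') (hq : 1 ≤ q) (hT : 0 ≤ T)
    {J : X → ℝ} {D : ℝ → ℝ} (hlip : ∀ R, ∃ K, LipschitzOnWith K J (Metric.closedBall 0 R))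
    (hderiv : ∀ᵐ s ∂(timeMeasure T), HasDerivAt (fun δ : ℝ => J (g s + δ • g' s)) (D s) 0) :
    IntervalIntegrable D volume 0 T ∧
      ∀ t ∈ Icc 0 T, J (g t) - J (g 0) = ∫ s in (0 : ℝ)..t, D s := by
  obtain ⟨R, hR0, hR⟩ := hg.exists_bound hq
  -- The extra 1 leaves room for the tangent line `g s + y • g' s`, which may leave the ball of
  -- radius `R`.
  obtain ⟨K, hK⟩ := hlip (R + 1)
  have hmem : ∀ t ∈ Icc 0 T, g t ∈ Metric.closedBall (0 : X) (R + 1) := fun t ht => by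
    rw [mem_closedBall_zero_iff]; linarith [hR t ht]
  -- The increments of `J ∘ g` are at most `K` times those of the absolutely continuous function
  -- `I`, so `J ∘ g` is absolutely continuous as well.
  set I : ℝ → ℝ := fun t => ∫ r in (0 : ℝ)..t, ‖g' r‖ with hI
  have hint := (hg.intervalIntegrable hq hT).norm
  have hIac : AbsolutelyContinuousOnInterval I 0 T :=
    hint.absolutelyContinuousOnInterval_intervalIntegral (c := 0) left_mem_uIcc
  have hdist : ∀ s ∈ uIcc 0 T, ∀ t ∈ uIcc 0 T,
      dist (J (g s)) (J (g t)) ≤ K * dist (I s) (I t) := by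
    intro s hs t ht
    rw [uIcc_of_le hT] at hs ht
    refine (hK.dist_le_mul _ (hmem s hs) _ (hmem t ht)).trans ?_
    gcongr
    rw [dist_comm, dist_eq_norm, dist_comm, Real.dist_eq]
    refine (hg.norm_sub_le hq hs ht).trans (le_of_eq ?_)
    have h0 : (0 : ℝ) ∈ Icc 0 T := ⟨le_rfl, hT⟩
    rw [hI]
    simp only
    rw [intervalIntegral.integral_interval_sub_left (hint.mono_Icc h0 ht) (hint.mono_Icc h0 hs)]
  have hac : AbsolutelyContinuousOnInterval (fun t => J (g t)) 0 T := by
    have h1 := Tendsto.const_mul (K : ℝ) hIac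
    rw [mul_zero] at h1
    refine squeeze_zero' (Eventually.of_forall fun E => Finset.sum_nonneg fun _ _ => dist_nonneg)
      ?_ h1
    refine eventually_inf_principal.2 (Eventually.of_forall fun E hE => ?_)
    rw [Finset.mul_sum]
    exact Finset.sum_le_sum fun i hi => hdist _ (hE.1 i hi).1 _ (hE.1 i hi).2
  have hD : ∀ᵐ s ∂(timeMeasure T), deriv (fun t => J (g t)) s = D s := by
    filter_upwards [hderiv, hg.ae_hasDerivAt hq, ae_mem_timeMeasure T] with s h1 h2 hs
    refine HasDerivAt.deriv ?_
    have hgs : g s + (0 : ℝ) • g' s = g s := by simp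
    -- The Lipschitz bound turns the first-order error of `g` into an `o(y)` error of `J ∘ g`. Hence
    -- a directional derivative of `J` suffices and no Fréchet derivative is needed.
    have e1 : (fun y : ℝ => J (g (s + y)) - J (g s + y • g' s)) =o[𝓝 0] fun y : ℝ => y := by
      have h3 := hasDerivAt_iff_isLittleO_nhds_zero.1 h2
      refine Asymptotics.IsBigO.trans_isLittleO ?_ h3
      refine Asymptotics.IsBigO.of_bound K ?_
      have hc1 : ∀ᶠ y : ℝ in 𝓝 0, s + y ∈ Icc 0 T := by
        have : Tendsto (fun y : ℝ => s + y) (𝓝 0) (𝓝 s) := by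
          simpa using (continuous_const_add s).tendsto 0
        exact this.eventually (Icc_mem_nhds hs.1 hs.2)
      have hc2 : ∀ᶠ y : ℝ in 𝓝 0, g s + y • g' s ∈ Metric.closedBall (0 : X) (R + 1) := by
        have : Tendsto (fun y : ℝ => g s + y • g' s) (𝓝 0) (𝓝 (g s)) := by
          have := (by fun_prop : Continuous fun y : ℝ => g s + y • g' s).tendsto 0
          simpa using this
        refine this.eventually (Metric.closedBall_mem_nhds_of_mem ?_)
        rw [mem_ball_zero_iff]; linarith [hR s (Ioo_subset_Icc_self hs)]
      filter_upwards [hc1, hc2] with y hy1 hy2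
      have := hK.norm_sub_le (hmem _ hy1) hy2
      rwa [← sub_sub] at this
    have e2 := hasDerivAt_iff_isLittleO_nhds_zero.1 h1
    rw [hasDerivAt_iff_isLittleO_nhds_zero]
    refine (e1.add e2).congr_left fun y => ?_
    simp only [zero_add, smul_eq_mul, zero_smul, add_zero]
    ring
  have hint' := hac.intervalIntegrable_deriv
  refine ⟨hint'.congr_ae ?_, fun t ht => ?_⟩
  · rw [uIoc_of_le hT, ← restrict_Ioo_eq_restrict_Ioc]
    exact hD
  · have h0 : (0 : ℝ) ∈ Icc 0 T := ⟨le_rfl, hT⟩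
    rw [← intervalIntegral_congr_timeMeasure ht hD]
    refine ((hac.mono ?_).integral_deriv_eq_sub).symm
    rw [uIcc_of_le hT]; exact uIcc_subset_Icc h0 ht

/-- A closed subspace that contains the values of `g` contains the time derivative. -/
lemma ae_dt_mem [CompleteSpace X] (hg : IsW1InTime T q g g') (hq : 1 ≤ q) (V : Submodule ℝ X)
    (hV : IsClosed (V : Set X)) (h : ∀ t ∈ Icc 0 T, g t ∈ V) :
    ∀ᵐ t ∂(timeMeasure T), g' t ∈ V := by
  filter_upwards [hg.ae_hasDerivAt hq, ae_mem_timeMeasure T] with t h1 ht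
  refine hV.mem_of_tendsto (hasDerivAt_iff_tendsto_slope.1 h1) ?_
  filter_upwards [mem_nhdsWithin_of_mem_nhds (Ioo_mem_nhds ht.1 ht.2)] with s hs
  exact V.smul_mem _ (V.sub_mem (h s (Ioo_subset_Icc_self hs)) (h t (Ioo_subset_Icc_self ht)))

/-- A closed set that contains `g t` for almost every `t` contains it for every `t`. -/
lemma mem_of_ae_mem (hg : IsW1InTime T q g g') (hq : 1 ≤ q) (hT : 0 < T) {S : Set X}
    (hS : IsClosed S) (h : ∀ᵐ t ∂(timeMeasure T), g t ∈ S) : ∀ t ∈ Icc 0 T, g t ∈ S := by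
  have hd : Icc 0 T ⊆ closure {t | t ∈ Ioo 0 T ∧ g t ∈ S} := by
    have h1 : Ioo 0 T ⊆ closure {t | t ∈ Ioo 0 T ∧ g t ∈ S} := by
      have hdense : Dense {t : ℝ | t ∈ Ioo 0 T → g t ∈ S} :=
        Measure.dense_of_ae (ae_timeMeasure_iff.1 h)
      refine (hdense.open_subset_closure_inter isOpen_Ioo).trans (closure_mono fun t ht => ⟨ht.1, ht.2 ht.1⟩)
    have := closure_mono h1
    rwa [closure_Ioo hT.ne, closure_closure] at this
  intro t ht
  have h2 := mem_closure_iff_nhdsWithin_neBot.1 (hd ht)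
  have h3 : Tendsto g (𝓝[{t | t ∈ Ioo 0 T ∧ g t ∈ S}] t) (𝓝 (g t)) :=
    (hg.continuousOn hq t ht).mono_left (nhdsWithin_mono _ fun s hs => Ioo_subset_Icc_self hs.1)
  exact hS.mem_of_tendsto h3 (eventually_nhdsWithin_of_forall fun s hs => hs.2)

end IsW1InTime

/-- Exchange of `∀ x ∈ K` and `∀ᵐ t` for conditions that are closed in `x` relative to `K`. -/
lemma ae_forall_of_forall_ae {Y α : Type*} [PseudoMetricSpace Y] [SecondCountableTopology Y]
    [MeasurableSpace α] {μ : Measure α} (K : Set Y) {P : α → Y → Prop}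
    (hclosed : ∀ᵐ t ∂μ, ∀ (y : ℕ → Y) (x : Y), (∀ k, y k ∈ K) → x ∈ K → Tendsto y atTop (𝓝 x) →
      (∀ k, P t (y k)) → P t x)
    (h : ∀ x ∈ K, ∀ᵐ t ∂μ, P t x) : ∀ᵐ t ∂μ, ∀ x ∈ K, P t x := by
  -- Density is taken inside `K`, so that the approximating sequences consist of admissible points.
  obtain ⟨D, hDc, hDd⟩ := TopologicalSpace.exists_countable_dense K
  have h1 : ∀ᵐ t ∂μ, ∀ x ∈ D, P t (x : Y) := (ae_ball_iff hDc).2 fun x _ => h x x.2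
  filter_upwards [h1, hclosed] with t ht hc x hx
  obtain ⟨y, hyD, hyx⟩ := mem_closure_iff_seq_limit.1 (hDd ⟨x, hx⟩)
  exact hc (fun k => (y k : Y)) x (fun k => (y k).2) hx
    ((continuous_subtype_val.tendsto _).comp hyx) fun k => ht _ (hyD k)

end TimeCalculus


/-! ### Continuity of integrals of superposition operators. -/

section Nemytskii

variable {α : Type*} [MeasurableSpace α] {μ : Measure α}

lemma exists_subseq_tendsto_ae_of_tendsto_Lp {E : Type*} [NormedAddCommGroup E] {p : ℝ≥0∞}
    [Fact (1 ≤ p)] {f : ℕ → Lp E p μ} {g : Lp E p μ} (h : Tendsto f atTop (𝓝 g)) :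
    ∃ ns : ℕ → ℕ, StrictMono ns ∧ ∀ᵐ x ∂μ, Tendsto (fun k => f (ns k) x) atTop (𝓝 (g x)) :=
  (tendstoInMeasure_of_tendsto_Lp h).exists_seq_tendsto_ae

lemma integral_abs_eq_norm (m : Lp ℝ 1 μ) : ∫ x, |m x| ∂μ = ‖m‖ := by
  rw [L1.norm_eq_integral_norm]; rfl

/-- Integrals of a bounded continuous function of `f` and `a` against `m` depend continuously on
`f`, `a` and `m`. -/
lemma continuous_integral_nemytskii {p : ℝ≥0∞} [Fact (1 ≤ p)] {K : ℝ → ℝ → ℝ} {B : ℝ}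
    (hK : Continuous fun y : ℝ × ℝ => K y.1 y.2) (hB : ∀ s r, |K s r| ≤ B) :
    Continuous fun w : Lp ℝ p μ × Lp ℝ 1 μ × Lp ℝ 1 μ =>
      ∫ x, K (w.1 x) (w.2.1 x) * w.2.2 x ∂μ := by
  have hmeas : ∀ w : Lp ℝ p μ × Lp ℝ 1 μ, AEStronglyMeasurable (fun x => K (w.1 x) (w.2 x)) μ :=
    fun w => hK.comp_aestronglyMeasurable
      ((Lp.aestronglyMeasurable w.1).prodMk (Lp.aestronglyMeasurable w.2))
  have hint : ∀ (w : Lp ℝ p μ × Lp ℝ 1 μ) (m : Lp ℝ 1 μ),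
      Integrable (fun x => K (w.1 x) (w.2 x) * m x) μ := fun w m =>
    (L1.integrable_coeFn m).bdd_mul (hmeas w) (Eventually.of_forall fun x => hB _ _)
  refine continuous_iff_seqContinuous.2 fun y w hy => ?_
  -- Each subsequence has a further one along which norm convergence becomes convergence almost
  -- everywhere, as dominated convergence requires.
  refine tendsto_of_subseq_tendsto fun ns hns => ?_
  have hy' := hy.comp hns
  have t1 : Tendsto (fun k => (y (ns k)).1) atTop (𝓝 w.1) := (continuous_fst.tendsto w).comp hy'
  have t2 : Tendsto (fun k => (y (ns k)).2.1) atTop (𝓝 w.2.1) :=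
    ((continuous_fst.comp continuous_snd).tendsto w).comp hy'
  have t3 : Tendsto (fun k => (y (ns k)).2.2) atTop (𝓝 w.2.2) :=
    ((continuous_snd.comp continuous_snd).tendsto w).comp hy'
  obtain ⟨m1, hm1, a1⟩ := exists_subseq_tendsto_ae_of_tendsto_Lp t1
  obtain ⟨m2, hm2, a2⟩ := exists_subseq_tendsto_ae_of_tendsto_Lp (t2.comp hm1.tendsto_atTop)
  refine ⟨fun k => m1 (m2 k), ?_⟩
  set v := fun k => y (ns (m1 (m2 k))) with hv
  have c3 : Tendsto (fun k => (v k).2.2) atTop (𝓝 w.2.2) :=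
    t3.comp (hm1.tendsto_atTop.comp hm2.tendsto_atTop)
  -- The change of the weight is controlled by `B` times its `L¹` norm, with no pointwise
  -- convergence; with the weight then frozen, `e2` is dominated convergence.
  have e1 : Tendsto (fun k => ∫ x, K ((v k).1 x) ((v k).2.1 x) * ((v k).2.2 - w.2.2 : Lp ℝ 1 μ) x ∂μ)
      atTop (𝓝 0) := by
    have hz : Tendsto (fun k => B * ‖(v k).2.2 - w.2.2‖) atTop (𝓝 0) := by
      have := (tendsto_iff_norm_sub_tendsto_zero.1 c3).const_mul B
      rwa [mul_zero] at this
    refine squeeze_zero_norm (fun k => ?_) hz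
    rw [← integral_abs_eq_norm, ← integral_const_mul]
    refine norm_integral_le_of_norm_le ((L1.integrable_coeFn _).abs.const_mul B)
      (Eventually.of_forall fun x => ?_)
    rw [Real.norm_eq_abs, abs_mul]
    exact mul_le_mul_of_nonneg_right (hB _ _) (abs_nonneg _)
  have e2 : Tendsto (fun k => ∫ x, K ((v k).1 x) ((v k).2.1 x) * w.2.2 x ∂μ)
      atTop (𝓝 (∫ x, K (w.1 x) (w.2.1 x) * w.2.2 x ∂μ)) := by
    refine tendsto_integral_of_dominated_convergence (fun x => B * |w.2.2 x|)
      (fun k => (hint ((v k).1, (v k).2.1) w.2.2).aestronglyMeasurable)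
      ((L1.integrable_coeFn _).abs.const_mul B) (fun k => Eventually.of_forall fun x => ?_) ?_
    · rw [Real.norm_eq_abs, abs_mul]
      exact mul_le_mul_of_nonneg_right (hB _ _) (abs_nonneg _)
    · filter_upwards [a1, a2] with x h1 h2
      exact ((hK.tendsto _).comp ((h1.comp hm2.tendsto_atTop).prodMk_nhds h2)).mul_const _
  have := e1.add e2
  rw [zero_add] at this
  refine this.congr fun k => ?_
  rw [← integral_add (hint ((v k).1, (v k).2.1) _) (hint ((v k).1, (v k).2.1) _)]
  refine integral_congr_ae ?_
  filter_upwards [Lp.coeFn_sub (v k).2.2 w.2.2] with x hx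
  rw [hx, Pi.sub_apply]
  ring

end Nemytskii

/-! ### Gradient, strain and elastic density as bounded linear and bilinear maps. -/

section Forms

variable {n : ℕ} {Ω : Set (Eu n)} {p : ℝ≥0∞} [Fact (1 ≤ p)]
  {F : Type*} [NormedAddCommGroup F] [NormedSpace ℝ F]

/-- The inclusion of `W^{1,p}` into `L^p`. -/
def W1.toLpL (Ω : Set (Eu n)) (p : ℝ≥0∞) [Fact (1 ≤ p)] (F : Type*) [NormedAddCommGroup F]
    [NormedSpace ℝ F] : W1 Ω p F →L[ℝ] Lp F p (volume.restrict Ω) :=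
  (ContinuousLinearMap.fst ℝ _ _).comp (sobolevW1 Ω p F).subtypeL

/-- The weak partial derivative as a continuous linear map. -/
def W1.partialL (Ω : Set (Eu n)) (p : ℝ≥0∞) [Fact (1 ≤ p)] (F : Type*) [NormedAddCommGroup F]
    [NormedSpace ℝ F] (i : Fin n) : W1 Ω p F →L[ℝ] Lp F p (volume.restrict Ω) :=
  ((ContinuousLinearMap.proj i).comp (ContinuousLinearMap.snd ℝ _ _)).comp
    (sobolevW1 Ω p F).subtypeL

@[simp] lemma W1.toLpL_apply (w : W1 Ω p F) : W1.toLpL Ω p F w = w.toLp := rfl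
@[simp] lemma W1.partialL_apply (w : W1 Ω p F) (i : Fin n) :
    W1.partialL Ω p F i w = w.partialLp i := rfl

lemma W1.norm_toLp_le (w : W1 Ω p F) : ‖w.toLp‖ ≤ ‖w‖ := norm_fst_le w.1

lemma W1.norm_partialLp_le (w : W1 Ω p F) (i : Fin n) : ‖w.partialLp i‖ ≤ ‖w‖ :=
  (norm_le_pi_norm w.1.2 i).trans (norm_snd_le w.1)

/-- Separability is what allows the exceptional null sets of times to be chosen independently of the
test function. -/
instance instSecondCountableW1 [Fact (p ≠ ⊤)] [TopologicalSpace.SeparableSpace F] :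
    SecondCountableTopology (W1 Ω p F) := by
  have h : SecondCountableTopology (Lp F p (volume.restrict Ω)) := Lp.SecondCountableTopology
  exact TopologicalSpace.Subtype.secondCountableTopology _

/-- The gradient as a continuous linear map. -/
def gradL (Ω : Set (Eu n)) (p : ℝ≥0∞) [Fact (1 ≤ p)] :
    W1 Ω p ℝ →L[ℝ] Lp (Eu n) p (volume.restrict Ω) :=
  ∑ i, ((ContinuousLinearMap.toSpanSingleton ℝ
    (EuclideanSpace.single i (1 : ℝ) : Eu n)).compLpL p (volume.restrict Ω)).comp
      (W1.partialL Ω p ℝ i)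

lemma gradL_ae (z : W1 Ω p ℝ) : gradL Ω p z =ᵐ[volume.restrict Ω] grad z := by
  have h : ∀ i : Fin n, ((ContinuousLinearMap.toSpanSingleton ℝ
      (EuclideanSpace.single i (1 : ℝ) : Eu n)).compLpL p (volume.restrict Ω)) (z.partialLp i)
      =ᵐ[volume.restrict Ω] fun x => z.partialLp i x • (EuclideanSpace.single i (1 : ℝ) : Eu n) :=
    fun i => by
      filter_upwards [ContinuousLinearMap.coeFn_compLpL (ContinuousLinearMap.toSpanSingleton ℝ
        (EuclideanSpace.single i (1 : ℝ) : Eu n)) (z.partialLp i)] with x hx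
      rw [hx, ContinuousLinearMap.toSpanSingleton_apply]
  have h2 := Lp.coeFn_finsetSum Finset.univ fun i : Fin n =>
    ((ContinuousLinearMap.toSpanSingleton ℝ
      (EuclideanSpace.single i (1 : ℝ) : Eu n)).compLpL p (volume.restrict Ω)) (z.partialLp i)
  have h1 : gradL Ω p z = ∑ i : Fin n, ((ContinuousLinearMap.toSpanSingleton ℝ
      (EuclideanSpace.single i (1 : ℝ) : Eu n)).compLpL p (volume.restrict Ω)) (z.partialLp i) := by
    simp [gradL]
  rw [h1]
  filter_upwards [h2, ae_all_iff.2 h] with x hx hx'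
  rw [hx]
  ext j
  simp [hx', grad, Finset.sum_apply, Pi.single_apply]

/-- The components of the linearized strain as continuous linear maps. -/
def strainL (Ω : Set (Eu n)) (i j : Fin n) :
    W1 Ω 2 (Eu n) →L[ℝ] Lp ℝ 2 (volume.restrict Ω) :=
  (1 / 2 : ℝ) • (((EuclideanSpace.proj i : Eu n →L[ℝ] ℝ).compLpL 2 (volume.restrict Ω)).comp
      (W1.partialL Ω 2 (Eu n) j)
    + ((EuclideanSpace.proj j : Eu n →L[ℝ] ℝ).compLpL 2 (volume.restrict Ω)).comp
      (W1.partialL Ω 2 (Eu n) i))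

lemma strainL_ae (i j : Fin n) (v : W1 Ω 2 (Eu n)) :
    strainL Ω i j v =ᵐ[volume.restrict Ω] fun x => strain v x i j := by
  have h : ∀ i j : Fin n, ((EuclideanSpace.proj i : Eu n →L[ℝ] ℝ).compLpL 2 (volume.restrict Ω))
      (v.partialLp j) =ᵐ[volume.restrict Ω] fun x => v.partialLp j x i := fun i j =>
    ContinuousLinearMap.coeFn_compLpL (EuclideanSpace.proj i : Eu n →L[ℝ] ℝ) (v.partialLp j)
  have h1 : strainL Ω i j v = (1 / 2 : ℝ) •
      (((EuclideanSpace.proj i : Eu n →L[ℝ] ℝ).compLpL 2 (volume.restrict Ω)) (v.partialLp j)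
      + ((EuclideanSpace.proj j : Eu n →L[ℝ] ℝ).compLpL 2 (volume.restrict Ω))
        (v.partialLp i)) := rfl
  rw [h1]
  filter_upwards [Lp.coeFn_smul (1 / 2 : ℝ)
      (((EuclideanSpace.proj i : Eu n →L[ℝ] ℝ).compLpL 2 (volume.restrict Ω)) (v.partialLp j)
      + ((EuclideanSpace.proj j : Eu n →L[ℝ] ℝ).compLpL 2 (volume.restrict Ω))
        (v.partialLp i)), Lp.coeFn_add
      (((EuclideanSpace.proj i : Eu n →L[ℝ] ℝ).compLpL 2 (volume.restrict Ω)) (v.partialLp j))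
      (((EuclideanSpace.proj j : Eu n →L[ℝ] ℝ).compLpL 2 (volume.restrict Ω))
        (v.partialLp i)), h i j, h j i] with x h1 h2 h3 h4
  rw [h1, Pi.smul_apply, h2, Pi.add_apply, h3, h4]
  simp [strain]

/-- The bilinear expression with coefficients `C` in families of square integrable functions, with
values in `L¹`. -/
def tensorForm {α X : Type*} [MeasurableSpace α] (μ : Measure α) [NormedAddCommGroup X]
    [NormedSpace ℝ X] (C : Tensor4 n) (S : Fin n → Fin n → X →L[ℝ] Lp ℝ 2 μ) :
    X →L[ℝ] X →L[ℝ] Lp ℝ 1 μ :=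
  ∑ i, ∑ j, ∑ k, ∑ l, C i j k l •
    ((ContinuousLinearMap.mul ℝ ℝ).holderL μ 2 2 1).bilinearComp (S k l) (S i j)

lemma tensorForm_apply {α X : Type*} [MeasurableSpace α] (μ : Measure α) [NormedAddCommGroup X]
    [NormedSpace ℝ X] (C : Tensor4 n) (S : Fin n → Fin n → X →L[ℝ] Lp ℝ 2 μ) (u v : X) :
    tensorForm μ C S u v = ∑ i, ∑ j, ∑ k, ∑ l, C i j k l •
      (ContinuousLinearMap.mul ℝ ℝ).holder 1 (S k l u) (S i j v) := by
  simp [tensorForm]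

/-- The density `C ε(u) : ε(v)` as a continuous bilinear map into `L¹`. -/
def energyForm (Ω : Set (Eu n)) (C : Tensor4 n) :
    W1 Ω 2 (Eu n) →L[ℝ] W1 Ω 2 (Eu n) →L[ℝ] Lp ℝ 1 (volume.restrict Ω) :=
  tensorForm (volume.restrict Ω) C (strainL Ω)

lemma Lp.coeFn_finsetSum_smul {α ι E : Type*} [MeasurableSpace α] {μ : Measure α}
    [NormedAddCommGroup E] [NormedSpace ℝ E] {r : ℝ≥0∞} (s : Finset ι) (c : ι → ℝ)
    {f : ι → Lp E r μ} {g : ι → α → E} (h : ∀ i ∈ s, f i =ᵐ[μ] g i) :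
    (∑ i ∈ s, c i • f i : Lp E r μ) =ᵐ[μ] fun x => ∑ i ∈ s, c i • g i x := by
  classical
  induction s using Finset.induction_on with
  | empty => simpa using! Lp.coeFn_zero E r μ
  | insert a s ha ih =>
    simp only [Finset.sum_insert ha]
    filter_upwards [Lp.coeFn_add (c a • f a) (∑ i ∈ s, c i • f i), Lp.coeFn_smul (c a) (f a),
      h a (Finset.mem_insert_self a s), ih fun i hi => h i (Finset.mem_insert_of_mem hi)]
      with x h1 h2 h3 h4
    rw [h1, Pi.add_apply, h2, Pi.smul_apply, h3, h4]

lemma energyForm_ae (C : Tensor4 n) (u v : W1 Ω 2 (Eu n)) :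
    energyForm Ω C u v =ᵐ[volume.restrict Ω] fun x => frob (C.app (strain u x)) (strain v x) := by
  have h2 : energyForm Ω C u v = ∑ q : (Fin n × Fin n) × Fin n × Fin n,
      C q.1.1 q.1.2 q.2.1 q.2.2 •
      (ContinuousLinearMap.mul ℝ ℝ).holder 1 (strainL Ω q.2.1 q.2.2 u)
        (strainL Ω q.1.1 q.1.2 v) := by
    rw [energyForm, tensorForm_apply]; simp only [Fintype.sum_prod_type]
  rw [h2]
  refine (Lp.coeFn_finsetSum_smul (g := fun (q : (Fin n × Fin n) × Fin n × Fin n) x =>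
    strain u x q.2.1 q.2.2 * strain v x q.1.1 q.1.2) _ _ fun q _ => ?_).trans
      (Eventually.of_forall fun x => ?_)
  · filter_upwards [(ContinuousLinearMap.mul ℝ ℝ).coeFn_holder (r := 1) (strainL Ω q.2.1 q.2.2 u)
      (strainL Ω q.1.1 q.1.2 v), strainL_ae q.2.1 q.2.2 u, strainL_ae q.1.1 q.1.2 v]
      with x a b c
    rw [a, b, c]; rfl
  · simp only [Fintype.sum_prod_type, frob, Tensor4.app, Matrix.of_apply, Finset.sum_mul,
      smul_eq_mul, mul_assoc]

lemma strain_isSymm (v : W1 Ω 2 (Eu n)) (x : Eu n) : (strain v x).IsSymm := by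
  ext i j
  simp [strain, add_comm]

lemma energyForm_nonneg {C : Tensor4 n} (hC : IsStiffnessTensor C) (v : W1 Ω 2 (Eu n)) (x : Eu n) :
    0 ≤ frob (C.app (strain v x)) (strain v x) := by
  obtain ⟨c₀, h0, h⟩ := hC.coercive
  rw [frob_comm]
  refine le_trans (mul_nonneg h0.le ?_) (h _ (strain_isSymm v x))
  exact Finset.sum_nonneg fun i _ => Finset.sum_nonneg fun j _ => mul_self_nonneg _

lemma energyForm_comm {C : Tensor4 n} (hC : IsStiffnessTensor C) (u v : W1 Ω 2 (Eu n)) :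
    energyForm Ω C u v = energyForm Ω C v u := by
  refine Lp.ext ?_
  filter_upwards [energyForm_ae C u v, energyForm_ae C v u] with x h1 h2
  rw [h1, h2, Tensor4.frob_app_symm hC]

end Forms


/-! ### Extension of the coefficients from `[0,1]` to the real line. -/

section Extension

/-- `H` is a bounded `C¹` function on `ℝ` with derivative `H'`, both bounded by `B`. -/
structure IsBoundedC1 (H H' : ℝ → ℝ) (B : ℝ) : Prop where
  hasDerivAt : ∀ s, HasDerivAt H (H' s) s
  continuous_deriv : Continuous H'
  bound : ∀ s, |H s| ≤ B
  bound_deriv : ∀ s, |H' s| ≤ B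

namespace IsBoundedC1

variable {H H' : ℝ → ℝ} {B : ℝ}

lemma continuous (hH : IsBoundedC1 H H' B) : Continuous H :=
  continuous_iff_continuousAt.2 fun s => (hH.hasDerivAt s).continuousAt

lemma nonneg (hH : IsBoundedC1 H H' B) : 0 ≤ B := (abs_nonneg _).trans (hH.bound 0)

lemma abs_sub_le (hH : IsBoundedC1 H H' B) (s r : ℝ) : |H s - H r| ≤ B * |s - r| := by
  have := convex_univ.norm_image_sub_le_of_norm_hasDerivWithin_le (f := H) (f' := H') (C := B)
    (fun x _ => (hH.hasDerivAt x).hasDerivWithinAt) (fun x _ => hH.bound_deriv x)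
    (mem_univ r) (mem_univ s)
  simpa using this

end IsBoundedC1

/-- A `C¹` function on `[0,1]` extends to a bounded `C¹` function on `ℝ` with bounded derivative. -/
lemma exists_isBoundedC1_extension {h : ℝ → ℝ} (hh : ContDiffOn ℝ 1 h (Icc 0 1)) :
    ∃ H H' B, IsBoundedC1 H H' B ∧ ∀ s ∈ Icc (0 : ℝ) 1, H s = h s ∧ H' s = deriv01 h s := by
  have hd : ContinuousOn (deriv01 h) (Icc 0 1) :=
    hh.continuousOn_derivWithin (uniqueDiffOn_Icc zero_lt_one) le_rfl
  set d : ℝ → ℝ := IccExtend (zero_le_one' ℝ) ((Icc (0 : ℝ) 1).domRestrict (deriv01 h)) with hdd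
  have hdc : Continuous d := (continuousOn_iff_continuous_domRestrict.1 hd).Icc_extend'
  -- The cutoff `max 0 (1 - dist(s, [0,1]))` gives the extended derivative compact support, which
  -- keeps its primitive bounded.
  set χ : ℝ → ℝ := fun s => max 0 (1 - |s - projIcc 0 1 zero_le_one s|) with hχ
  have hχc : Continuous χ := by
    have : Continuous fun s : ℝ => (projIcc (0 : ℝ) 1 zero_le_one s : ℝ) :=
      continuous_subtype_val.comp continuous_projIcc
    fun_prop
  have hχ1 : ∀ s ∈ Icc (0 : ℝ) 1, χ s = 1 := fun s hs => by
    simp [hχ, projIcc_of_mem zero_le_one hs]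
  have hsupp : HasCompactSupport χ := by
    refine HasCompactSupport.intro (K := Icc (-1) 2) isCompact_Icc fun s hs => ?_
    have h1 := (projIcc (0 : ℝ) 1 zero_le_one s).2
    simp only [hχ]
    refine max_eq_left ?_
    rcases lt_or_ge s (-1) with h2 | h2
    · rw [abs_of_nonpos (by linarith [h1.1])]; linarith [h1.1]
    · have h3 : 2 < s := by by_contra h3; exact hs ⟨h2, not_lt.1 h3⟩
      rw [abs_of_nonneg (by linarith [h1.2])]; linarith [h1.2]
  set H' : ℝ → ℝ := fun s => χ s * d s with hH'
  have hcs : HasCompactSupport H' := hsupp.mul_right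
  have hc' : Continuous H' := hχc.mul hdc
  have hint : Integrable H' := hc'.integrable_of_hasCompactSupport hcs
  obtain ⟨M, hM⟩ := hcs.exists_bound_of_continuous hc'
  set H : ℝ → ℝ := fun s => h 0 + ∫ r in (0 : ℝ)..s, H' r with hH
  refine ⟨H, H', max M (|h 0| + ∫ r, ‖H' r‖), ⟨fun s => ?_, hc', fun s => ?_, fun s => ?_⟩, ?_⟩
  · exact (intervalIntegral.integral_hasDerivAt_right (hc'.intervalIntegrable _ _)
      (hc'.stronglyMeasurableAtFilter _ _) hc'.continuousAt).const_add _
  · refine le_trans ?_ (le_max_right _ _)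
    refine (abs_add_le _ _).trans (add_le_add_right ?_ _)
    rw [← Real.norm_eq_abs]
    refine (intervalIntegral.norm_integral_le_integral_norm_uIoc).trans ?_
    exact setIntegral_le_integral hint.norm (Eventually.of_forall fun _ => norm_nonneg _)
  · exact (hM s).trans (le_max_left _ _)
  · have hd01 : ∀ s ∈ Icc (0 : ℝ) 1, H' s = deriv01 h s := fun s hs => by
      simp only [hH', hχ1 s hs, one_mul, hdd, IccExtend_of_mem zero_le_one _ hs]
      rfl
    refine fun s hs => ⟨?_, hd01 s hs⟩
    have hsub : Icc 0 s ⊆ Icc (0 : ℝ) 1 := Icc_subset_Icc le_rfl hs.2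
    have := intervalIntegral.integral_eq_sub_of_hasDerivAt_of_le hs.1
      (hh.continuousOn.mono hsub) (f' := H') (fun r hr => ?_) (hc'.intervalIntegrable _ _)
    · simp only [hH, this]; ring
    · have hr1 : r ∈ Icc (0 : ℝ) 1 := hsub (Ioo_subset_Icc_self hr)
      rw [hd01 r hr1]
      exact ((hh.differentiableOn one_ne_zero) r hr1).hasDerivWithinAt.hasDerivAt
        (Icc_mem_nhds hr.1 (hr.2.trans_le hs.2))

end Extension

/-! ### A bounded truncation of nonnegative numbers. -/

section Truncation

/-- The truncation `a / (1 + ε a)`. -/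
def trunc (ε a : ℝ) : ℝ := a / (1 + ε * a)

variable {ε a b : ℝ}

lemma trunc_nonneg (hε : 0 ≤ ε) (ha : 0 ≤ a) : 0 ≤ trunc ε a := by
  unfold trunc; positivity

lemma trunc_le_self (hε : 0 ≤ ε) (ha : 0 ≤ a) : trunc ε a ≤ a := by
  unfold trunc
  exact div_le_self ha (by nlinarith [mul_nonneg hε ha])

/-- This bound makes the product of `H(z)` with the truncated density Lipschitz in `z` with respect
to `L¹`. -/
lemma trunc_le_inv (hε : 0 < ε) (ha : 0 ≤ a) : trunc ε a ≤ ε⁻¹ := by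
  unfold trunc
  rw [div_le_iff₀ (by positivity)]
  have : ε⁻¹ * (1 + ε * a) = ε⁻¹ + a := by field_simp
  rw [this]
  have : 0 ≤ ε⁻¹ := by positivity
  linarith

lemma abs_trunc_le (hε : 0 ≤ ε) (ha : 0 ≤ a) : |trunc ε a| ≤ |a| := by
  rw [abs_of_nonneg (trunc_nonneg hε ha), abs_of_nonneg ha]; exact trunc_le_self hε ha

/-- The difference equals `(a - b) / ((1 + ε a)(1 + ε b))`, and the denominator is at least 1. -/
lemma abs_trunc_sub_le (hε : 0 ≤ ε) (ha : 0 ≤ a) (hb : 0 ≤ b) :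
    |trunc ε a - trunc ε b| ≤ |a - b| := by
  have h1 : 1 ≤ 1 + ε * a := by nlinarith [mul_nonneg hε ha]
  have h2 : 1 ≤ 1 + ε * b := by nlinarith [mul_nonneg hε hb]
  have h3 : trunc ε a - trunc ε b = (a - b) / ((1 + ε * a) * (1 + ε * b)) := by
    unfold trunc; field_simp; ring
  rw [h3, abs_div]
  refine div_le_self (abs_nonneg _) ?_
  rw [abs_of_pos (by positivity)]
  nlinarith

lemma hasDerivAt_trunc (hε : 0 ≤ ε) (ha : 0 ≤ a) :
    HasDerivAt (trunc ε) (1 / (1 + ε * a) ^ 2) a := by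
  have h1 : (1 + ε * a) ≠ 0 := by positivity
  have h := (hasDerivAt_id a).div (((hasDerivAt_id a).const_mul ε).const_add 1) h1
  refine h.congr_deriv ?_
  simp only [id]
  congr 1
  ring

lemma trunc_deriv_mem (hε : 0 ≤ ε) (ha : 0 ≤ a) :
    0 ≤ 1 / (1 + ε * a) ^ 2 ∧ 1 / (1 + ε * a) ^ 2 ≤ 1 := by
  have h1 : 1 ≤ 1 + ε * a := by nlinarith [mul_nonneg hε ha]
  exact ⟨by positivity, div_le_one_of_le₀ (one_le_pow₀ h1) (by positivity)⟩

lemma measurable_trunc (ε : ℝ) : Measurable (trunc ε) := by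
  unfold trunc; fun_prop

end Truncation

/-! ### Regularity of the truncated elastic energy. -/

section TruncatedEnergy

variable {α : Type*} [MeasurableSpace α] {μ : Measure α}

lemma integral_abs_le_norm_Lp [IsFiniteMeasure μ] {p : ℝ≥0∞} [hp : Fact (1 ≤ p)] :
    ∃ c, 0 ≤ c ∧ ∀ f : Lp ℝ p μ, ∫ x, |f x| ∂μ ≤ c * ‖f‖ := by
  refine ⟨(μ univ ^ (1 / (1 : ℝ≥0∞).toReal - 1 / p.toReal)).toReal,
    ENNReal.toReal_nonneg, fun f => ?_⟩
  have h1 := eLpNorm_le_eLpNorm_mul_rpow_measure_univ (μ := μ) (p := 1) (q := p) hp.out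
    (Lp.aestronglyMeasurable f)
  have h2 : ∫ x, |f x| ∂μ = (eLpNorm f 1 μ).toReal := by
    rw [eLpNorm_one_eq_lintegral_enorm, ← integral_norm_eq_lintegral_enorm
      (Lp.aestronglyMeasurable f)]
    rfl
  rw [h2, Lp.norm_def, mul_comm, ← ENNReal.toReal_mul]
  refine ENNReal.toReal_mono (ENNReal.mul_ne_top (Lp.eLpNorm_ne_top f) ?_) h1
  refine ENNReal.rpow_ne_top_of_nonneg ?_ (measure_ne_top _ _)
  rcases eq_or_ne p ⊤ with rfl | h
  · simp
  · have : 1 ≤ p.toReal := by simpa using (ENNReal.toReal_le_toReal ENNReal.one_ne_top h).2 hp.out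
    have : 1 / p.toReal ≤ 1 := div_le_one_of_le₀ this (by linarith)
    rw [ENNReal.toReal_one, one_div_one]; linarith

lemma Lp.integrable_two [IsFiniteMeasure μ] (f : Lp ℝ 2 μ) : Integrable f μ :=
  (Lp.memLp f).integrable one_le_two

variable {X Y : Type*} [NormedAddCommGroup X] [NormedSpace ℝ X] [NormedAddCommGroup Y]
  [NormedSpace ℝ Y]

/-- The truncated energy `∫ ½ H(z) trunc ε (A v v) + F(z)`. -/
def truncEnergy (μ : Measure α) (Λ : X →L[ℝ] Lp ℝ 2 μ) (A : Y →L[ℝ] Y →L[ℝ] Lp ℝ 1 μ)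
    (H F : ℝ → ℝ) (ε : ℝ) (w : X × Y) : ℝ :=
  ∫ x, (1 / 2 * H (Λ w.1 x) * trunc ε (A w.2 w.2 x) + F (Λ w.1 x)) ∂μ

/-- The derivative of the truncated energy at `w` in the direction `v`. -/
def truncEnergyDeriv (μ : Measure α) (Λ : X →L[ℝ] Lp ℝ 2 μ) (A : Y →L[ℝ] Y →L[ℝ] Lp ℝ 1 μ)
    (H H' F' : ℝ → ℝ) (ε : ℝ) (w v : X × Y) : ℝ :=
  ∫ x, (1 / 2 * H' (Λ w.1 x) * Λ v.1 x * trunc ε (A w.2 w.2 x)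
    + H (Λ w.1 x) * (1 / (1 + ε * A w.2 w.2 x) ^ 2) * A w.2 v.2 x + F' (Λ w.1 x) * Λ v.1 x) ∂μ

variable [IsFiniteMeasure μ] {Λ : X →L[ℝ] Lp ℝ 2 μ} {A : Y →L[ℝ] Y →L[ℝ] Lp ℝ 1 μ}
  {H H' F F' : ℝ → ℝ} {B B' ε : ℝ}

lemma integrable_comp_isBoundedC1 (hH : IsBoundedC1 H H' B) {f : α → ℝ}
    (hf : AEStronglyMeasurable f μ) : Integrable (fun x => H (f x)) μ :=
  Integrable.of_bound (hH.continuous.comp_aestronglyMeasurable hf) B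
    (Eventually.of_forall fun _ => hH.bound _)

lemma integrable_truncEnergy (hH : IsBoundedC1 H H' B) (hF : IsBoundedC1 F F' B') (hε : 0 < ε)
    {f a : α → ℝ} (hf : AEStronglyMeasurable f μ) (ha : Integrable a μ) (ha0 : ∀ᵐ x ∂μ, 0 ≤ a x) :
    Integrable (fun x => 1 / 2 * H (f x) * trunc ε (a x) + F (f x)) μ := by
  refine Integrable.add ?_ (integrable_comp_isBoundedC1 hF hf)
  have h1 : Integrable (fun x => trunc ε (a x)) μ := by
    refine ha.mono ((measurable_trunc ε).comp_aemeasurable ha.aemeasurable).aestronglyMeasurable ?_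
    filter_upwards [ha0] with x hx
    exact abs_trunc_le hε.le hx
  refine h1.bdd_mul (c := 1 / 2 * B)
    ((hH.continuous.comp_aestronglyMeasurable hf).const_mul (1 / 2))
    (Eventually.of_forall fun x => ?_)
  rw [norm_mul]
  norm_num
  exact hH.bound _

/-- In the first variable the bound `ε⁻¹` of the truncation is used, so this constant degenerates as
`ε → 0`. In the second, `A` is bilinear into `L¹` and the truncation is 1-Lipschitz. -/
lemma lipschitzOnWith_truncEnergy (hH : IsBoundedC1 H H' B) (hF : IsBoundedC1 F F' B')
    (hε : 0 < ε) (hA : ∀ v, ∀ᵐ x ∂μ, 0 ≤ A v v x) (R : ℝ) :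
    ∃ K, LipschitzOnWith K (truncEnergy μ Λ A H F ε) (Metric.closedBall 0 R) := by
  obtain ⟨c, hc0, hc⟩ := integral_abs_le_norm_Lp (μ := μ) (p := 2)
  set C₁ := B * ε⁻¹ + B'
  have hC₁ : 0 ≤ C₁ := add_nonneg (mul_nonneg hH.nonneg (by positivity)) hF.nonneg
  refine ⟨Real.toNNReal (C₁ * (c * ‖Λ‖) + B * (‖A‖ * (2 * R))), ?_⟩
  refine LipschitzOnWith.of_dist_le' fun w hw v hv => ?_
  rw [mem_closedBall_zero_iff] at hw hv
  have i1 := integrable_truncEnergy hH hF hε (Lp.aestronglyMeasurable (Λ w.1))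
    (L1.integrable_coeFn (A w.2 w.2)) (hA w.2)
  have i2 := integrable_truncEnergy hH hF hε (Lp.aestronglyMeasurable (Λ v.1))
    (L1.integrable_coeFn (A v.2 v.2)) (hA v.2)
  have iz : Integrable (fun x => |(Λ w.1 - Λ v.1 : Lp ℝ 2 μ) x|) μ := (Lp.integrable_two _).abs
  have ia : Integrable (fun x => |(A w.2 w.2 - A v.2 v.2 : Lp ℝ 1 μ) x|) μ :=
    (L1.integrable_coeFn _).abs
  have key : ‖truncEnergy μ Λ A H F ε w - truncEnergy μ Λ A H F ε v‖ ≤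
      ∫ x, (C₁ * |(Λ w.1 - Λ v.1 : Lp ℝ 2 μ) x| + B * |(A w.2 w.2 - A v.2 v.2 : Lp ℝ 1 μ) x|) ∂μ := by
    rw [truncEnergy, truncEnergy, ← integral_sub i1 i2]
    refine norm_integral_le_of_norm_le ((iz.const_mul _).add (ia.const_mul _)) ?_
    filter_upwards [Lp.coeFn_sub (Λ w.1) (Λ v.1), Lp.coeFn_sub (A w.2 w.2) (A v.2 v.2),
      hA w.2, hA v.2] with x hx1 hx2 hx3 hx4
    rw [hx1, hx2, Pi.sub_apply, Pi.sub_apply]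
    generalize (Λ w.1) x = s at *
    generalize (Λ v.1) x = r at *
    generalize (A w.2 w.2) x = a at *
    generalize (A v.2 v.2) x = b at *
    have e1 : 1 / 2 * H s * trunc ε a + F s - (1 / 2 * H r * trunc ε b + F r)
        = 1 / 2 * ((H s - H r) * trunc ε a) + 1 / 2 * (H r * (trunc ε a - trunc ε b))
          + (F s - F r) := by ring
    have b1 : |(H s - H r) * trunc ε a| ≤ B * |s - r| * ε⁻¹ := by
      rw [abs_mul, abs_of_nonneg (trunc_nonneg hε.le hx3)]
      exact mul_le_mul (hH.abs_sub_le _ _) (trunc_le_inv hε hx3) (trunc_nonneg hε.le hx3)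
        (mul_nonneg hH.nonneg (abs_nonneg _))
    have b2 : |H r * (trunc ε a - trunc ε b)| ≤ B * |a - b| := by
      rw [abs_mul]
      exact mul_le_mul (hH.bound _) (abs_trunc_sub_le hε.le hx3 hx4) (abs_nonneg _) hH.nonneg
    have b3 := hF.abs_sub_le s r
    have p1 : 0 ≤ B * |s - r| * ε⁻¹ :=
      mul_nonneg (mul_nonneg hH.nonneg (abs_nonneg _)) (by positivity)
    have p2 : 0 ≤ B * |a - b| := mul_nonneg hH.nonneg (abs_nonneg _)
    rw [e1, Real.norm_eq_abs]
    refine (abs_add_le _ _).trans ?_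
    refine (add_le_add_left (abs_add_le _ _) _).trans ?_
    rw [abs_mul (1 / 2 : ℝ), abs_mul (1 / 2 : ℝ), abs_of_pos (show (0 : ℝ) < 1 / 2 by norm_num)]
    have : C₁ * |s - r| = B * |s - r| * ε⁻¹ + B' * |s - r| := by simp only [C₁]; ring
    linarith
  rw [dist_eq_norm]
  refine key.trans ?_
  rw [integral_add (iz.const_mul _) (ia.const_mul _), integral_const_mul, integral_const_mul,
    integral_abs_eq_norm]
  have n1 : ∫ x, |(Λ w.1 - Λ v.1 : Lp ℝ 2 μ) x| ∂μ ≤ c * ‖Λ‖ * dist w v := by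
    refine (hc _).trans ?_
    rw [← map_sub, mul_assoc, dist_eq_norm]
    exact mul_le_mul_of_nonneg_left ((Λ.le_opNorm _).trans
      (mul_le_mul_of_nonneg_left (norm_fst_le (w - v)) (norm_nonneg _))) hc0
  have n2 : ‖A w.2 w.2 - A v.2 v.2‖ ≤ ‖A‖ * (2 * R) * dist w v := by
    have e : A w.2 w.2 - A v.2 v.2 = A w.2 (w.2 - v.2) + A (w.2 - v.2) v.2 := by
      simp only [map_sub, sub_apply]; abel
    have hw2 : ‖w.2‖ ≤ R := (norm_snd_le w).trans hw
    have hv2 : ‖v.2‖ ≤ R := (norm_snd_le v).trans hv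
    have hd : ‖w.2 - v.2‖ ≤ dist w v := by rw [dist_eq_norm]; exact norm_snd_le (w - v)
    rw [e]
    refine (norm_add_le _ _).trans ?_
    have hR : 0 ≤ R := (norm_nonneg _).trans hw
    have q1 : ‖A w.2 (w.2 - v.2)‖ ≤ ‖A‖ * R * dist w v :=
      (A.le_opNorm₂ _ _).trans (by gcongr)
    have q2 : ‖A (w.2 - v.2) v.2‖ ≤ ‖A‖ * dist w v * R :=
      (A.le_opNorm₂ _ _).trans (by gcongr)
    nlinarith
  have := mul_le_mul_of_nonneg_left n1 hC₁
  have := mul_le_mul_of_nonneg_left n2 hH.nonneg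
  nlinarith

/-- Along the line `w + δ v` the form is the polynomial `a₀ + 2δa₁ + δ²a₂`, by symmetry of `A`, and
the integral can be differentiated under the integral sign. -/
lemma hasDerivAt_truncEnergy (hH : IsBoundedC1 H H' B) (hF : IsBoundedC1 F F' B')
    (hε : 0 < ε) (hA : ∀ v, ∀ᵐ x ∂μ, 0 ≤ A v v x) (hsymm : ∀ u v, A u v = A v u) (w v : X × Y) :
    HasDerivAt (fun δ : ℝ => truncEnergy μ Λ A H F ε (w + δ • v))
      (truncEnergyDeriv μ Λ A H H' F' ε w v) 0 := by
  set z : α → ℝ := fun x => Λ w.1 x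
  set ζ : α → ℝ := fun x => Λ v.1 x
  set a₀ : α → ℝ := fun x => A w.2 w.2 x
  set a₁ : α → ℝ := fun x => A w.2 v.2 x
  set a₂ : α → ℝ := fun x => A v.2 v.2 x
  have mz : AEStronglyMeasurable z μ := Lp.aestronglyMeasurable _
  have iζ : Integrable ζ μ := Lp.integrable_two _
  have i0 : Integrable a₀ μ := L1.integrable_coeFn _
  have i1 : Integrable a₁ μ := L1.integrable_coeFn _
  have i2 : Integrable a₂ μ := L1.integrable_coeFn _
  have hz : ∀ δ : ℝ, ∀ᵐ x ∂μ, Λ (w + δ • v).1 x = z x + δ * ζ x := fun δ => by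
    have e : Λ (w + δ • v).1 = Λ w.1 + δ • Λ v.1 := by simp
    rw [e]
    filter_upwards [Lp.coeFn_add (Λ w.1) (δ • Λ v.1), Lp.coeFn_smul δ (Λ v.1)] with x h1 h2
    rw [h1, Pi.add_apply, h2]; rfl
  have ha : ∀ δ : ℝ, ∀ᵐ x ∂μ, A (w + δ • v).2 (w + δ • v).2 x
      = a₀ x + 2 * δ * a₁ x + δ ^ 2 * a₂ x := fun δ => by
    have e : A (w + δ • v).2 (w + δ • v).2
        = A w.2 w.2 + ((2 * δ) • A w.2 v.2 + (δ ^ 2) • A v.2 v.2) := by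
      simp only [Prod.snd_add, Prod.smul_snd, map_add, map_smul, add_apply,
        smul_apply, hsymm v.2 w.2]
      module
    rw [e]
    filter_upwards [Lp.coeFn_add (A w.2 w.2) ((2 * δ) • A w.2 v.2 + (δ ^ 2) • A v.2 v.2),
      Lp.coeFn_add ((2 * δ) • A w.2 v.2) ((δ ^ 2) • A v.2 v.2),
      Lp.coeFn_smul (2 * δ) (A w.2 v.2), Lp.coeFn_smul (δ ^ 2) (A v.2 v.2)] with x h1 h2 h3 h4
    rw [h1, Pi.add_apply, h2, Pi.add_apply, h3, h4, ← add_assoc]; rfl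
  -- The null set must not depend on `δ`: countably many rational values are treated first, and
  -- continuity of the polynomial gives the others.
  have hpos : ∀ᵐ x ∂μ, ∀ δ : ℝ, 0 ≤ a₀ x + 2 * δ * a₁ x + δ ^ 2 * a₂ x := by
    have h1 : ∀ᵐ x ∂μ, ∀ q : ℚ, 0 ≤ a₀ x + 2 * (q : ℝ) * a₁ x + (q : ℝ) ^ 2 * a₂ x := by
      refine ae_all_iff.2 fun q => ?_
      filter_upwards [ha q, hA (w + (q : ℝ) • v).2] with x h2 h3
      rwa [← h2]
    filter_upwards [h1] with x hx δ
    have hcl : IsClosed {δ : ℝ | 0 ≤ a₀ x + 2 * δ * a₁ x + δ ^ 2 * a₂ x} :=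
      isClosed_le continuous_const (by fun_prop)
    have : closure (range ((↑) : ℚ → ℝ)) ⊆ {δ : ℝ | 0 ≤ a₀ x + 2 * δ * a₁ x + δ ^ 2 * a₂ x} :=
      hcl.closure_subset_iff.2 (by rintro _ ⟨q, rfl⟩; exact hx q)
    exact this (Rat.denseRange_cast δ)
  set f : ℝ → α → ℝ := fun δ x => 1 / 2 * H (z x + δ * ζ x)
    * trunc ε (a₀ x + 2 * δ * a₁ x + δ ^ 2 * a₂ x) + F (z x + δ * ζ x) with hf
  set f' : ℝ → α → ℝ := fun δ x => 1 / 2 * H' (z x + δ * ζ x) * ζ x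
      * trunc ε (a₀ x + 2 * δ * a₁ x + δ ^ 2 * a₂ x)
    + H (z x + δ * ζ x) * (1 / (1 + ε * (a₀ x + 2 * δ * a₁ x + δ ^ 2 * a₂ x)) ^ 2)
      * (a₁ x + δ * a₂ x) + F' (z x + δ * ζ x) * ζ x with hf'
  have hEf : (fun δ : ℝ => truncEnergy μ Λ A H F ε (w + δ • v)) = fun δ => ∫ x, f δ x ∂μ := by
    funext δ
    refine integral_congr_ae ?_
    filter_upwards [hz δ, ha δ] with x h1 h2
    simp only [h1, h2, hf]
  have hDf : truncEnergyDeriv μ Λ A H H' F' ε w v = ∫ x, f' 0 x ∂μ := by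
    simp only [truncEnergyDeriv, hf', z, ζ, a₀, a₁, a₂]
    simp
  have hfi : ∀ δ, Integrable (f δ) μ := fun δ =>
    integrable_truncEnergy hH hF hε (mz.add (iζ.aestronglyMeasurable.const_mul δ))
      ((i0.add (i1.const_mul (2 * δ))).add (i2.const_mul (δ ^ 2))) (hpos.mono fun x hx => hx δ)
  rw [hEf, hDf]
  -- The dominating function is valid for `|δ| < 1`: it uses `trunc ≤ ε⁻¹`, a derivative of `trunc`
  -- between 0 and 1, and the bounds on `H`, `H'` and `F'`.
  refine (hasDerivAt_integral_of_dominated_loc_of_deriv_le (F := f) (F' := f')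
    (bound := fun x => B * |ζ x| * ε⁻¹ + B * (|a₁ x| + |a₂ x|) + B' * |ζ x|)
    (Metric.ball_mem_nhds (0 : ℝ) one_pos)
    (Eventually.of_forall fun δ => (hfi δ).aestronglyMeasurable) (hfi 0) ?_ ?_ ?_ ?_).2
  · have m1 : AEMeasurable z μ := mz.aemeasurable
    have m2 := iζ.aemeasurable
    have m3 := i0.aemeasurable
    have m4 := i1.aemeasurable
    have m5 := i2.aemeasurable
    have c1 := hH.continuous.measurable
    have c2 := hH.continuous_deriv.measurable
    have c3 := hF.continuous_deriv.measurable
    have c4 := measurable_trunc ε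
    refine AEMeasurable.aestronglyMeasurable ?_
    have q : AEMeasurable (fun x => z x + 0 * ζ x) μ := by fun_prop
    have q1 := c1.comp_aemeasurable q
    have q2 := c2.comp_aemeasurable q
    have q3 := c3.comp_aemeasurable q
    have r : AEMeasurable (fun x => a₀ x + 2 * 0 * a₁ x + 0 ^ 2 * a₂ x) μ := by fun_prop
    have r1 := c4.comp_aemeasurable r
    exact ((((q2.const_mul (1 / 2)).mul m2).mul r1).add
      ((q1.mul ((((r.const_mul ε).const_add 1).pow_const 2).const_div 1)).mul
        (m4.add (m5.const_mul 0)))).add (q3.mul m2)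
  · filter_upwards [hpos] with x hx δ hδ
    rw [mem_ball_zero_iff, Real.norm_eq_abs] at hδ
    have t0 := trunc_nonneg hε.le (hx δ)
    have t1 := trunc_le_inv hε (hx δ)
    have t2 := trunc_deriv_mem hε.le (hx δ)
    have b1 : |1 / 2 * H' (z x + δ * ζ x) * ζ x
        * trunc ε (a₀ x + 2 * δ * a₁ x + δ ^ 2 * a₂ x)| ≤ B * |ζ x| * ε⁻¹ := by
      rw [abs_mul, abs_of_nonneg t0]
      refine mul_le_mul ?_ t1 t0 (mul_nonneg hH.nonneg (abs_nonneg _))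
      rw [abs_mul]
      refine mul_le_mul_of_nonneg_right ?_ (abs_nonneg _)
      rw [abs_mul, abs_of_pos (show (0 : ℝ) < 1 / 2 by norm_num)]
      linarith [hH.bound_deriv (z x + δ * ζ x), abs_nonneg (H' (z x + δ * ζ x))]
    have b2 : |H (z x + δ * ζ x) * (1 / (1 + ε * (a₀ x + 2 * δ * a₁ x + δ ^ 2 * a₂ x)) ^ 2)
        * (a₁ x + δ * a₂ x)| ≤ B * (|a₁ x| + |a₂ x|) := by
      rw [abs_mul]
      refine mul_le_mul ?_ ?_ (abs_nonneg _) hH.nonneg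
      · rw [abs_mul, abs_of_nonneg t2.1]
        exact (mul_le_mul (hH.bound _) t2.2 t2.1 hH.nonneg).trans (by rw [mul_one])
      · refine (abs_add_le _ _).trans (add_le_add_right ?_ _)
        rw [abs_mul]
        nlinarith [abs_nonneg (a₂ x)]
    have b3 : |F' (z x + δ * ζ x) * ζ x| ≤ B' * |ζ x| := by
      rw [abs_mul]
      exact mul_le_mul_of_nonneg_right (hF.bound_deriv _) (abs_nonneg _)
    exact (abs_add_le _ _).trans (add_le_add ((abs_add_le _ _).trans (add_le_add b1 b2)) b3)
  · exact (((iζ.abs.const_mul B).mul_const _).add ((i1.abs.add i2.abs).const_mul B)).add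
      (iζ.abs.const_mul B')
  · filter_upwards [hpos] with x hx δ _
    have l1 : HasDerivAt (fun δ : ℝ => z x + δ * ζ x) (ζ x) δ := by
      simpa using ((hasDerivAt_id δ).mul_const (ζ x)).const_add (z x)
    have l2 : HasDerivAt (fun δ : ℝ => a₀ x + 2 * δ * a₁ x + δ ^ 2 * a₂ x)
        (2 * a₁ x + 2 * δ * a₂ x) δ := by
      have := ((((hasDerivAt_id δ).const_mul 2).mul_const (a₁ x)).const_add (a₀ x)).add
        (((hasDerivAt_id δ).pow 2).mul_const (a₂ x))
      refine this.congr_deriv ?_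
      simp
    have d1 := (hH.hasDerivAt (z x + δ * ζ x)).comp δ l1
    have d2 := (hF.hasDerivAt (z x + δ * ζ x)).comp δ l1
    have d3 := (hasDerivAt_trunc hε.le (hx δ)).comp δ l2
    refine (((d1.const_mul (1 / 2)).mul d3).add d2).congr_deriv ?_
    simp only [hf', Function.comp]
    ring

end TruncatedEnergy


/-! ### The functional `1/r ‖·‖^r` on `L^p`, with `r = p.toReal`, and the `p`-Laplacian. -/

section NormPower

variable {α : Type*} [MeasurableSpace α] {μ : Measure α} {E : Type*} [NormedAddCommGroup E]
  {p : ℝ≥0∞}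

lemma one_lt_toReal (hp1 : 1 < p) (hp : p ≠ ⊤) : 1 < p.toReal := by
  have := (ENNReal.toReal_lt_toReal ENNReal.one_ne_top hp).2 hp1
  simpa using this

lemma MemLp.integrable_norm_rpow_toReal (hp1 : 1 ≤ p) (hp : p ≠ ⊤) {f : α → E}
    (hf : MemLp f p μ) : Integrable (fun x => ‖f x‖ ^ p.toReal) μ :=
  hf.integrable_norm_rpow (zero_lt_one.trans_le hp1).ne' hp

lemma Lp.norm_rpow_eq_integral [Fact (1 ≤ p)] (hp : p ≠ ⊤) (f : Lp E p μ) :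
    ‖f‖ ^ p.toReal = ∫ x, ‖f x‖ ^ p.toReal ∂μ := by
  have hp1 : (1 : ℝ≥0∞) ≤ p := Fact.out
  have h0 : p ≠ 0 := (zero_lt_one.trans_le hp1).ne'
  have hr : 0 < p.toReal := ENNReal.toReal_pos h0 hp
  have hi : 0 ≤ ∫ x, ‖f x‖ ^ p.toReal ∂μ := integral_nonneg fun x => by positivity
  rw [Lp.norm_def, (Lp.memLp f).eLpNorm_eq_integral_rpow_norm h0 hp,
    ENNReal.toReal_ofReal (by positivity), ← Real.rpow_mul hi, inv_mul_cancel₀ hr.ne', Real.rpow_one]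

variable [InnerProductSpace ℝ E]

/-- Directional derivative of `1/p ‖·‖_{L^p}^p`. -/
lemma hasDerivAt_norm_rpow_Lp [Fact (1 ≤ p)] (hp1 : 1 < p) (hp : p ≠ ⊤) (g v : Lp E p μ) :
    Integrable (fun x => ‖g x‖ ^ (p.toReal - 2) * inner ℝ (g x) (v x)) μ ∧
    HasDerivAt (fun δ : ℝ => 1 / p.toReal * ‖g + δ • v‖ ^ p.toReal)
      (∫ x, ‖g x‖ ^ (p.toReal - 2) * inner ℝ (g x) (v x) ∂μ) 0 := by
  set r := p.toReal with hr
  have hr1 : 1 < r := one_lt_toReal hp1 hp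
  have hr0 : 0 < r := by linarith
  have mg := Lp.aestronglyMeasurable g
  have mv := Lp.aestronglyMeasurable v
  have hmem : ∀ δ : ℝ, MemLp (fun x => g x + δ • v x) p μ := fun δ =>
    (Lp.memLp g).add ((Lp.memLp v).const_smul δ)
  set f : ℝ → α → ℝ := fun δ x => 1 / r * ‖g x + δ • v x‖ ^ r with hf
  set f' : ℝ → α → ℝ := fun δ x =>
    ‖g x + δ • v x‖ ^ (r - 2) * inner ℝ (g x + δ • v x) (v x) with hf'
  have hfe : (fun δ : ℝ => 1 / r * ‖g + δ • v‖ ^ r) = fun δ => ∫ x, f δ x ∂μ := by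
    funext δ
    rw [hr, Lp.norm_rpow_eq_integral hp, ← integral_const_mul]
    refine integral_congr_ae ?_
    filter_upwards [Lp.coeFn_add g (δ • v), Lp.coeFn_smul δ v] with x h1 h2
    rw [h1, Pi.add_apply, h2]; rfl
  have hfi : ∀ δ, Integrable (f δ) μ := fun δ =>
    (MemLp.integrable_norm_rpow_toReal hp1.le hp (hmem δ)).const_mul _
  have hbi : Integrable (fun x => (‖g x‖ + ‖v x‖) ^ r) μ := by
    have := MemLp.integrable_norm_rpow_toReal hp1.le hp ((Lp.memLp g).norm.add (Lp.memLp v).norm)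
    refine this.congr (Eventually.of_forall fun x => ?_)
    simp only [Pi.add_apply]
    rw [Real.norm_of_nonneg (by positivity)]
  have key := hasDerivAt_integral_of_dominated_loc_of_deriv_le (F := f) (F' := f')
    (bound := fun x => (‖g x‖ + ‖v x‖) ^ r) (μ := μ) (Metric.ball_mem_nhds (0 : ℝ) one_pos)
    (Eventually.of_forall fun δ => (hfi δ).aestronglyMeasurable) (hfi 0) ?_ ?_ hbi ?_
  · rw [hfe]
    have e : f' 0 = fun x => ‖g x‖ ^ (r - 2) * inner ℝ (g x) (v x) := by
      funext x; simp [hf']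
    rw [e] at key
    exact key
  · have h1 := (hmem 0).aestronglyMeasurable
    exact (h1.norm.aemeasurable.pow_const (r - 2)).aestronglyMeasurable.mul (h1.inner mv)
  · refine Eventually.of_forall fun x δ hδ => ?_
    rw [mem_ball_zero_iff, Real.norm_eq_abs] at hδ
    set y := g x + δ • v x with hy
    have hyn : ‖y‖ ≤ ‖g x‖ + ‖v x‖ := by
      refine (norm_add_le _ _).trans (add_le_add_right ?_ _)
      rw [norm_smul, Real.norm_eq_abs]
      nlinarith [norm_nonneg (v x)]
    have hvn : ‖v x‖ ≤ ‖g x‖ + ‖v x‖ := by linarith [norm_nonneg (g x)]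
    have h1 : ‖f' δ x‖ ≤ ‖y‖ ^ (r - 2) * (‖y‖ * ‖v x‖) := by
      simp only [hf', norm_mul]
      rw [Real.norm_of_nonneg (Real.rpow_nonneg (norm_nonneg _) _)]
      exact mul_le_mul_of_nonneg_left (norm_inner_le_norm _ _)
        (Real.rpow_nonneg (norm_nonneg _) _)
    refine h1.trans ?_
    -- At `y = 0` the power `r - 2` may be negative, but it multiplies `‖y‖ = 0`. Elsewhere the two
    -- factors combine to `‖y‖ ^ (r - 1)`, with a positive exponent.
    rcases eq_or_lt_of_le (norm_nonneg y) with h0 | h0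
    · rw [← h0]; simp only [zero_mul, mul_zero]; positivity
    · have h2 : ‖y‖ ^ (r - 2) * (‖y‖ * ‖v x‖) = ‖y‖ ^ (r - 1) * ‖v x‖ := by
        rw [← mul_assoc, ← Real.rpow_add_one h0.ne']; ring_nf
      have h3 : 0 < ‖g x‖ + ‖v x‖ := h0.trans_le hyn
      have h4 : (‖g x‖ + ‖v x‖) ^ r = (‖g x‖ + ‖v x‖) ^ (r - 1) * (‖g x‖ + ‖v x‖) := by
        rw [← Real.rpow_add_one h3.ne']; ring_nf
      rw [h2, h4]
      exact mul_le_mul (Real.rpow_le_rpow h0.le hyn (by linarith)) hvn (norm_nonneg _)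
        (by positivity)
  · refine Eventually.of_forall fun x δ _ => ?_
    have l1 : HasDerivAt (fun δ : ℝ => g x + δ • v x) (v x) δ := by
      simpa using ((hasDerivAt_id δ).smul_const (v x)).const_add (g x)
    have l2 := (hasFDerivAt_norm_rpow (g x + δ • v x) hr1).comp_hasDerivAt δ l1
    refine (l2.const_mul (1 / r)).congr_deriv ?_
    simp only [hf', smul_apply, innerSL_apply_apply, smul_eq_mul]
    field_simp

lemma exists_lipschitzOnWith_rpow {r : ℝ} (hr : 1 ≤ r) (R : ℝ) :
    ∃ K, LipschitzOnWith K (fun s : ℝ => 1 / r * s ^ r) (Icc 0 R) := by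
  refine ⟨Real.toNNReal (|R| ^ (r - 1)), ?_⟩
  refine (convex_Icc 0 R).lipschitzOnWith_of_nnnorm_hasDerivWithin_le
    (f' := fun s => s ^ (r - 1)) (fun s _ => ?_) fun s hs => ?_
  · refine (((Real.hasDerivAt_rpow_const (Or.inr hr)).const_mul (1 / r)).congr_deriv ?_).hasDerivWithinAt
    field_simp
  · rw [← NNReal.coe_le_coe, Real.coe_toNNReal _ (by positivity), coe_nnnorm,
      Real.norm_of_nonneg (Real.rpow_nonneg hs.1 _)]
    exact Real.rpow_le_rpow hs.1 (hs.2.trans (le_abs_self R)) (by linarith)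

/-- `1/p ‖G ·‖_{L^p}^p` is Lipschitz on balls. -/
lemma lipschitzOnWith_norm_rpow {X Y : Type*} [NormedAddCommGroup X] [NormedSpace ℝ X]
    [NormedAddCommGroup Y] [NormedSpace ℝ Y] {r : ℝ} (hr : 1 ≤ r) (G : X →L[ℝ] Y) (R : ℝ) :
    ∃ K, LipschitzOnWith K (fun x => 1 / r * ‖G x‖ ^ r) (Metric.closedBall 0 R) := by
  obtain ⟨K, hK⟩ := exists_lipschitzOnWith_rpow hr (‖G‖ * R)
  have h1 : LipschitzWith (1 * ‖G‖₊) fun x => ‖G x‖ := lipschitzWith_one_norm.comp G.lipschitz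
  refine ⟨_, hK.comp (h1.lipschitzOnWith (s := Metric.closedBall 0 R)) fun x hx => ?_⟩
  rw [mem_closedBall_zero_iff] at hx
  exact ⟨norm_nonneg _, (G.le_opNorm x).trans (by gcongr)⟩

/-- The linear functional `v ↦ ∫ |g|^{p-2} g · v` on `L^p`. -/
lemma exists_clm_pLaplace [Fact (1 ≤ p)] (hp1 : 1 < p) (hp : p ≠ ⊤) (g : Lp E p μ) :
    ∃ φ : Lp E p μ →L[ℝ] ℝ, ∀ v, φ v = ∫ x, ‖g x‖ ^ (p.toReal - 2) * inner ℝ (g x) (v x) ∂μ := by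
  set r := p.toReal with hr
  have hr1 : 1 < r := one_lt_toReal hp1 hp
  let L : Lp E p μ →ₗ[ℝ] ℝ :=
    { toFun := fun v => ∫ x, ‖g x‖ ^ (r - 2) * inner ℝ (g x) (v x) ∂μ
      map_add' := fun v w => by
        rw [← integral_add (hasDerivAt_norm_rpow_Lp hp1 hp g v).1
          (hasDerivAt_norm_rpow_Lp hp1 hp g w).1]
        refine integral_congr_ae ?_
        filter_upwards [Lp.coeFn_add v w] with x hx
        rw [hx, Pi.add_apply, inner_add_right, mul_add]
      map_smul' := fun c v => by
        rw [RingHom.id_apply, smul_eq_mul, ← integral_const_mul]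
        refine integral_congr_ae ?_
        filter_upwards [Lp.coeFn_smul c v] with x hx
        rw [hx, Pi.smul_apply, inner_smul_right]
        ring }
  obtain ⟨K, hK⟩ := lipschitzOnWith_norm_rpow hr1.le (ContinuousLinearMap.id ℝ (Lp E p μ)) (‖g‖ + 1)
  refine ⟨L.mkContinuous K fun v => ?_, fun v => rfl⟩
  -- Continuity comes for free: the functional is a directional derivative of a locally Lipschitz
  -- function, hence bounded by its Lipschitz constant.
  refine (hasDerivAt_norm_rpow_Lp hp1 hp g v).2.le_of_lip' (by positivity) ?_
  have hc : ∀ᶠ y : ℝ in 𝓝 0, g + y • v ∈ Metric.closedBall (0 : Lp E p μ) (‖g‖ + 1) := by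
    have : Tendsto (fun y : ℝ => g + y • v) (𝓝 0) (𝓝 g) := by
      have := (by fun_prop : Continuous fun y : ℝ => g + y • v).tendsto 0
      simpa using this
    refine this.eventually (Metric.closedBall_mem_nhds_of_mem ?_)
    rw [mem_ball_zero_iff]; linarith
  filter_upwards [hc] with y hy
  have h0 : g + (0 : ℝ) • v ∈ Metric.closedBall (0 : Lp E p μ) (‖g‖ + 1) := hc.self_of_nhds
  refine (hK.norm_sub_le hy h0).trans (le_of_eq ?_)
  rw [add_sub_add_left_eq_sub, ← sub_smul, norm_smul]
  ring

end NormPower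

/-! ### The closed subspace of functions with zero trace on a boundary part. -/

section Vanishing

variable {n : ℕ} {Ω Γ : Set (Eu n)}

/-- `φ` is `δ`-close to `v` in `H¹(Ω)` and `δ`-close to `0` in `L²(Γ)`. -/
structure IsTraceApprox (Γ : Set (Eu n)) (v : W1 Ω 2 (Eu n)) (φ : Eu n → Eu n) (δ : ℝ≥0∞) :
    Prop where
  contDiff : ContDiff ℝ ∞ φ
  val : eLpNorm (fun x => φ x - v.toLp x) 2 (volume.restrict Ω) ≤ δ
  grad : ∀ i, eLpNorm (fun x => fderiv ℝ φ x (EuclideanSpace.single i 1) - v.partialLp i x) 2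
      (volume.restrict Ω) ≤ δ
  trace : eLpNorm φ 2 ((Measure.hausdorffMeasure ((n : ℝ) - 1)).restrict Γ) ≤ δ

/-- With one smooth approximant per tolerance in place of a sequence, closedness needs no diagonal
argument. -/
lemma vanishesOn_iff (v : W1 Ω 2 (Eu n)) :
    VanishesOn Γ v ↔ ∀ δ : ℝ≥0∞, 0 < δ → ∃ φ, IsTraceApprox Γ v φ δ := by
  constructor
  · rintro ⟨φ, h1, h2, h3, h4⟩ δ hδ
    have e2 := h2.eventually (ge_mem_nhds hδ)
    have e3 := eventually_all.2 fun i => (h3 i).eventually (ge_mem_nhds hδ)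
    have e4 := h4.eventually (ge_mem_nhds hδ)
    obtain ⟨k, k2, k3, k4⟩ := (e2.and (e3.and e4)).exists
    exact ⟨φ k, h1 k, k2, k3, by simpa using k4⟩
  · intro h
    have hpos : ∀ k : ℕ, (0 : ℝ≥0∞) < ((k : ℝ≥0∞) + 1)⁻¹ := fun k => by simp
    choose φ hφ using fun k : ℕ => h _ (hpos k)
    have hlim : Tendsto (fun k : ℕ => ((k : ℝ≥0∞) + 1)⁻¹) atTop (𝓝 0) := by
      have := (tendsto_add_atTop_iff_nat 1).2 ENNReal.tendsto_inv_nat_nhds_zero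
      simpa using this
    refine ⟨φ, fun k => (hφ k).contDiff, ?_, fun i => ?_, ?_⟩
    · exact tendsto_of_tendsto_of_tendsto_of_le_of_le tendsto_const_nhds hlim
        (fun _ => zero_le) fun k => (hφ k).val
    · exact tendsto_of_tendsto_of_tendsto_of_le_of_le tendsto_const_nhds hlim
        (fun _ => zero_le) fun k => (hφ k).grad i
    · refine tendsto_of_tendsto_of_tendsto_of_le_of_le tendsto_const_nhds hlim
        (fun _ => zero_le) fun k => ?_
      simpa using (hφ k).trace

lemma IsTraceApprox.comb {v w : W1 Ω 2 (Eu n)} {φ ψ : Eu n → Eu n} {δ : ℝ≥0∞}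
    (hφ : IsTraceApprox Γ v φ δ) (hψ : IsTraceApprox Γ w ψ δ) (c : ℝ) :
    IsTraceApprox Γ (v + c • w) (fun x => φ x + c • ψ x) (δ + ‖c‖ₑ * δ) := by
  have dφ : Differentiable ℝ φ := hφ.contDiff.differentiable (by simp)
  have dψ : Differentiable ℝ ψ := hψ.contDiff.differentiable (by simp)
  have key : ∀ (a b : Eu n → Eu n) (V W VW : Lp (Eu n) 2 (volume.restrict Ω)),
      Continuous a → Continuous b → VW = V + c • W →
      eLpNorm (fun x => a x - V x) 2 (volume.restrict Ω) ≤ δ →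
      eLpNorm (fun x => b x - W x) 2 (volume.restrict Ω) ≤ δ →
      eLpNorm (fun x => a x + c • b x - VW x) 2 (volume.restrict Ω) ≤ δ + ‖c‖ₑ * δ := by
    rintro a b V W _ ha hb rfl h1 h2
    have e : (fun x => a x + c • b x - (V + c • W : Lp (Eu n) 2 (volume.restrict Ω)) x)
        =ᵐ[volume.restrict Ω] (fun x => a x - V x) + c • (fun x => b x - W x) := by
      filter_upwards [Lp.coeFn_add V (c • W), Lp.coeFn_smul c W] with x k1 k2
      simp only [Pi.add_apply, Pi.smul_apply, k1, k2]
      module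
    have m1 : AEStronglyMeasurable (fun x => a x - V x) (volume.restrict Ω) :=
      ha.aestronglyMeasurable.sub (Lp.aestronglyMeasurable V)
    have m2 : AEStronglyMeasurable (fun x => b x - W x) (volume.restrict Ω) :=
      hb.aestronglyMeasurable.sub (Lp.aestronglyMeasurable W)
    rw [eLpNorm_congr_ae e]
    refine (eLpNorm_add_le m1 (m2.const_smul c) one_le_two).trans ?_
    rw [eLpNorm_const_smul]
    gcongr
  refine ⟨hφ.contDiff.add (hψ.contDiff.const_smul c), ?_, fun i => ?_, ?_⟩
  · exact key φ ψ _ _ _ hφ.contDiff.continuous hψ.contDiff.continuous rfl hφ.val hψ.val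
  · have e : ∀ x, fderiv ℝ (fun x => φ x + c • ψ x) x (EuclideanSpace.single i 1)
        = fderiv ℝ φ x (EuclideanSpace.single i 1)
          + c • fderiv ℝ ψ x (EuclideanSpace.single i 1) := fun x => by
      have h1 := (dφ x).hasFDerivAt.add ((dψ x).hasFDerivAt.const_smul c)
      exact congrArg (fun L : Eu n →L[ℝ] Eu n => L (EuclideanSpace.single i 1)) h1.fderiv
    simp only [e]
    exact key _ _ _ _ _ ((hφ.contDiff.continuous_fderiv (by simp)).clm_apply continuous_const)
      ((hψ.contDiff.continuous_fderiv (by simp)).clm_apply continuous_const) rfl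
      (hφ.grad i) (hψ.grad i)
  · refine (eLpNorm_add_le hφ.contDiff.continuous.aestronglyMeasurable
      (hψ.contDiff.continuous.aestronglyMeasurable.const_smul c) one_le_two).trans ?_
    rw [eLpNorm_const_smul]
    exact add_le_add hφ.trace (by gcongr; exact hψ.trace)

lemma isTraceApprox_zero (δ : ℝ≥0∞) : IsTraceApprox Γ (0 : W1 Ω 2 (Eu n)) 0 δ := by
  have h : ∀ V : Lp (Eu n) 2 (volume.restrict Ω), V = 0 →
      eLpNorm (fun x => (0 : Eu n) - V x) 2 (volume.restrict Ω) ≤ δ := by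
    rintro _ rfl
    rw [eLpNorm_congr_ae (g := (0 : Eu n → Eu n))]
    · simp
    · filter_upwards [Lp.coeFn_zero (Eu n) 2 (volume.restrict Ω)] with x hx
      rw [hx]; simp
  refine ⟨contDiff_const, h _ rfl, fun i => ?_, by simp⟩
  simpa using h ((0 : W1 Ω 2 (Eu n)).partialLp i) rfl

/-- The space `H¹_Γ(Ω; ℝⁿ)` of functions that vanish on `Γ`. -/
def vanishing (Ω Γ : Set (Eu n)) : Submodule ℝ (W1 Ω 2 (Eu n)) where
  carrier := {v | VanishesOn Γ v}
  zero_mem' := (vanishesOn_iff _).2 fun δ _ => ⟨0, isTraceApprox_zero δ⟩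
  add_mem' := by
    intro v w hv hw
    refine (vanishesOn_iff _).2 fun δ hδ => ?_
    obtain ⟨φ, hφ⟩ := (vanishesOn_iff _).1 hv (δ / 2) (ENNReal.half_pos hδ.ne')
    obtain ⟨ψ, hψ⟩ := (vanishesOn_iff _).1 hw (δ / 2) (ENNReal.half_pos hδ.ne')
    have := hφ.comb hψ 1
    rw [one_smul, enorm_one, one_mul, ENNReal.add_halves] at this
    exact ⟨_, this⟩
  smul_mem' := by
    intro c v hv
    refine (vanishesOn_iff _).2 fun δ hδ => ?_
    -- Combining the zero approximant with `c` times one of tolerance `δ'` costs `δ' + ‖c‖ δ'`,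
    -- which explains the choice `δ' = δ / (1 + ‖c‖)`.
    have hc : (1 + ‖c‖ₑ) ≠ 0 := by positivity
    have hc' : (1 + ‖c‖ₑ) ≠ ⊤ := by simp
    obtain ⟨φ, hφ⟩ := (vanishesOn_iff _).1 hv (δ / (1 + ‖c‖ₑ)) (ENNReal.div_pos hδ.ne' hc')
    have := (isTraceApprox_zero (δ / (1 + ‖c‖ₑ))).comb hφ c
    have e : δ / (1 + ‖c‖ₑ) + ‖c‖ₑ * (δ / (1 + ‖c‖ₑ)) = δ := by
      rw [← one_add_mul, ENNReal.mul_div_cancel hc hc']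
    rw [zero_add, e] at this
    exact ⟨_, this⟩

/-- An approximant of a nearby element `w` also serves for `v`: only the interior norms have to be
compared, since the boundary condition on the approximant does not involve `v`. -/
lemma isClosed_vanishing : IsClosed (vanishing Ω Γ : Set (W1 Ω 2 (Eu n))) := by
  refine isClosed_of_closure_subset fun v hv => (vanishesOn_iff v).2 fun δ hδ => ?_
  -- The minimum with 1 keeps the radius positive for `δ = ⊤`, where `toReal` of `δ / 2` would be 0.
  obtain ⟨w, hw, hd⟩ := Metric.mem_closure_iff.1 hv (min 1 (δ / 2)).toReal
    (ENNReal.toReal_pos (by simp [hδ.ne']) (by simp))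
  obtain ⟨φ, hφ⟩ := (vanishesOn_iff _).1 hw (δ / 2) (ENNReal.half_pos hδ.ne')
  have key : ∀ (a : Eu n → Eu n) (V W : Lp (Eu n) 2 (volume.restrict Ω)), Continuous a →
      ‖V - W‖ ≤ dist v w → eLpNorm (fun x => a x - W x) 2 (volume.restrict Ω) ≤ δ / 2 →
      eLpNorm (fun x => a x - V x) 2 (volume.restrict Ω) ≤ δ := by
    intro a V W ha h1 h2
    have e : (fun x => a x - V x) =ᵐ[volume.restrict Ω]
        (fun x => a x - W x) - ⇑(V - W) := by
      filter_upwards [Lp.coeFn_sub V W] with x k1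
      simp only [Pi.sub_apply, k1]
      module
    rw [eLpNorm_congr_ae e]
    refine (eLpNorm_sub_le (ha.aestronglyMeasurable.sub (Lp.aestronglyMeasurable W))
      (Lp.aestronglyMeasurable _) one_le_two).trans ?_
    refine (add_le_add h2 ?_).trans (ENNReal.add_halves δ).le
    have h3 := h1.trans hd.le
    rw [Lp.norm_def] at h3
    exact ((ENNReal.toReal_le_toReal (Lp.eLpNorm_ne_top _) (by simp)).1 h3).trans (min_le_right _ _)
  refine ⟨φ, hφ.contDiff, key φ _ _ hφ.contDiff.continuous ?_ hφ.val, fun i =>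
    key _ _ _ ((hφ.contDiff.continuous_fderiv (by simp)).clm_apply continuous_const) ?_
      (hφ.grad i), hφ.trace.trans ENNReal.half_le_self⟩
  · rw [dist_eq_norm]; exact W1.norm_toLp_le (v - w)
  · rw [dist_eq_norm]; exact W1.norm_partialLp_le (v - w) i

end Vanishing


/-! ### Weak derivatives on an interval. -/

section OneDimensional

variable {a b : ℝ}

lemma contDiff_infty_primitive {θ : ℝ → ℝ} (hθ : ContDiff ℝ ∞ θ) (c : ℝ) :
    ContDiff ℝ ∞ (fun x => ∫ s in c..x, θ s) := by
  have hd : ∀ x, HasDerivAt (fun x => ∫ s in c..x, θ s) (θ x) x := fun x =>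
    hθ.continuous.integral_hasStrictDerivAt c x |>.hasDerivAt
  refine contDiff_infty_iff_deriv.2 ⟨fun x => (hd x).differentiableAt, ?_⟩
  rwa [show deriv (fun x => ∫ s in c..x, θ s) = θ from funext fun x => (hd x).deriv]

/-- A test function on `(a, b)` is supported in a compact subinterval. -/
lemma exists_Icc_of_tsupport_subset (hab : a < b) {θ : ℝ → ℝ} (hc : HasCompactSupport θ)
    (hs : tsupport θ ⊆ Ioo a b) : ∃ c d, a < c ∧ c ≤ d ∧ d < b ∧ tsupport θ ⊆ Icc c d := by
  rcases (tsupport θ).eq_empty_or_nonempty with h | h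
  · exact ⟨(a + b) / 2, (a + b) / 2, by linarith, le_rfl, by linarith, by simp [h]⟩
  · have h1 := hc.isCompact.sInf_mem h
    have h2 := hc.isCompact.sSup_mem h
    exact ⟨sInf (tsupport θ), sSup (tsupport θ), (hs h1).1, csInf_le hc.isCompact.bddBelow h2,
      (hs h2).2, fun x hx => ⟨csInf_le hc.isCompact.bddBelow hx, le_csSup hc.isCompact.bddAbove hx⟩⟩

/-- A test function on `(a, b)` with mean zero is the derivative of a test function. -/
lemma exists_test_primitive (hab : a < b) {θ : ℝ → ℝ} (hθ : ContDiff ℝ ∞ θ)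
    (hc : HasCompactSupport θ) (hs : tsupport θ ⊆ Ioo a b) (h0 : ∫ x in a..b, θ x = 0) :
    ∃ η : ℝ → ℝ, ContDiff ℝ ∞ η ∧ HasCompactSupport η ∧ tsupport η ⊆ Ioo a b ∧
      ∀ x, deriv η x = θ x := by
  obtain ⟨c, d, hac, hcd, hdb, hsub⟩ := exists_Icc_of_tsupport_subset hab hc hs
  set η : ℝ → ℝ := fun x => ∫ s in a..x, θ s with hη
  have hz : ∀ x, x ∉ Icc c d → θ x = 0 := fun x hx =>
    image_eq_zero_of_notMem_tsupport fun h => hx (hsub h)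
  have hsupp : Function.support η ⊆ Icc c d := by
    intro x hx
    by_contra hn
    refine hx ?_
    rw [mem_Icc, not_and_or, not_le, not_le] at hn
    rcases hn with h | h
    · simp only [hη]
      rw [intervalIntegral.integral_congr (g := fun _ => 0)]
      · simp
      · intro s hs
        refine hz s fun h' => ?_
        have : s ≤ max a x := hs.2
        have : s < c := this.trans_lt (max_lt hac h)
        linarith [h'.1]
    -- To the right of the support the primitive vanishes because the total integral is zero.
    · have h2 : ∫ s in x..b, θ s = 0 := by
        rw [intervalIntegral.integral_congr (g := fun _ => 0)]
        · simp
        · intro s hs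
          refine hz s fun h' => ?_
          have : min x b ≤ s := hs.1
          have : d < s := (lt_min h hdb).trans_le this
          linarith [h'.2]
      have := intervalIntegral.integral_add_adjacent_intervals (a := a) (b := x) (c := b)
        (hθ.continuous.intervalIntegrable (μ := volume) _ _)
        (hθ.continuous.intervalIntegrable _ _)
      simp only [hη]
      linarith
  have hts : tsupport η ⊆ Icc c d := closure_minimal hsupp isClosed_Icc
  refine ⟨η, contDiff_infty_primitive hθ a,
    isCompact_Icc.of_isClosed_subset (isClosed_tsupport η) hts,
    hts.trans fun x hx => ⟨hac.trans_le hx.1, hx.2.trans_lt hdb⟩, fun x => ?_⟩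
  exact (hθ.continuous.integral_hasStrictDerivAt a x).hasDerivAt.deriv

lemma exists_normalized_test (hab : a < b) : ∃ χ : ℝ → ℝ, ContDiff ℝ ∞ χ ∧ HasCompactSupport χ ∧
    tsupport χ ⊆ Ioo a b ∧ ∫ x in a..b, χ x = 1 := by
  let f : ContDiffBump ((a + b) / 2) := ⟨(b - a) / 8, (b - a) / 4, by linarith, by linarith⟩
  have hts : tsupport (f.normed volume) ⊆ Ioo a b := by
    rw [f.tsupport_normed_eq, Real.closedBall_eq_Icc]
    exact fun x hx => ⟨by have := hx.1; simp only [f] at this; linarith,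
      by have := hx.2; simp only [f] at this; linarith⟩
  refine ⟨f.normed volume, f.contDiff_normed, f.hasCompactSupport_normed, hts, ?_⟩
  rw [intervalIntegral.integral_of_le hab.le, ← f.integral_normed (μ := volume)]
  refine setIntegral_eq_integral_of_forall_compl_eq_zero fun x hx => ?_
  exact image_eq_zero_of_notMem_tsupport fun h => hx (Ioo_subset_Ioc_self (hts h))

/-- A function with an integrable weak derivative `g` on `(a, b)` is a primitive of `g`. -/
lemma exists_ae_eq_primitive (hab : a < b) {v g : ℝ → ℝ} (hv : IntervalIntegrable v volume a b)
    (hg : IntervalIntegrable g volume a b)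
    (h : ∀ η : ℝ → ℝ, ContDiff ℝ ∞ η → HasCompactSupport η → tsupport η ⊆ Ioo a b →
      ∫ x in a..b, deriv η x * v x = - ∫ x in a..b, η x * g x) :
    ∃ c, ∀ᵐ x, x ∈ Ioo a b → v x = c + ∫ s in a..x, g s := by
  set G : ℝ → ℝ := fun x => ∫ s in a..x, g s with hG
  have hGac : AbsolutelyContinuousOnInterval G a b :=
    hg.absolutelyContinuousOnInterval_intervalIntegral left_mem_uIcc
  have hGi : IntervalIntegrable G volume a b := hGac.continuousOn.intervalIntegrable
  have hGd : ∀ᵐ x, x ∈ uIoc a b → deriv G x = g x := by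
    filter_upwards [hg.ae_hasDerivAt_integral] with x hx hmem
    exact (hx (uIoc_subset_uIcc hmem) a left_mem_uIcc).deriv
  -- Integration by parts against the absolutely continuous primitive `G` shows that `v - G` has
  -- zero weak derivative.
  have hw0 : ∀ η : ℝ → ℝ, ContDiff ℝ ∞ η → HasCompactSupport η → tsupport η ⊆ Ioo a b →
      ∫ x in a..b, deriv η x * (v x - G x) = 0 := by
    intro η h1 h2 h3
    have hηac : AbsolutelyContinuousOnInterval η a b :=
      (h1.of_le (by norm_cast)).contDiffOn.absolutelyContinuousOnInterval
    have e1 := hηac.integral_mul_deriv_eq_deriv_mul hGac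
    have ha : η a = 0 := image_eq_zero_of_notMem_tsupport fun h => lt_irrefl _ (h3 h).1
    have hb : η b = 0 := image_eq_zero_of_notMem_tsupport fun h => lt_irrefl _ (h3 h).2
    have e2 : ∫ x in a..b, η x * deriv G x = ∫ x in a..b, η x * g x :=
      intervalIntegral.integral_congr_ae (hGd.mono fun x hx hmem => by rw [hx hmem])
    have hdc : Continuous (deriv η) := h1.continuous_deriv (by simp)
    simp only [mul_sub]
    rw [intervalIntegral.integral_sub (hv.continuousOn_mul hdc.continuousOn)
      (hGi.continuousOn_mul hdc.continuousOn), h η h1 h2 h3, ← e2, e1, ha, hb]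
    ring
  obtain ⟨χ, χ1, χ2, χ3, χ4⟩ := exists_normalized_test hab
  set w : ℝ → ℝ := fun x => v x - G x with hw
  have hwi : IntervalIntegrable w volume a b := hv.sub hGi
  -- As `w` turns out to be constant and `χ` has integral 1, the constant has to be this mean.
  set c := ∫ x in a..b, χ x * w x with hc
  refine ⟨c, ?_⟩
  have key : ∀ᵐ x, x ∈ Ioo a b → w x - c = 0 := by
    have hloc : IntegrableOn (fun x => w x - c) (Ioo a b) volume :=
      ((hwi.sub intervalIntegrable_const).1).mono_set Ioo_subset_Ioc_self
    refine isOpen_Ioo.ae_eq_zero_of_integral_contDiff_smul_eq_zero hloc.locallyIntegrableOn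
      fun ψ p1 p2 p3 => ?_
    have e0 : ∫ x, ψ x • (w x - c) = ∫ x in a..b, ψ x * (w x - c) := by
      rw [intervalIntegral.integral_of_le hab.le]
      refine (setIntegral_eq_integral_of_forall_compl_eq_zero fun x hx => ?_).symm
      rw [image_eq_zero_of_notMem_tsupport fun h => hx (Ioo_subset_Ioc_self (p3 h)), zero_smul]
    set m := ∫ x in a..b, ψ x with hm
    -- Subtracting `m χ` removes the mean of `ψ`, so that `θ` is the derivative of a test function.
    set θ : ℝ → ℝ := fun x => ψ x - m * χ x with hθ
    have i1 : IntervalIntegrable ψ volume a b := p1.continuous.intervalIntegrable _ _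
    have i2 : IntervalIntegrable χ volume a b := χ1.continuous.intervalIntegrable _ _
    have θ4 : ∫ x in a..b, θ x = 0 := by
      simp only [hθ]
      rw [intervalIntegral.integral_sub i1 (i2.const_mul m), intervalIntegral.integral_const_mul,
        χ4]
      simp [hm]
    have hts : tsupport θ ⊆ tsupport ψ ∪ tsupport χ := by
      refine closure_minimal ?_ ((isClosed_tsupport _).union (isClosed_tsupport _))
      intro x hx
      by_contra hn
      rw [mem_union, not_or] at hn
      refine hx ?_
      simp [hθ, image_eq_zero_of_notMem_tsupport hn.1, image_eq_zero_of_notMem_tsupport hn.2]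
    obtain ⟨η, η1, η2, η3, η4⟩ := exists_test_primitive hab (θ := θ)
      (p1.sub (contDiff_const.mul χ1))
      ((p2.isCompact.union χ2.isCompact).of_isClosed_subset (isClosed_tsupport θ) hts)
      (hts.trans (union_subset p3 χ3)) θ4
    have e1 := hw0 η η1 η2 η3
    simp only [η4] at e1
    have j1 : IntervalIntegrable (fun x => ψ x * w x) volume a b :=
      hwi.continuousOn_mul p1.continuous.continuousOn
    have j2 : IntervalIntegrable (fun x => χ x * w x) volume a b :=
      hwi.continuousOn_mul χ1.continuous.continuousOn
    have e2 : ∫ x in a..b, θ x * (v x - G x)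
        = (∫ x in a..b, ψ x * w x) - m * c := by
      rw [hc, ← intervalIntegral.integral_const_mul, ← intervalIntegral.integral_sub j1
        (j2.const_mul m)]
      refine intervalIntegral.integral_congr fun x _ => ?_
      simp only [hθ, hw]; ring
    rw [e0]
    simp only [mul_sub]
    rw [intervalIntegral.integral_sub j1 (i1.mul_const c), intervalIntegral.integral_mul_const,
      ← hm, ← e2, e1]
  filter_upwards [key] with x hx hmem
  have := hx hmem
  simp only [hw] at this
  linarith

/-- In `v = c + ∫ g` the integral is at most `‖g‖₁`, and averaging `|c| ≤ |v| + ‖g‖₁` over the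
interval bounds the constant; hence the factor 2. -/
lemma ae_abs_le_of_weakDeriv (hab : a < b) {v g : ℝ → ℝ} (hv : IntervalIntegrable v volume a b)
    (hg : IntervalIntegrable g volume a b)
    (h : ∀ η : ℝ → ℝ, ContDiff ℝ ∞ η → HasCompactSupport η → tsupport η ⊆ Ioo a b →
      ∫ x in a..b, deriv η x * v x = - ∫ x in a..b, η x * g x) :
    ∀ᵐ x, x ∈ Ioo a b →
      |v x| ≤ (b - a)⁻¹ * (∫ s in a..b, |v s|) + 2 * ∫ s in a..b, |g s| := by
  obtain ⟨c, hc⟩ := exists_ae_eq_primitive hab hv hg h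
  set N := ∫ s in a..b, |g s| with hN
  have hG : ∀ x ∈ Icc a b, |∫ s in a..x, g s| ≤ N := fun x hx => by
    refine (intervalIntegral.abs_integral_le_integral_abs hx.1).trans ?_
    refine intervalIntegral.integral_mono_interval le_rfl hx.1 hx.2
      (Eventually.of_forall fun _ => abs_nonneg _) hg.abs
  have hc' : |c| ≤ (b - a)⁻¹ * (∫ s in a..b, |v s|) + N := by
    have h1 : ∫ s in a..b, (|c| - N) ≤ ∫ s in a..b, |v s| := by
      refine intervalIntegral.integral_mono_ae_restrict hab.le intervalIntegrable_const hv.abs ?_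
      refine (ae_restrict_iff' measurableSet_Icc).2 ?_
      have n1 : ∀ᵐ s : ℝ, s ≠ a := by simp [ae_iff, measure_singleton]
      have n2 : ∀ᵐ s : ℝ, s ≠ b := by simp [ae_iff, measure_singleton]
      filter_upwards [hc, n1, n2] with x hx x1 x2 hmem
      have hx' := hx ⟨lt_of_le_of_ne hmem.1 (Ne.symm x1), lt_of_le_of_ne hmem.2 x2⟩
      have h2 := hG x hmem
      have h3 : |c| ≤ |v x| + |∫ s in a..x, g s| := by
        have : c = v x - ∫ s in a..x, g s := by linarith
        rw [this]; exact abs_sub _ _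
      linarith
    rw [intervalIntegral.integral_const, smul_eq_mul] at h1
    have h0 : 0 < b - a := sub_pos.2 hab
    have h2 : |c| - N ≤ (b - a)⁻¹ * ∫ s in a..b, |v s| := by
      rw [inv_mul_eq_div, le_div_iff₀ h0]; linarith
    linarith
  filter_upwards [hc] with x hx hmem
  rw [hx hmem]
  refine (abs_add_le _ _).trans ?_
  linarith [hG x (Ioo_subset_Icc_self hmem)]

end OneDimensional

/-! ### Embedding of `W^{1,p}` into `L²`, and into `L^∞` when `p < 2`. -/

section Embedding

/-- The coordinate of a one-dimensional Euclidean space. -/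
def coordL : Eu 1 ≃L[ℝ] ℝ :=
  (EuclideanSpace.equiv (Fin 1) ℝ).trans (ContinuousLinearEquiv.funUnique (Fin 1) ℝ ℝ)

lemma measurePreserving_coordL : MeasurePreserving coordL :=
  (volume_preserving_funUnique (Fin 1) ℝ).comp (PiLp.volume_preserving_ofLp (Fin 1))

lemma measurableEmbedding_coordL : MeasurableEmbedding coordL :=
  coordL.toHomeomorph.measurableEmbedding

lemma coordL_single : coordL (EuclideanSpace.single 0 1) = 1 := by
  simp [coordL]

lemma exists_eq_Ioo {I : Set ℝ} (ho : IsOpen I) (hc : IsConnected I) (hb : Bornology.IsBounded I) :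
    ∃ a b, a < b ∧ I = Ioo a b := by
  have h1 : I ⊆ Ioo (sInf I) (sSup I) := by
    intro x hx
    obtain ⟨r, hr, hsub⟩ := Metric.isOpen_iff.1 ho x hx
    have m1 : x - r / 2 ∈ I := hsub (by rw [Metric.mem_ball, Real.dist_eq, abs_lt]; constructor <;> linarith)
    have m2 : x + r / 2 ∈ I := hsub (by rw [Metric.mem_ball, Real.dist_eq, abs_lt]; constructor <;> linarith)
    have n1 := csInf_le hb.bddBelow m1
    have n2 := le_csSup hb.bddAbove m2
    constructor <;> linarith
  have h2 : Ioo (sInf I) (sSup I) ⊆ I := by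
    intro x hx
    obtain ⟨y, hy, hyx⟩ := exists_lt_of_csInf_lt hc.nonempty hx.1
    obtain ⟨z, hz, hxz⟩ := exists_lt_of_lt_csSup hc.nonempty hx.2
    exact hc.isPreconnected.ordConnected.out hy hz ⟨hyx.le, hxz.le⟩
  obtain ⟨x, hx⟩ := hc.nonempty
  exact ⟨sInf I, sSup I, (h1 hx).1.trans (h1 hx).2, h1.antisymm h2⟩

lemma IsBoundedLipschitzDomain.isFiniteMeasure {n : ℕ} {Ω : Set (Eu n)}
    (hΩ : IsBoundedLipschitzDomain Ω) : IsFiniteMeasure (volume.restrict Ω) :=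
  ⟨by rw [Measure.restrict_apply_univ]; exact hΩ.isBounded.measure_lt_top⟩

/-- On an interval, `W^{1,p}` embeds into `L^∞`. -/
lemma exists_ae_abs_le_norm {Ω : Set (Eu 1)} (hΩ : IsBoundedLipschitzDomain Ω) (p : ℝ≥0∞)
    [Fact (1 ≤ p)] : ∃ C, 0 ≤ C ∧ ∀ w : W1 Ω p ℝ, ∀ᵐ x ∂(volume.restrict Ω), |w.toLp x| ≤ C * ‖w‖ := by
  have := hΩ.isFiniteMeasure
  obtain ⟨a, b, hab, hI⟩ := exists_eq_Ioo (I := coordL '' Ω)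
    (coordL.toHomeomorph.isOpenMap _ hΩ.isOpen)
    (hΩ.isConnected.image _ coordL.continuous.continuousOn)
    (coordL.lipschitz.isBounded_image hΩ.isBounded)
  have hpre : Ω = coordL ⁻¹' Ioo a b := by
    rw [← hI, preimage_image_eq _ coordL.injective]
  obtain ⟨c, hc0, hc⟩ := integral_abs_le_norm_Lp (μ := volume.restrict Ω) (p := p)
  have hba : 0 < b - a := sub_pos.2 hab
  have htr : ∀ F : ℝ → ℝ, ∫ x in a..b, F x = ∫ x in Ω, F (coordL x) := fun F => by
    rw [intervalIntegral.integral_of_le hab.le, integral_Ioc_eq_integral_Ioo, hpre,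
      measurePreserving_coordL.setIntegral_preimage_emb measurableEmbedding_coordL]
  have hint : ∀ f : Lp ℝ p (volume.restrict Ω),
      IntervalIntegrable (fun t => f (coordL.symm t)) volume a b := fun f => by
    rw [intervalIntegrable_iff_integrableOn_Ioo_of_le hab.le,
      ← measurePreserving_coordL.integrableOn_comp_preimage measurableEmbedding_coordL, ← hpre]
    have h1 : Integrable f (volume.restrict Ω) := (Lp.memLp f).integrable Fact.out
    refine h1.congr (Eventually.of_forall fun x => ?_)
    simp
  have habs : ∀ f : Lp ℝ p (volume.restrict Ω),
      ∫ t in a..b, |f (coordL.symm t)| ≤ c * ‖f‖ := fun f => by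
    rw [htr fun t => |f (coordL.symm t)|]
    simpa using hc f
  refine ⟨(b - a)⁻¹ * c + 2 * c, by positivity, fun w => ?_⟩
  have key := ae_abs_le_of_weakDeriv hab (hint w.toLp) (hint (w.partialLp 0)) fun η h1 h2 h3 => by
    have hw := w.2 0 (η ∘ coordL) (h1.comp coordL.contDiff)
      (h2.comp_homeomorph coordL.toHomeomorph) (by
        have e := tsupport_comp_eq_preimage η coordL.toHomeomorph
        have e' : tsupport (η ∘ coordL) = coordL ⁻¹' tsupport η := e
        rw [e', hpre]
        exact preimage_mono h3)
    rw [htr, htr]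
    have hf : ∀ x, fderiv ℝ (η ∘ coordL) x (EuclideanSpace.single 0 1) = deriv η (coordL x) := by
      intro x
      have hd := (h1.differentiable (by simp) (coordL x)).hasFDerivAt.comp x
        (coordL : Eu 1 →L[ℝ] ℝ).hasFDerivAt
      have e := congrArg (fun M : Eu 1 →L[ℝ] ℝ => M (EuclideanSpace.single 0 1)) hd.fderiv
      refine e.trans ?_
      change fderiv ℝ η (coordL x) (coordL (EuclideanSpace.single 0 1)) = _
      rw [coordL_single, fderiv_eq_smul_deriv, one_smul]
    simp only [hf, smul_eq_mul, Function.comp] at hw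
    simpa [W1.toLp, W1.partialLp] using hw
  have key' := measurePreserving_coordL.quasiMeasurePreserving.ae key
  have hΩm : MeasurableSet Ω := hΩ.isOpen.measurableSet
  refine (ae_restrict_iff' hΩm).2 ?_
  filter_upwards [key'] with x hx hxΩ
  have h1 := hx (by rw [hpre] at hxΩ; exact hxΩ)
  rw [ContinuousLinearEquiv.symm_apply_apply] at h1
  refine h1.trans ?_
  have n1 := (habs w.toLp).trans (mul_le_mul_of_nonneg_left w.norm_toLp_le hc0)
  have n2 := (habs (w.partialLp 0)).trans (mul_le_mul_of_nonneg_left (w.norm_partialLp_le 0) hc0)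
  have n3 := mul_le_mul_of_nonneg_left n1 (inv_pos.2 hba).le
  linarith

/-- Changes the target exponent of a bounded operator: a linear bound on the `L²` seminorms lets the
same functions be read as classes in `L²`. -/
lemma exists_clm_of_eLpNorm_le {α X : Type*} [MeasurableSpace α] {μ : Measure α}
    [NormedAddCommGroup X] [NormedSpace ℝ X] {p : ℝ≥0∞} [Fact (1 ≤ p)] (J : X →L[ℝ] Lp ℝ p μ)
    {C : ℝ} (hC : 0 ≤ C) (h : ∀ x, eLpNorm (J x) 2 μ ≤ ENNReal.ofReal (C * ‖x‖)) :
    ∃ Λ : X →L[ℝ] Lp ℝ 2 μ, ∀ x, Λ x =ᵐ[μ] J x := by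
  have hm : ∀ x, MemLp (J x) 2 μ := fun x =>
    ⟨Lp.aestronglyMeasurable _, (h x).trans_lt ENNReal.ofReal_lt_top⟩
  let L : X →ₗ[ℝ] Lp ℝ 2 μ :=
    { toFun := fun x => (hm x).toLp
      map_add' := fun x y => by
        refine Lp.ext ?_
        have e : J (x + y) = J x + J y := map_add J x y
        filter_upwards [(hm (x + y)).coeFn_toLp, (hm x).coeFn_toLp, (hm y).coeFn_toLp,
          Lp.coeFn_add (J x) (J y), Lp.coeFn_add (hm x).toLp (hm y).toLp] with t h1 h2 h3 h4 h5
        rw [h1, h5, Pi.add_apply, h2, h3, e, h4, Pi.add_apply]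
      map_smul' := fun c x => by
        refine Lp.ext ?_
        have e : J (c • x) = c • J x := map_smul J c x
        filter_upwards [(hm (c • x)).coeFn_toLp, (hm x).coeFn_toLp,
          Lp.coeFn_smul c (J x), Lp.coeFn_smul c (hm x).toLp] with t h1 h2 h3 h4
        rw [h1, RingHom.id_apply, h4, Pi.smul_apply, h2, e, h3, Pi.smul_apply] }
  refine ⟨L.mkContinuous C fun x => ?_, fun x => (hm x).coeFn_toLp⟩
  change ‖(hm x).toLp‖ ≤ _
  rw [Lp.norm_toLp]
  exact ENNReal.toReal_le_of_le_ofReal (by positivity) (h x)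

/-- For `p > n` the space `W^{1,p}` embeds into `L²`; if moreover `p < 2`, it embeds into `L^∞`. -/
lemma exists_embedding {n : ℕ} (hn : 1 ≤ n) {p : ℝ≥0∞} [Fact (1 ≤ p)] (hnp : (n : ℝ≥0∞) < p)
    {Ω : Set (Eu n)} (hΩ : IsBoundedLipschitzDomain Ω) :
    ∃ Λ : W1 Ω p ℝ →L[ℝ] Lp ℝ 2 (volume.restrict Ω),
      (∀ w : W1 Ω p ℝ, Λ w =ᵐ[volume.restrict Ω] w.toLp) ∧
      (2 ≤ p ∨ ∃ C, 0 ≤ C ∧ ∀ w : W1 Ω p ℝ, ∀ᵐ x ∂(volume.restrict Ω), |w.toLp x| ≤ C * ‖w‖) := by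
  have := hΩ.isFiniteMeasure
  set M : ℝ≥0∞ := volume.restrict Ω univ with hM
  have hMt : M ≠ ⊤ := measure_ne_top _ _
  -- For `p ≥ 2` finiteness of the measure suffices. Otherwise `n < p < 2` forces `n = 1`, where the
  -- one-dimensional `L^∞` bound applies.
  by_cases h2 : 2 ≤ p
  · set q : ℝ := 1 / (2 : ℝ≥0∞).toReal - 1 / p.toReal with hq
    have hq0 : 0 ≤ q := by
      rcases eq_or_ne p ⊤ with rfl | hp
      · simp [hq]
      · have h3 : (2 : ℝ) ≤ p.toReal := by
          simpa using (ENNReal.toReal_le_toReal (by simp) hp).2 h2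
        have : 1 / p.toReal ≤ 1 / 2 := one_div_le_one_div_of_le two_pos h3
        simp only [hq, ENNReal.toReal_ofNat]; linarith
    have hMq : M ^ q ≠ ⊤ := ENNReal.rpow_ne_top_of_nonneg hq0 hMt
    obtain ⟨Λ, hΛ⟩ := exists_clm_of_eLpNorm_le (W1.toLpL Ω p ℝ) (C := (M ^ q).toReal)
      ENNReal.toReal_nonneg fun w => by
        refine (eLpNorm_le_eLpNorm_mul_rpow_measure_univ h2 (Lp.aestronglyMeasurable _)).trans ?_
        rw [ENNReal.ofReal_mul ENNReal.toReal_nonneg, ENNReal.ofReal_toReal hMq, mul_comm]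
        refine mul_le_mul_right ?_ _
        rw [← ENNReal.ofReal_toReal (Lp.eLpNorm_ne_top (W1.toLpL Ω p ℝ w)), ← Lp.norm_def]
        exact ENNReal.ofReal_le_ofReal w.norm_toLp_le
    exact ⟨Λ, hΛ, Or.inl h2⟩
  · have hn1 : n = 1 := by
      have h3 : (n : ℝ≥0∞) < 2 := hnp.trans (not_le.1 h2)
      have h4 : n < 2 := by exact_mod_cast h3
      omega
    subst hn1
    obtain ⟨C, hC0, hC⟩ := exists_ae_abs_le_norm hΩ p
    have hMq : M ^ ((2 : ℝ≥0∞).toReal⁻¹) ≠ ⊤ := ENNReal.rpow_ne_top_of_nonneg (by simp) hMt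
    obtain ⟨Λ, hΛ⟩ := exists_clm_of_eLpNorm_le (W1.toLpL Ω p ℝ)
      (C := (M ^ ((2 : ℝ≥0∞).toReal⁻¹)).toReal * C) (by positivity) fun w => by
        refine (eLpNorm_le_of_ae_bound (C := C * ‖w‖) (hC w)).trans ?_
        rw [mul_assoc, ENNReal.ofReal_mul ENNReal.toReal_nonneg, ENNReal.ofReal_toReal hMq]
    exact ⟨Λ, hΛ, Or.inr ⟨C, hC0, hC⟩⟩

end Embedding


/-! ### Weighted pairings and the passage to the limit in difference quotients. -/

section Abstract

variable {α : Type*} [MeasurableSpace α] {μ : Measure α}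

lemma integral_mul_eq_inner (f g : Lp ℝ 2 μ) : ∫ x, f x * g x ∂μ = inner ℝ f g := by
  rw [L2.inner_def]
  refine integral_congr_ae (Eventually.of_forall fun x => ?_)
  simp [mul_comm]

lemma integral_sq_eq_norm (f : Lp ℝ 2 μ) : ∫ x, |f x| ^ 2 ∂μ = ‖f‖ ^ 2 := by
  rw [← real_inner_self_eq_norm_sq, ← integral_mul_eq_inner]
  refine integral_congr_ae (Eventually.of_forall fun x => ?_)
  change |f x| ^ 2 = f x * f x
  rw [sq_abs, sq]

lemma Lp.integrable_mul_two (f g : Lp ℝ 2 μ) : Integrable (fun x => f x * g x) μ :=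
  (Lp.memLp f).integrable_mul (Lp.memLp g)

variable {X Y : Type*} [NormedAddCommGroup X] [NormedSpace ℝ X] [NormedAddCommGroup Y]
  [NormedSpace ℝ Y] {Λ : X →L[ℝ] Lp ℝ 2 μ} {A : Y →L[ℝ] Y →L[ℝ] Lp ℝ 1 μ}

/-- The pairing `∫ H(z) A(u, v)`. -/
def pairing (Λ : X →L[ℝ] Lp ℝ 2 μ) (A : Y →L[ℝ] Y →L[ℝ] Lp ℝ 1 μ) (H : ℝ → ℝ) (z : X)
    (u v : Y) : ℝ :=
  ∫ x, H (Λ z x) * A u v x ∂μ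

lemma continuous_pairing (Λ : X →L[ℝ] Lp ℝ 2 μ) (A : Y →L[ℝ] Y →L[ℝ] Lp ℝ 1 μ) {H H' : ℝ → ℝ}
    {B : ℝ} (hH : IsBoundedC1 H H' B) :
    Continuous fun w : X × Y × Y => pairing Λ A H w.1 w.2.1 w.2.2 := by
  have h := continuous_integral_nemytskii (μ := μ) (p := 2) (K := fun s _ => H s) (B := B)
    (hH.continuous.comp continuous_fst) fun s _ => hH.bound s
  have h2 : Continuous fun w : X × Y × Y => (Λ w.1, (0 : Lp ℝ 1 μ), A w.2.1 w.2.2) := by fun_prop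
  exact h.comp h2

lemma integrable_pairing {H H' : ℝ → ℝ} {B : ℝ} (hH : IsBoundedC1 H H' B) (f : Lp ℝ 2 μ)
    (m : Lp ℝ 1 μ) : Integrable (fun x => H (f x) * m x) μ :=
  (L1.integrable_coeFn m).bdd_mul
    (hH.continuous.comp_aestronglyMeasurable (Lp.aestronglyMeasurable f))
    (Eventually.of_forall fun _ => hH.bound _)

lemma abs_pairing_le {H H' : ℝ → ℝ} {B : ℝ} (hH : IsBoundedC1 H H' B) (z : X) (u v : Y) :
    |pairing Λ A H z u v| ≤ B * ‖A u v‖ := by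
  rw [← integral_abs_eq_norm, ← integral_const_mul, ← Real.norm_eq_abs]
  refine norm_integral_le_of_norm_le ((L1.integrable_coeFn _).abs.const_mul B)
    (Eventually.of_forall fun x => ?_)
  rw [Real.norm_eq_abs, abs_mul]
  exact mul_le_mul_of_nonneg_right (hH.bound _) (abs_nonneg _)

/-- Passage to the limit in the difference quotients of a monotone curve `z`: if the functional `P`
balances the weighted increments of `z`, its value at the derivative dominates the weighted
derivative. -/
lemma integrable_and_nonneg_of_hasDerivAt {m : Lp ℝ 1 μ} (hm : ∀ᵐ x ∂μ, 0 ≤ m x) {P : X →L[ℝ] ℝ}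
    {z : ℝ → X} {z' : X} {t T : ℝ} (htT : t < T) (hz : HasDerivAt z z' t)
    (hanti : ∀ s ∈ Ioc t T, ∀ᵐ x ∂μ, Λ (z s) x ≤ Λ (z t) x)
    (hint : ∀ s ∈ Ioc t T, Integrable (fun x => m x * (Λ (z s) x - Λ (z t) x)) μ)
    (hP : ∀ s ∈ Ioc t T, P (z s - z t) + ∫ x, m x * (Λ (z s) x - Λ (z t) x) ∂μ = 0) :
    Integrable (fun x => m x * Λ z' x) μ ∧ 0 ≤ (∫ x, m x * Λ z' x ∂μ) + P z' := by
  set δ : ℕ → ℝ := fun k => (T - t) * (1 / ((k : ℝ) + 1)) with hδ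
  have hδ0 : ∀ k, 0 < δ k := fun k => mul_pos (sub_pos.2 htT) (by positivity)
  have hδ1 : ∀ k, δ k ≤ T - t := fun k => by
    refine mul_le_of_le_one_right (sub_pos.2 htT).le (div_le_one_of_le₀ ?_ (by positivity))
    have : (0 : ℝ) ≤ k := Nat.cast_nonneg k
    linarith
  have hδlim : Tendsto δ atTop (𝓝 0) := by
    have := tendsto_one_div_add_atTop_nhds_zero_nat (𝕜 := ℝ).const_mul (T - t)
    rwa [mul_zero] at this
  have hs : ∀ k, t + δ k ∈ Ioc t T := fun k =>
    ⟨by linarith [hδ0 k], by linarith [hδ1 k]⟩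
  set q : ℕ → X := fun k => (δ k)⁻¹ • (z (t + δ k) - z t) with hq
  have hqlim : Tendsto q atTop (𝓝 z') := by
    have h1 := hasDerivAt_iff_tendsto_slope_zero.1 hz
    refine h1.comp (tendsto_nhdsWithin_iff.2 ⟨hδlim, Eventually.of_forall fun k => (hδ0 k).ne'⟩)
  have hΛq : ∀ k, ∀ᵐ x ∂μ, Λ (q k) x = (δ k)⁻¹ * (Λ (z (t + δ k)) x - Λ (z t) x) := fun k => by
    have e : Λ (q k) = (δ k)⁻¹ • (Λ (z (t + δ k)) - Λ (z t)) := by simp [hq]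
    rw [e]
    filter_upwards [Lp.coeFn_smul (δ k)⁻¹ (Λ (z (t + δ k)) - Λ (z t)),
      Lp.coeFn_sub (Λ (z (t + δ k))) (Λ (z t))] with x h1 h2
    rw [h1, Pi.smul_apply, h2]; rfl
  have hqint : ∀ k, Integrable (fun x => -(m x * Λ (q k) x)) μ := fun k => by
    refine (((hint _ (hs k)).const_mul (δ k)⁻¹).neg).congr ?_
    filter_upwards [hΛq k] with x hx
    simp only [Pi.neg_apply]
    rw [hx]; ring
  -- This is where monotonicity of the curve and nonnegativity of the weight enter; the sign is what
  -- Fatou's lemma requires.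
  have hq0 : ∀ k, 0 ≤ᵐ[μ] fun x => -(m x * Λ (q k) x) := fun k => by
    filter_upwards [hΛq k, hm, hanti _ (hs k)] with x h1 h2 h3
    have : 0 ≤ m x * ((δ k)⁻¹ * (Λ (z t) x - Λ (z (t + δ k)) x)) :=
      mul_nonneg h2 (mul_nonneg (inv_pos.2 (hδ0 k)).le (sub_nonneg.2 h3))
    simp only [Pi.zero_apply]
    rw [h1]; linarith
  have hPq : ∀ k, ∫ x, -(m x * Λ (q k) x) ∂μ = P (q k) := fun k => by
    have h1 := hP _ (hs k)
    have h2 : P (q k) = (δ k)⁻¹ * P (z (t + δ k) - z t) := by simp [hq]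
    have h3 : ∫ x, -(m x * Λ (q k) x) ∂μ
        = -((δ k)⁻¹ * ∫ x, m x * (Λ (z (t + δ k)) x - Λ (z t) x) ∂μ) := by
      rw [← integral_const_mul, ← integral_neg]
      refine integral_congr_ae ?_
      filter_upwards [hΛq k] with x hx
      rw [hx]; ring
    rw [h2, h3, eq_neg_of_add_eq_zero_left h1]; ring
  have hPlim : Tendsto (fun k => P (q k)) atTop (𝓝 (P z')) := (P.continuous.tendsto _).comp hqlim
  have hP0 : 0 ≤ P z' := ge_of_tendsto' hPlim fun k => by
    rw [← hPq k]; exact integral_nonneg_of_ae (hq0 k)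
  obtain ⟨ns, hns, hae⟩ := exists_subseq_tendsto_ae_of_tendsto_Lp ((Λ.continuous.tendsto _).comp hqlim)
  have hmeas : AEStronglyMeasurable (fun x => -(m x * Λ z' x)) μ :=
    ((Lp.aestronglyMeasurable m).mul (Lp.aestronglyMeasurable (Λ z'))).neg
  have hlim : ∀ᵐ x ∂μ, Tendsto (fun k => -(m x * Λ (q (ns k)) x)) atTop (𝓝 (-(m x * Λ z' x))) := by
    filter_upwards [hae] with x hx
    exact (hx.const_mul (m x)).neg
  have hnn : 0 ≤ᵐ[μ] fun x => -(m x * Λ z' x) := by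
    filter_upwards [hlim, ae_all_iff.2 hq0] with x h1 h2
    exact ge_of_tendsto' h1 fun k => h2 (ns k)
  -- The product `m * Λ z'` of an `L¹` and an `L²` function is not integrable a priori. Along a
  -- subsequence the nonnegative functions `-(m * Λ q)` converge almost everywhere, while their
  -- integrals `P q` converge to `P z'`. Fatou's lemma then yields integrability and the one-sided
  -- inequality together.
  have hfatou : ∫⁻ x, ENNReal.ofReal (-(m x * Λ z' x)) ∂μ ≤ ENNReal.ofReal (P z') := by
    have h1 : ∫⁻ x, ENNReal.ofReal (-(m x * Λ z' x)) ∂μ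
        = ∫⁻ x, liminf (fun k => ENNReal.ofReal (-(m x * Λ (q (ns k)) x))) atTop ∂μ := by
      refine lintegral_congr_ae ?_
      filter_upwards [hlim] with x hx
      exact ((ENNReal.continuous_ofReal.tendsto _).comp hx).liminf_eq.symm
    rw [h1]
    refine (lintegral_liminf_le' fun k =>
      (hqint (ns k)).aestronglyMeasurable.aemeasurable.ennreal_ofReal).trans ?_
    have h2 : ∀ k, ∫⁻ x, ENNReal.ofReal (-(m x * Λ (q (ns k)) x)) ∂μ
        = ENNReal.ofReal (P (q (ns k))) := fun k => by
      rw [← hPq, ofReal_integral_eq_lintegral_ofReal (hqint _) (hq0 _)]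
    simp only [h2]
    exact ((ENNReal.continuous_ofReal.tendsto _).comp
      (hPlim.comp hns.tendsto_atTop)).liminf_eq.le
  have hi : Integrable (fun x => -(m x * Λ z' x)) μ := by
    refine ⟨hmeas, ?_⟩
    rw [hasFiniteIntegral_iff_ofReal hnn]
    exact hfatou.trans_lt ENNReal.ofReal_lt_top
  refine ⟨by simpa using hi.neg, ?_⟩
  have h3 : ∫ x, -(m x * Λ z' x) ∂μ ≤ P z' := by
    rw [integral_eq_lintegral_of_nonneg_ae hnn hmeas]
    exact ENNReal.toReal_le_of_le_ofReal hP0 hfatou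
  rw [integral_neg] at h3
  linarith

end Abstract

/-! ### Monotonicity in time and the bounds `0 ≤ z ≤ 1`. -/

section Order

variable {n : ℕ} {Ω : Set (Eu n)} {p : ℝ≥0∞} [Fact (1 ≤ p)] {T : ℝ}

/-- Provides the order structure used for the sign of Bochner integrals with values in `L^p`. -/
instance instIsOrderedModuleLp {α : Type*} [MeasurableSpace α] (μ : Measure α) (p : ℝ≥0∞) :
    IsOrderedModule ℝ (Lp ℝ p μ) := by
  refine IsOrderedModule.of_smul_nonneg fun c hc f hf => ?_
  rw [← Lp.coeFn_nonneg] at hf ⊢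
  filter_upwards [hf, Lp.coeFn_smul c f] with x h1 h2
  rw [h2]
  exact mul_nonneg hc h1

lemma isClosed_nonneg : IsClosed {ζ : W1 Ω p ℝ | ∀ᵐ x ∂(volume.restrict Ω), 0 ≤ ζ.toLp x} := by
  have h : {ζ : W1 Ω p ℝ | ∀ᵐ x ∂(volume.restrict Ω), 0 ≤ ζ.toLp x}
      = W1.toLpL Ω p ℝ ⁻¹' Ici 0 := by
    ext ζ
    exact Lp.coeFn_nonneg (W1.toLpL Ω p ℝ ζ)
  rw [h]
  exact isClosed_Ici.preimage (W1.toLpL Ω p ℝ).continuous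

/-- The increment is the Bochner integral of nonpositive elements of `L^p`, hence itself
nonpositive. -/
lemma ae_le_of_dt_nonpos (z : W1InTime T p (W1 Ω p ℝ))
    (h : ∀ᵐ t ∂(timeMeasure T), ∀ᵐ x ∂(volume.restrict Ω), (z.dt t).toLp x ≤ 0) {s t : ℝ}
    (hs : s ∈ Icc 0 T) (ht : t ∈ Icc 0 T) (hst : s ≤ t) :
    ∀ᵐ x ∂(volume.restrict Ω), (z.val t).toLp x ≤ (z.val s).toLp x := by
  have hp : 1 ≤ p := Fact.out
  have hT : 0 ≤ T := hs.1.trans hs.2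
  have h1 := (z.isW1.comp_clm hp (W1.toLpL Ω p ℝ)).sub_eq_integral hp hs ht
  have h2 : ∫ r in s..t, W1.toLpL Ω p ℝ (z.dt r) ≤ 0 := by
    have h3 : 0 ≤ ∫ r in s..t, -W1.toLpL Ω p ℝ (z.dt r) := by
      rw [intervalIntegral.integral_of_le hst]
      refine integral_nonneg_of_ae ?_
      have hsub : Ioc s t ⊆ Ioc 0 T := Ioc_subset_Ioc hs.1 ht.2
      have h4 : ∀ᵐ r ∂(volume.restrict (Ioc 0 T)), ∀ᵐ x ∂(volume.restrict Ω),
          (z.dt r).toLp x ≤ 0 := by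
        rw [← restrict_Ioo_eq_restrict_Ioc]; exact h
      filter_upwards [ae_restrict_of_ae_restrict_of_subset hsub h4] with r hr
      refine (Lp.coeFn_nonneg _).1 ?_
      filter_upwards [hr, Lp.coeFn_neg (W1.toLpL Ω p ℝ (z.dt r))] with x hx hx'
      rw [hx']
      exact neg_nonneg.2 hx
    rw [intervalIntegral.integral_neg] at h3
    exact neg_nonneg.1 h3
  rw [← h1, sub_nonpos] at h2
  exact (Lp.coeFn_le _ _).2 h2

/-- The lower bound passes from almost every time to every time, as the cone of nonnegative
functions is closed and `z` is continuous. The upper bound is inherited from the initial value by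
monotonicity. -/
lemma ae_mem_Icc (z : W1InTime T p (W1 Ω p ℝ)) (hT : 0 < T)
    (h : ∀ᵐ t ∂(timeMeasure T), ∀ᵐ x ∂(volume.restrict Ω), (z.dt t).toLp x ≤ 0)
    (h0 : ∀ᵐ t ∂(timeMeasure T), ∀ᵐ x ∂(volume.restrict Ω), 0 ≤ (z.val t).toLp x)
    (h1 : ∀ᵐ x ∂(volume.restrict Ω), (z.val 0).toLp x ≤ 1) {t : ℝ} (ht : t ∈ Icc 0 T) :
    ∀ᵐ x ∂(volume.restrict Ω), (z.val t).toLp x ∈ Icc (0 : ℝ) 1 := by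
  have hp : 1 ≤ p := Fact.out
  have h2 := z.isW1.mem_of_ae_mem hp hT isClosed_nonneg h0 t ht
  filter_upwards [h1, h2, ae_le_of_dt_nonpos z h ⟨le_rfl, hT.le⟩ ht ht.1] with x a b c
  exact ⟨b, c.trans a⟩

end Order


/-! ### The weak conditions with null sets independent of the test function. -/

section Weak

variable {n : ℕ} {Ω : Set (Eu n)} {p : ℝ≥0∞} [Fact (1 ≤ p)] {T : ℝ}
  {Λ : W1 Ω p ℝ →L[ℝ] Lp ℝ 2 (volume.restrict Ω)}
  {C : Tensor4 n} {h f H H' F F' : ℝ → ℝ} {B B' : ℝ}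

/-- The elastic stress power written with the bounded extension `H` of `h`. -/
lemma integral_elasticWe_eq_pairing
    (hΛ : ∀ w : W1 Ω p ℝ, Λ w =ᵐ[volume.restrict Ω] w.toLp)
    (hHh : ∀ s ∈ Icc (0 : ℝ) 1, H s = h s) {z : W1 Ω p ℝ}
    (hz : ∀ᵐ x ∂(volume.restrict Ω), z.toLp x ∈ Icc (0 : ℝ) 1) (u v : W1 Ω 2 (Eu n)) :
    ∫ x in Ω, frob (elasticWe C h (strain u x) (z.toLp x)) (strain v x)
      = pairing Λ (energyForm Ω C) H z u v := by
  refine integral_congr_ae ?_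
  filter_upwards [hΛ z, hz, energyForm_ae C u v] with x h1 h2 h3
  rw [h1, h3, hHh _ h2, elasticWe, frob_smul_left]

lemma inner_toLpL_eq (v : Lp (Eu n) 2 (volume.restrict Ω)) (ζ : W1 Ω 2 (Eu n)) :
    ∫ x in Ω, inner ℝ (v x) (ζ.toLp x) = inner ℝ v (W1.toLpL Ω 2 (Eu n) ζ) := by
  rw [L2.inner_def]; rfl

/-- The exchange of quantifiers is needed because the test function used later, `∂ₜ(u - b)(t)`,
depends on time. Both sides are continuous in `ζ` and `H¹` is separable. -/
lemma ae_force_balance {ΓD : Set (Eu n)} {ℓ : ℝ → Lp (Eu n) 2 (volume.restrict Ω)}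
    {u : HypPath Ω T} {z : W1InTime T p (W1 Ω p ℝ)}
    (hΛ : ∀ w : W1 Ω p ℝ, Λ w =ᵐ[volume.restrict Ω] w.toLp)
    (hH : IsBoundedC1 H H' B) (hHh : ∀ s ∈ Icc (0 : ℝ) 1, H s = h s)
    (hz : ∀ t ∈ Icc 0 T, ∀ᵐ x ∂(volume.restrict Ω), (z.val t).toLp x ∈ Icc (0 : ℝ) 1)
    (hforce : ∀ ζ : W1 Ω 2 (Eu n), VanishesOn ΓD ζ → ∀ᵐ t ∂(timeMeasure T),
      (∫ x in Ω, inner ℝ (u.acc t x) (ζ.toLp x))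
        + (∫ x in Ω, frob (elasticWe C h (strain (u.val t) x) ((z.val t).toLp x)) (strain ζ x))
        = ∫ x in Ω, inner ℝ (ℓ t x) (ζ.toLp x)) :
    ∀ᵐ t ∂(timeMeasure T), ∀ ζ ∈ vanishing Ω ΓD,
      inner ℝ (u.acc t) (W1.toLpL Ω 2 (Eu n) ζ)
        + pairing Λ (energyForm Ω C) H (z.val t) (u.val t) ζ
        = inner ℝ (ℓ t) (W1.toLpL Ω 2 (Eu n) ζ) := by
  have : Fact ((2 : ℝ≥0∞) ≠ ⊤) := ⟨by simp⟩
  refine ae_forall_of_forall_ae (vanishing Ω ΓD : Set (W1 Ω 2 (Eu n)))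
    (Eventually.of_forall fun t y x _ _ hyx hP => ?_) fun ζ hζ => ?_
  · have c0 : Continuous fun ζ : W1 Ω 2 (Eu n) => (z.val t, u.val t, ζ) := by fun_prop
    have c1 := (continuous_pairing Λ (energyForm Ω C) hH).comp c0
    have c2 : Continuous fun ζ : W1 Ω 2 (Eu n) =>
        (inner ℝ (u.acc t) (W1.toLpL Ω 2 (Eu n) ζ) : ℝ) :=
      continuous_const.inner (W1.toLpL Ω 2 (Eu n)).continuous
    have c3 : Continuous fun ζ : W1 Ω 2 (Eu n) =>
        (inner ℝ (ℓ t) (W1.toLpL Ω 2 (Eu n) ζ) : ℝ) :=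
      continuous_const.inner (W1.toLpL Ω 2 (Eu n)).continuous
    exact tendsto_nhds_unique_of_eventuallyEq (((c2.add c1).tendsto x).comp hyx)
      ((c3.tendsto x).comp hyx) (Eventually.of_forall fun k => hP k)
  · filter_upwards [hforce ζ hζ, ae_mem_timeMeasure T] with t ht htT
    rw [inner_toLpL_eq, inner_toLpL_eq,
      integral_elasticWe_eq_pairing hΛ hHh (hz t (Ioo_subset_Icc_self htT))] at ht
    exact ht

/-- The `p`-Laplacian `∫ |g|^{p-2} g · v`. -/
def pLaplace (g v : Lp (Eu n) p (volume.restrict Ω)) : ℝ :=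
  ∫ x in Ω, ‖g x‖ ^ (p.toReal - 2) * inner ℝ (g x) (v x)

/-- The terms of the damage law that are continuous in the test function `ζ`. -/
def damageResidual (Λ : W1 Ω p ℝ →L[ℝ] Lp ℝ 2 (volume.restrict Ω)) (F' : ℝ → ℝ) (z zt : W1 Ω p ℝ)
    (ξ φ : Lp ℝ 2 (volume.restrict Ω)) (ζ : W1 Ω p ℝ) : ℝ :=
  inner ℝ (Λ zt) (Λ ζ) + pLaplace (gradL Ω p z) (gradL Ω p ζ)
    + (∫ x in Ω, F' (Λ z x) * Λ ζ x) + inner ℝ ξ (Λ ζ) + inner ℝ φ (Λ ζ)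

lemma memLp_comp_deriv [IsFiniteMeasure (volume.restrict Ω)] (hF : IsBoundedC1 F F' B')
    (z : Lp ℝ 2 (volume.restrict Ω)) : MemLp (fun x => F' (z x)) 2 (volume.restrict Ω) :=
  MemLp.of_bound (hF.continuous_deriv.comp_aestronglyMeasurable (Lp.aestronglyMeasurable z)) B'
    (Eventually.of_forall fun _ => hF.bound_deriv _)

lemma exists_clm_damageResidual [IsFiniteMeasure (volume.restrict Ω)] (hp1 : 1 < p) (hp : p ≠ ⊤)
    (hF : IsBoundedC1 F F' B') (z zt : W1 Ω p ℝ) (ξ φ : Lp ℝ 2 (volume.restrict Ω)) :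
    ∃ P : W1 Ω p ℝ →L[ℝ] ℝ, ∀ ζ, P ζ = damageResidual Λ F' z zt ξ φ ζ := by
  obtain ⟨Q, hQ⟩ := exists_clm_pLaplace hp1 hp (gradL Ω p z)
  have hm := memLp_comp_deriv hF (Λ z)
  refine ⟨(innerSL ℝ (Λ zt + hm.toLp + ξ + φ)).comp Λ + Q.comp (gradL Ω p), fun ζ => ?_⟩
  have e : inner ℝ hm.toLp (Λ ζ) = ∫ x in Ω, F' (Λ z x) * Λ ζ x := by
    rw [← integral_mul_eq_inner]
    refine integral_congr_ae ?_
    filter_upwards [hm.coeFn_toLp] with x hx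
    rw [hx]
  simp only [damageResidual, add_apply, ContinuousLinearMap.comp_apply, innerSL_apply_apply,
    inner_add_left, hQ, e, pLaplace]
  ring

/-- The weight `½ H'(z) A(u, u)` as an element of `L¹`. -/
lemma exists_weight (hH : IsBoundedC1 H H' B) (z : Lp ℝ 2 (volume.restrict Ω))
    (a : Lp ℝ 1 (volume.restrict Ω)) :
    ∃ m : Lp ℝ 1 (volume.restrict Ω), m =ᵐ[volume.restrict Ω] fun x => 1 / 2 * H' (z x) * a x := by
  have hi : Integrable (fun x => 1 / 2 * H' (z x) * a x) (volume.restrict Ω) := by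
    refine (L1.integrable_coeFn a).bdd_mul (c := 1 / 2 * B)
      ((hH.continuous_deriv.comp_aestronglyMeasurable (Lp.aestronglyMeasurable z)).const_mul _)
      (Eventually.of_forall fun x => ?_)
    rw [norm_mul]
    norm_num
    exact hH.bound_deriv _
  exact ⟨(memLp_one_iff_integrable.2 hi).toLp, (memLp_one_iff_integrable.2 hi).coeFn_toLp⟩

/-- The damage law, tested with `ζ`, in terms of the embedding into `L²` and the bounded extensions
of the coefficients. -/
def damageBalance (Λ : W1 Ω p ℝ →L[ℝ] Lp ℝ 2 (volume.restrict Ω)) (C : Tensor4 n) (H' F' : ℝ → ℝ)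
    (u : W1 Ω 2 (Eu n)) (z zt : W1 Ω p ℝ) (ξ φ : Lp ℝ 2 (volume.restrict Ω)) (ζ : W1 Ω p ℝ) : ℝ :=
  damageResidual Λ F' z zt ξ φ ζ + ∫ x in Ω, 1 / 2 * H' (Λ z x) * energyForm Ω C u u x * Λ ζ x

/-- The truncation of a real number to `[0, 1]`. -/
def clamp01 (s : ℝ) : ℝ := max 0 (min s 1)

lemma continuous_clamp01 : Continuous clamp01 := by unfold clamp01; fun_prop

lemma abs_clamp01_le (s : ℝ) : |clamp01 s| ≤ 1 := by
  rw [clamp01, abs_of_nonneg (le_max_left _ _)]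
  exact max_le zero_le_one (min_le_right _ _)

lemma clamp01_of_mem {s : ℝ} (hs : s ∈ Icc (0 : ℝ) 1) : clamp01 s = s := by
  rw [clamp01, min_eq_left hs.2, max_eq_right hs.1]

/-- The weight is only in `L¹`, so its pairing with `ζ` is not continuous in `L²`. On functions with
values in `[0,1]`, however, `ζ` equals its clamp, and the pairing becomes a bounded superposition
integrated against an `L¹` weight. -/
lemma damageBalance_eq_zero_of_tendsto [IsFiniteMeasure (volume.restrict Ω)] (hp1 : 1 < p)
    (hp : p ≠ ⊤) (hΛ : ∀ w : W1 Ω p ℝ, Λ w =ᵐ[volume.restrict Ω] w.toLp)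
    (hH : IsBoundedC1 H H' B) (hF : IsBoundedC1 F F' B')
    (u : W1 Ω 2 (Eu n)) (z zt : W1 Ω p ℝ) (ξ φ : Lp ℝ 2 (volume.restrict Ω))
    {y : ℕ → W1 Ω p ℝ} {w : W1 Ω p ℝ}
    (hy : ∀ k, ∀ᵐ x ∂(volume.restrict Ω), (y k).toLp x ∈ Icc (0 : ℝ) 1)
    (hw : ∀ᵐ x ∂(volume.restrict Ω), w.toLp x ∈ Icc (0 : ℝ) 1) (hyw : Tendsto y atTop (𝓝 w))
    (h0 : ∀ k, damageBalance Λ C H' F' u z zt ξ φ (y k) = 0) :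
    damageBalance Λ C H' F' u z zt ξ φ w = 0 := by
  obtain ⟨P, hP⟩ := exists_clm_damageResidual (Λ := Λ) hp1 hp hF z zt ξ φ
  obtain ⟨m, hm⟩ := exists_weight hH (Λ z) (energyForm Ω C u u)
  have c1 := continuous_integral_nemytskii (μ := volume.restrict Ω) (p := 2)
    (K := fun s _ => clamp01 s) (continuous_clamp01.comp continuous_fst)
    fun s _ => abs_clamp01_le s
  have c0 : Continuous fun ζ : W1 Ω p ℝ => (Λ ζ, (0 : Lp ℝ 1 (volume.restrict Ω)), m) :=
    Λ.continuous.prodMk continuous_const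
  have c2 := P.continuous.add (c1.comp c0)
  have e : ∀ ζ : W1 Ω p ℝ, (∀ᵐ x ∂(volume.restrict Ω), ζ.toLp x ∈ Icc (0 : ℝ) 1) →
      damageBalance Λ C H' F' u z zt ξ φ ζ = P ζ + ∫ x in Ω, clamp01 (Λ ζ x) * m x := by
    intro ζ hζ
    rw [hP, damageBalance]
    congr 1
    refine integral_congr_ae ?_
    filter_upwards [hm, hζ, hΛ ζ] with x h1 h2 h3
    rw [h1, clamp01_of_mem (h3 ▸ h2)]; ring
  rw [e w hw]
  refine tendsto_nhds_unique ((c2.tendsto w).comp hyw) ?_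
  refine tendsto_const_nhds.congr fun k => ?_
  rw [← h0 k, e (y k) (hy k)]
  rfl

lemma integrable_weight_mul (hH : IsBoundedC1 H H' B) (z : Lp ℝ 2 (volume.restrict Ω))
    (a : Lp ℝ 1 (volume.restrict Ω)) (g : Lp ℝ 2 (volume.restrict Ω)) {c : ℝ}
    (hg : ∀ᵐ x ∂(volume.restrict Ω), |g x| ≤ c) :
    Integrable (fun x => 1 / 2 * H' (z x) * a x * g x) (volume.restrict Ω) := by
  obtain ⟨m, hm⟩ := exists_weight hH z a
  refine ((L1.integrable_coeFn m).mul_bdd (c := c) (Lp.aestronglyMeasurable g) hg).congr ?_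
  filter_upwards [hm] with x hx
  rw [hx]

lemma integrable_deriv_mul [IsFiniteMeasure (volume.restrict Ω)] (hF : IsBoundedC1 F F' B')
    (z g : Lp ℝ 2 (volume.restrict Ω)) :
    Integrable (fun x => F' (z x) * g x) (volume.restrict Ω) :=
  (memLp_comp_deriv hF z).integrable_mul (Lp.memLp g)

lemma integral_add_four {α : Type*} [MeasurableSpace α] {μ : Measure α} {f₁ f₂ f₃ f₄ : α → ℝ}
    (h₁ : Integrable f₁ μ) (h₂ : Integrable f₂ μ) (h₃ : Integrable f₃ μ) (h₄ : Integrable f₄ μ) :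
    ∫ x, (f₁ x + f₂ x + f₃ x + f₄ x) ∂μ
      = (∫ x, f₁ x ∂μ) + (∫ x, f₂ x ∂μ) + (∫ x, f₃ x ∂μ) + ∫ x, f₄ x ∂μ := by
  have h12 : Integrable (fun x => f₁ x + f₂ x) μ := h₁.add h₂
  have h123 : Integrable (fun x => f₁ x + f₂ x + f₃ x) μ := h12.add h₃
  rw [integral_add h123 h₄, integral_add h12 h₃, integral_add h₁ h₂]

lemma integral_mul_toLp_eq_inner (hΛ : ∀ w : W1 Ω p ℝ, Λ w =ᵐ[volume.restrict Ω] w.toLp)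
    (η : Lp ℝ 2 (volume.restrict Ω)) (ζ : W1 Ω p ℝ) :
    ∫ x in Ω, η x * ζ.toLp x = inner ℝ η (Λ ζ) := by
  rw [← integral_mul_eq_inner]
  refine integral_congr_ae ?_
  filter_upwards [hΛ ζ] with x hx
  rw [hx]

/-- The range `[0,1]` of `ζ` makes the product with the `L¹` weight integrable, without which the
integral could not be split into its four terms. -/
lemma damageBalance_eq [IsFiniteMeasure (volume.restrict Ω)] (hp1 : 1 < p) (hp : p ≠ ⊤)
    (hΛ : ∀ w : W1 Ω p ℝ, Λ w =ᵐ[volume.restrict Ω] w.toLp)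
    (hH : IsBoundedC1 H H' B) (hHh : ∀ s ∈ Icc (0 : ℝ) 1, H' s = deriv01 h s)
    (hF : IsBoundedC1 F F' B') (hFf : ∀ s ∈ Icc (0 : ℝ) 1, F' s = deriv01 f s)
    (u : W1 Ω 2 (Eu n)) (z zt : W1 Ω p ℝ) (ξ φ : Lp ℝ 2 (volume.restrict Ω)) (ζ : W1 Ω p ℝ)
    (hz : ∀ᵐ x ∂(volume.restrict Ω), z.toLp x ∈ Icc (0 : ℝ) 1)
    (hζ : ∀ᵐ x ∂(volume.restrict Ω), ζ.toLp x ∈ Icc (0 : ℝ) 1) :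
    damageBalance Λ C H' F' u z zt ξ φ ζ =
      (∫ x in Ω, (zt.toLp x * ζ.toLp x
            + ‖grad z x‖ ^ (p.toReal - 2) * inner ℝ (grad z x) (grad ζ x)
            + elasticWz C h (strain u x) (z.toLp x) * ζ.toLp x
            + deriv01 f (z.toLp x) * ζ.toLp x))
      + (∫ x in Ω, ξ x * ζ.toLp x) + ∫ x in Ω, φ x * ζ.toLp x := by
  have i1 : Integrable (fun x => Λ zt x * Λ ζ x) (volume.restrict Ω) := Lp.integrable_mul_two _ _
  have i2 := (hasDerivAt_norm_rpow_Lp hp1 hp (gradL Ω p z) (gradL Ω p ζ)).1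
  have i3 : Integrable (fun x => 1 / 2 * H' (Λ z x) * energyForm Ω C u u x * Λ ζ x)
      (volume.restrict Ω) := by
    refine integrable_weight_mul hH _ _ _ (c := 1) ?_
    filter_upwards [hζ, hΛ ζ] with x h1 h2
    rw [h2, abs_of_nonneg h1.1]; exact h1.2
  have i4 := integrable_deriv_mul hF (Λ z) (Λ ζ)
  have e1 : ∫ x in Ω, (zt.toLp x * ζ.toLp x
            + ‖grad z x‖ ^ (p.toReal - 2) * inner ℝ (grad z x) (grad ζ x)
            + elasticWz C h (strain u x) (z.toLp x) * ζ.toLp x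
            + deriv01 f (z.toLp x) * ζ.toLp x)
      = inner ℝ (Λ zt) (Λ ζ) + pLaplace (gradL Ω p z) (gradL Ω p ζ)
        + (∫ x in Ω, 1 / 2 * H' (Λ z x) * energyForm Ω C u u x * Λ ζ x)
        + ∫ x in Ω, F' (Λ z x) * Λ ζ x := by
    refine (integral_congr_ae ?_).trans ((integral_add_four i1 i2 i3 i4).trans ?_)
    · filter_upwards [hΛ ζ, hΛ zt, hΛ z, hz, gradL_ae z, gradL_ae ζ,
        energyForm_ae C u u] with x h1 h2 h3 h4 h5 h6 h7
      simp only [h1, h2, h3, h5, h6, h7, hHh _ h4, hFf _ h4, elasticWz]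
    · simp only [integral_mul_eq_inner, pLaplace]
  simp only [e1, integral_mul_toLp_eq_inner hΛ, damageBalance, damageResidual]
  ring

/-- The set of `[0,1]`-valued test functions is large enough to contain every `z(s)` and small
enough for the balance to be continuous on it. -/
lemma ae_damage_law [IsFiniteMeasure (volume.restrict Ω)] (hp1 : 1 < p) (hp : p ≠ ⊤)
    {u : HypPath Ω T} {z : W1InTime T p (W1 Ω p ℝ)} {ξ φ : ℝ → Lp ℝ 2 (volume.restrict Ω)}
    (hΛ : ∀ w : W1 Ω p ℝ, Λ w =ᵐ[volume.restrict Ω] w.toLp)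
    (hH : IsBoundedC1 H H' B) (hHh : ∀ s ∈ Icc (0 : ℝ) 1, H' s = deriv01 h s)
    (hF : IsBoundedC1 F F' B') (hFf : ∀ s ∈ Icc (0 : ℝ) 1, F' s = deriv01 f s)
    (hz : ∀ t ∈ Icc 0 T, ∀ᵐ x ∂(volume.restrict Ω), (z.val t).toLp x ∈ Icc (0 : ℝ) 1)
    (hlaw : ∀ ζ : W1 Ω p ℝ, ∀ᵐ t ∂(timeMeasure T),
      0 = (∫ x in Ω, ((z.dt t).toLp x * ζ.toLp x
            + ‖grad (z.val t) x‖ ^ (p.toReal - 2) * inner ℝ (grad (z.val t) x) (grad ζ x)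
            + elasticWz C h (strain (u.val t) x) ((z.val t).toLp x) * ζ.toLp x
            + deriv01 f ((z.val t).toLp x) * ζ.toLp x))
      + (∫ x in Ω, ξ t x * ζ.toLp x) + ∫ x in Ω, φ t x * ζ.toLp x) :
    ∀ᵐ t ∂(timeMeasure T), ∀ ζ ∈ {ζ : W1 Ω p ℝ | ∀ᵐ x ∂(volume.restrict Ω),
        ζ.toLp x ∈ Icc (0 : ℝ) 1},
      damageBalance Λ C H' F' (u.val t) (z.val t) (z.dt t) (ξ t) (φ t) ζ = 0 := by
  have : Fact (p ≠ ⊤) := ⟨hp⟩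
  refine ae_forall_of_forall_ae {ζ : W1 Ω p ℝ | ∀ᵐ x ∂(volume.restrict Ω),
        ζ.toLp x ∈ Icc (0 : ℝ) 1} (P := fun t ζ =>
      damageBalance Λ C H' F' (u.val t) (z.val t) (z.dt t) (ξ t) (φ t) ζ = 0)
    (Eventually.of_forall fun t y x hy hx hyx hP => ?_) fun ζ hζ => ?_
  · exact damageBalance_eq_zero_of_tendsto hp1 hp hΛ hH hF _ _ _ _ _ hy hx hyx hP
  · filter_upwards [hlaw ζ, ae_mem_timeMeasure T] with t ht htT
    rw [ht]
    exact damageBalance_eq hp1 hp hΛ hH hHh hF hFf _ _ _ _ _ _ (hz t (Ioo_subset_Icc_self htT)) hζ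

/-- Once the null set is independent of `ζ`, the choice `ζ = ∂ₜz(t)` is admissible. -/
lemma ae_inner_phi_dt_nonpos {z : W1InTime T p (W1 Ω p ℝ)} (hp : p ≠ ⊤)
    {φ : ℝ → Lp ℝ 2 (volume.restrict Ω)}
    (hΛ : ∀ w : W1 Ω p ℝ, Λ w =ᵐ[volume.restrict Ω] w.toLp)
    (hφ : ∀ ζ : W1 Ω p ℝ, (∀ᵐ x ∂(volume.restrict Ω), ζ.toLp x ≤ 0) →
      ∀ᵐ t ∂(timeMeasure T), ∫ x in Ω, φ t x * ζ.toLp x ≤ 0)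
    (hdt : ∀ᵐ t ∂(timeMeasure T), ∀ᵐ x ∂(volume.restrict Ω), (z.dt t).toLp x ≤ 0) :
    ∀ᵐ t ∂(timeMeasure T), inner ℝ (φ t) (Λ (z.dt t)) ≤ (0 : ℝ) := by
  have : Fact (p ≠ ⊤) := ⟨hp⟩
  have key : ∀ᵐ t ∂(timeMeasure T), ∀ ζ ∈ {ζ : W1 Ω p ℝ | ∀ᵐ x ∂(volume.restrict Ω),
      ζ.toLp x ≤ 0}, inner ℝ (φ t) (Λ ζ) ≤ (0 : ℝ) := by
    refine ae_forall_of_forall_ae _ (Eventually.of_forall fun t y x _ _ hyx hP => ?_) fun ζ hζ => ?_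
    · have c : Continuous fun ζ : W1 Ω p ℝ => (inner ℝ (φ t) (Λ ζ) : ℝ) :=
        continuous_const.inner Λ.continuous
      exact le_of_tendsto' ((c.tendsto x).comp hyx) hP
    · filter_upwards [hφ ζ hζ] with t ht
      rw [← integral_mul_eq_inner]
      refine le_of_eq_of_le (integral_congr_ae ?_) ht
      filter_upwards [hΛ ζ] with x hx
      rw [hx]
  filter_upwards [key, hdt] with t h1 h2
  exact h1 _ h2

/-- At a time of differentiability `ζ = z(s)` with `s > t` is admissible, and division by `s - t`
preserves the sign in the limit; hence the restriction to right difference quotients. -/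
lemma ae_inner_xi_dt_nonpos {z : W1InTime T p (W1 Ω p ℝ)} (hp : p ≠ ⊤)
    {ξ : ℝ → Lp ℝ 2 (volume.restrict Ω)}
    (hΛ : ∀ w : W1 Ω p ℝ, Λ w =ᵐ[volume.restrict Ω] w.toLp)
    (hξ : ∀ ζ : W1 Ω p ℝ, (∀ᵐ x ∂(volume.restrict Ω), 0 ≤ ζ.toLp x) →
      ∀ᵐ t ∂(timeMeasure T), ∫ x in Ω, ξ t x * (ζ.toLp x - (z.val t).toLp x) ≤ 0)
    (hz : ∀ t ∈ Icc 0 T, ∀ᵐ x ∂(volume.restrict Ω), (z.val t).toLp x ∈ Icc (0 : ℝ) 1) :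
    ∀ᵐ t ∂(timeMeasure T), inner ℝ (ξ t) (Λ (z.dt t)) ≤ (0 : ℝ) := by
  have : Fact (p ≠ ⊤) := ⟨hp⟩
  have key : ∀ᵐ t ∂(timeMeasure T), ∀ ζ ∈ {ζ : W1 Ω p ℝ | ∀ᵐ x ∂(volume.restrict Ω),
      0 ≤ ζ.toLp x}, inner ℝ (ξ t) (Λ (ζ - z.val t)) ≤ (0 : ℝ) := by
    refine ae_forall_of_forall_ae _ (Eventually.of_forall fun t y x _ _ hyx hP => ?_) fun ζ hζ => ?_
    · have c : Continuous fun ζ : W1 Ω p ℝ => (inner ℝ (ξ t) (Λ (ζ - z.val t)) : ℝ) :=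
        continuous_const.inner (Λ.continuous.comp (continuous_sub_right _))
      exact le_of_tendsto' ((c.tendsto x).comp hyx) hP
    · filter_upwards [hξ ζ hζ] with t ht
      rw [← integral_mul_eq_inner, map_sub]
      refine le_of_eq_of_le (integral_congr_ae ?_) ht
      filter_upwards [hΛ ζ, hΛ (z.val t), Lp.coeFn_sub (Λ ζ) (Λ (z.val t))] with x h1 h2 h3
      rw [h3, Pi.sub_apply, h1, h2]
  filter_upwards [key, z.isW1.ae_hasDerivAt Fact.out, ae_mem_timeMeasure T] with t h1 h2 ht
  have h3 := (hasDerivAt_iff_tendsto_slope.1 h2).mono_left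
    (nhdsWithin_mono t (fun s (hs : s ∈ Ioi t) => ne_of_gt hs))
  have c : Continuous fun ζ : W1 Ω p ℝ => (inner ℝ (ξ t) (Λ ζ) : ℝ) :=
    continuous_const.inner Λ.continuous
  refine le_of_tendsto ((c.tendsto _).comp h3) ?_
  filter_upwards [Ioo_mem_nhdsGT ht.2] with s hs
  have hsT : s ∈ Icc 0 T := ⟨(ht.1.trans hs.1).le, hs.2.le⟩
  have h4 := h1 (z.val s) ((hz s hsT).mono fun x hx => hx.1)
  simp only [Function.comp, slope, map_smul, inner_smul_right, vsub_eq_sub]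
  exact mul_nonpos_of_nonneg_of_nonpos (inv_nonneg.2 (sub_nonneg.2 hs.1.le)) h4

end Weak


/-! ### Removal of the truncation. -/

section TruncationLimit

variable {α : Type*} [MeasurableSpace α] {μ : Measure α}

lemma tendsto_trunc (a : ℝ) :
    Tendsto (fun k : ℕ => trunc (1 / ((k : ℝ) + 1)) a) atTop (𝓝 a) := by
  have h : Tendsto (fun k : ℕ => 1 + 1 / ((k : ℝ) + 1) * a) atTop (𝓝 1) := by
    have := (tendsto_one_div_add_atTop_nhds_zero_nat (𝕜 := ℝ).mul_const a).const_add 1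
    simpa using this
  have := (tendsto_const_nhds (x := a)).div h one_ne_zero
  rw [div_one] at this
  exact this

lemma tendsto_trunc_deriv (a : ℝ) :
    Tendsto (fun k : ℕ => 1 / (1 + 1 / ((k : ℝ) + 1) * |a|) ^ 2) atTop (𝓝 1) := by
  have h : Tendsto (fun k : ℕ => 1 + 1 / ((k : ℝ) + 1) * |a|) atTop (𝓝 1) := by
    have := (tendsto_one_div_add_atTop_nhds_zero_nat (𝕜 := ℝ).mul_const |a|).const_add 1
    simpa using this
  have := (tendsto_const_nhds (x := (1 : ℝ))).div (h.pow 2) (by simp)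
  rw [one_pow, div_one] at this
  exact this

variable {X Y : Type*} [NormedAddCommGroup X] [NormedSpace ℝ X] [NormedAddCommGroup Y]
  [NormedSpace ℝ Y] {Λ : X →L[ℝ] Lp ℝ 2 μ} {A : Y →L[ℝ] Y →L[ℝ] Lp ℝ 1 μ}
  {H H' F F' : ℝ → ℝ} {B B' ε : ℝ}

/-- The energy `∫ ½ H(z) A(v, v) + F(z)`. -/
def fullEnergy (μ : Measure α) (Λ : X →L[ℝ] Lp ℝ 2 μ) (A : Y →L[ℝ] Y →L[ℝ] Lp ℝ 1 μ)
    (H F : ℝ → ℝ) (w : X × Y) : ℝ :=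
  ∫ x, (1 / 2 * H (Λ w.1 x) * A w.2 w.2 x + F (Λ w.1 x)) ∂μ

lemma tendsto_truncEnergy [IsFiniteMeasure μ] (hH : IsBoundedC1 H H' B)
    (hF : IsBoundedC1 F F' B') (hA : ∀ v, ∀ᵐ x ∂μ, 0 ≤ A v v x) (w : X × Y) :
    Tendsto (fun k : ℕ => truncEnergy μ Λ A H F (1 / ((k : ℝ) + 1)) w) atTop
      (𝓝 (fullEnergy μ Λ A H F w)) := by
  have hε : ∀ k : ℕ, (0 : ℝ) < 1 / ((k : ℝ) + 1) := fun k => by positivity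
  refine tendsto_integral_of_dominated_convergence
    (fun x => 1 / 2 * B * |A w.2 w.2 x| + B')
    (fun k => (integrable_truncEnergy hH hF (hε k) (Lp.aestronglyMeasurable (Λ w.1))
      (L1.integrable_coeFn (A w.2 w.2)) (hA w.2)).aestronglyMeasurable)
    (((L1.integrable_coeFn _).abs.const_mul _).add (integrable_const _)) (fun k => ?_) ?_
  · filter_upwards [hA w.2] with x hx
    refine (abs_add_le _ _).trans (add_le_add ?_ (hF.bound _))
    rw [abs_mul, abs_mul, abs_of_pos (show (0 : ℝ) < 1 / 2 by norm_num)]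
    exact mul_le_mul (mul_le_mul_of_nonneg_left (hH.bound _) (by norm_num))
      (abs_trunc_le (hε k).le hx) (abs_nonneg _) (mul_nonneg (by norm_num) hH.nonneg)
  · refine Eventually.of_forall fun x => ?_
    exact ((tendsto_trunc _).const_mul _).add_const _

/-- The pairing `∫ H(z) Θ'(A(u, u)) A(u, v)` for the truncation `Θ`. -/
def truncPairing (Λ : X →L[ℝ] Lp ℝ 2 μ) (A : Y →L[ℝ] Y →L[ℝ] Lp ℝ 1 μ) (H : ℝ → ℝ) (ε : ℝ)
    (z : X) (u v : Y) : ℝ :=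
  ∫ x, H (Λ z x) * (1 / (1 + ε * |A u u x|) ^ 2) * A u v x ∂μ

lemma abs_mul_trunc_deriv_le (hH : IsBoundedC1 H H' B) (hε : 0 ≤ ε) (s r : ℝ) :
    |H s * (1 / (1 + ε * |r|) ^ 2)| ≤ B := by
  have h := trunc_deriv_mem hε (abs_nonneg r)
  rw [abs_mul, abs_of_nonneg h.1]
  exact (mul_le_mul (hH.bound s) h.2 h.1 hH.nonneg).trans (mul_one B).le

/-- The absolute value keeps the denominator at least 1 for every real `y.2`, so that the kernel is
continuous on the whole plane. It changes nothing where `A(u, u) ≥ 0`. -/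
lemma continuous_truncPairing_kernel (hH : IsBoundedC1 H H' B) (hε : 0 ≤ ε) :
    Continuous fun y : ℝ × ℝ => H y.1 * (1 / (1 + ε * |y.2|) ^ 2) := by
  have h1 := hH.continuous
  have h2 : ∀ y : ℝ × ℝ, (1 + ε * |y.2|) ^ 2 ≠ 0 := fun y => by positivity
  exact (h1.comp continuous_fst).mul (continuous_const.div (by fun_prop) h2)

lemma continuous_truncPairing (Λ : X →L[ℝ] Lp ℝ 2 μ) (A : Y →L[ℝ] Y →L[ℝ] Lp ℝ 1 μ)
    (hH : IsBoundedC1 H H' B) (hε : 0 ≤ ε) :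
    Continuous fun w : X × Y × Y => truncPairing Λ A H ε w.1 w.2.1 w.2.2 := by
  have h := continuous_integral_nemytskii (μ := μ) (p := 2)
    (K := fun s r => H s * (1 / (1 + ε * |r|) ^ 2)) (B := B)
    (continuous_truncPairing_kernel hH hε) (abs_mul_trunc_deriv_le hH hε)
  have h2 : Continuous fun w : X × Y × Y => (Λ w.1, A w.2.1 w.2.1, A w.2.1 w.2.2) := by fun_prop
  exact h.comp h2

lemma integrable_truncPairing (hH : IsBoundedC1 H H' B) (hε : 0 ≤ ε) (f : Lp ℝ 2 μ)
    (a m : Lp ℝ 1 μ) :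
    Integrable (fun x => H (f x) * (1 / (1 + ε * |a x|) ^ 2) * m x) μ :=
  (L1.integrable_coeFn m).bdd_mul ((continuous_truncPairing_kernel hH hε).comp_aestronglyMeasurable
    ((Lp.aestronglyMeasurable f).prodMk (Lp.aestronglyMeasurable a)))
    (Eventually.of_forall fun _ => abs_mul_trunc_deriv_le hH hε _ _)

lemma abs_truncPairing_le (hH : IsBoundedC1 H H' B) (hε : 0 ≤ ε) (z : X) (u v : Y) :
    |truncPairing Λ A H ε z u v| ≤ B * ‖A u v‖ := by
  rw [← integral_abs_eq_norm, ← integral_const_mul, ← Real.norm_eq_abs]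
  refine norm_integral_le_of_norm_le ((L1.integrable_coeFn _).abs.const_mul B)
    (Eventually.of_forall fun x => ?_)
  rw [Real.norm_eq_abs, abs_mul]
  exact mul_le_mul_of_nonneg_right (abs_mul_trunc_deriv_le hH hε _ _) (abs_nonneg _)

lemma tendsto_truncPairing (hH : IsBoundedC1 H H' B) (z : X) (u v : Y) :
    Tendsto (fun k : ℕ => truncPairing Λ A H (1 / ((k : ℝ) + 1)) z u v) atTop
      (𝓝 (pairing Λ A H z u v)) := by
  have hε : ∀ k : ℕ, (0 : ℝ) ≤ 1 / ((k : ℝ) + 1) := fun k => by positivity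
  refine tendsto_integral_of_dominated_convergence (fun x => B * |A u v x|)
    (fun k => (integrable_truncPairing hH (hε k) _ _ _).aestronglyMeasurable)
    ((L1.integrable_coeFn _).abs.const_mul _) (fun k => Eventually.of_forall fun x => ?_)
    (Eventually.of_forall fun x => ?_)
  · rw [Real.norm_eq_abs, abs_mul]
    exact mul_le_mul_of_nonneg_right (abs_mul_trunc_deriv_le hH (hε k) _ _) (abs_nonneg _)
  · have := (((tendsto_trunc_deriv (A u u x)).const_mul (H (Λ z x))).mul_const (A u v x))
    simpa using this

/-- Lower bound for the derivative of the truncated energy in directions decreasing `z`. -/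
lemma le_truncEnergyDeriv [IsFiniteMeasure μ] (hH : IsBoundedC1 H H' B)
    (hF : IsBoundedC1 F F' B') (hε : 0 < ε) (hA : ∀ v, ∀ᵐ x ∂μ, 0 ≤ A v v x) {w v : X × Y}
    (hH0 : ∀ᵐ x ∂μ, 0 ≤ H' (Λ w.1 x)) (hv : ∀ᵐ x ∂μ, Λ v.1 x ≤ 0)
    {m : Lp ℝ 1 μ} (hm : m =ᵐ[μ] fun x => 1 / 2 * H' (Λ w.1 x) * A w.2 w.2 x)
    (hi : Integrable (fun x => m x * Λ v.1 x) μ) :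
    (∫ x, m x * Λ v.1 x ∂μ) + truncPairing Λ A H ε w.1 w.2 v.2
      + (∫ x, F' (Λ w.1 x) * Λ v.1 x ∂μ) ≤ truncEnergyDeriv μ Λ A H H' F' ε w v := by
  have i1 : Integrable (fun x => 1 / 2 * H' (Λ w.1 x) * Λ v.1 x * trunc ε (A w.2 w.2 x)) μ := by
    refine hi.mono ?_ ?_
    · exact (((hH.continuous_deriv.comp_aestronglyMeasurable
        (Lp.aestronglyMeasurable (Λ w.1))).const_mul (1 / 2)).mul
          (Lp.aestronglyMeasurable (Λ v.1))).mul
        ((measurable_trunc ε).comp_aemeasurable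
          (Lp.aestronglyMeasurable (A w.2 w.2)).aemeasurable).aestronglyMeasurable
    · filter_upwards [hm, hA w.2] with x h1 h2
      rw [h1, mul_right_comm, norm_mul, norm_mul _ (Λ v.1 x), norm_mul _ (A w.2 w.2 x),
        norm_mul _ (trunc _ _)]
      have := abs_trunc_le hε.le h2
      simp only [← Real.norm_eq_abs] at this
      gcongr
  have i2 := integrable_truncPairing hH hε.le (Λ w.1) (A w.2 w.2) (A w.2 v.2)
  have i3 : Integrable (fun x => F' (Λ w.1 x) * Λ v.1 x) μ :=
    (Lp.integrable_two _).bdd_mul (hF.continuous_deriv.comp_aestronglyMeasurable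
      (Lp.aestronglyMeasurable (Λ w.1))) (Eventually.of_forall fun _ => hF.bound_deriv _)
  have e : truncEnergyDeriv μ Λ A H H' F' ε w v
      = (∫ x, 1 / 2 * H' (Λ w.1 x) * Λ v.1 x * trunc ε (A w.2 w.2 x) ∂μ)
        + truncPairing Λ A H ε w.1 w.2 v.2 + ∫ x, F' (Λ w.1 x) * Λ v.1 x ∂μ := by
    have i12 : Integrable (fun x => 1 / 2 * H' (Λ w.1 x) * Λ v.1 x * trunc ε (A w.2 w.2 x)
        + H (Λ w.1 x) * (1 / (1 + ε * |A w.2 w.2 x|) ^ 2) * A w.2 v.2 x) μ := i1.add i2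
    rw [truncPairing, ← integral_add i1 i2, ← integral_add i12 i3]
    refine integral_congr_ae ?_
    filter_upwards [hA w.2] with x hx
    rw [abs_of_nonneg hx]
  -- Truncating decreases `A(w, w)`, whose coefficient `½ H'(z) Λ v` is nonpositive; the integral
  -- can only go up.
  have key : (∫ x, m x * Λ v.1 x ∂μ)
      ≤ ∫ x, 1 / 2 * H' (Λ w.1 x) * Λ v.1 x * trunc ε (A w.2 w.2 x) ∂μ := by
    refine integral_mono_ae hi i1 ?_
    filter_upwards [hm, hA w.2, hH0, hv] with x h1 h2 h3 h4
    rw [h1]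
    have h5 := trunc_le_self hε.le h2
    have h6 : 0 ≤ 1 / 2 * H' (Λ w.1 x) * -Λ v.1 x := by
      have : 0 ≤ -Λ v.1 x := neg_nonneg.2 h4
      positivity
    nlinarith [mul_le_mul_of_nonneg_left h5 h6]
  linarith

end TruncationLimit


/-! ### The damage law tested with the time derivative. -/

lemma abs_clm_le_of_hasDerivAt {X : Type*} [NormedAddCommGroup X] [NormedSpace ℝ X] (P : X →L[ℝ] ℝ)
    {z : ℝ → X} {z' : X} {t T K : ℝ} (htT : t < T) (hz : HasDerivAt z z' t)
    (h : ∀ s ∈ Ioc t T, |P (z s - z t)| ≤ K * ‖z s - z t‖) : |P z'| ≤ K * ‖z'‖ := by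
  have h3 := (hasDerivAt_iff_tendsto_slope.1 hz).mono_left
    (nhdsWithin_mono t (fun s (hs : s ∈ Ioi t) => ne_of_gt hs))
  have c1 : Continuous fun ζ : X => |P ζ| := P.continuous.abs
  have c2 : Continuous fun ζ : X => K * ‖ζ‖ := continuous_const.mul continuous_norm
  refine le_of_tendsto_of_tendsto ((c1.tendsto _).comp h3) ((c2.tendsto _).comp h3) ?_
  filter_upwards [Ioc_mem_nhdsGT htT] with s hs
  have h4 := mul_le_mul_of_nonneg_left (h s hs) (abs_nonneg (s - t)⁻¹)
  simp only [Function.comp, slope, map_smul, vsub_eq_sub, smul_eq_mul, abs_mul, norm_smul,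
    Real.norm_eq_abs]
  linarith

lemma abs_integral_mul_le {α : Type*} [MeasurableSpace α] {μ : Measure α} (m : Lp ℝ 1 μ) {g : α → ℝ}
    {c : ℝ} (hg : ∀ᵐ x ∂μ, |g x| ≤ c) : |∫ x, m x * g x ∂μ| ≤ ‖m‖ * c := by
  rw [← integral_abs_eq_norm, ← integral_mul_const, ← Real.norm_eq_abs]
  refine norm_integral_le_of_norm_le ((L1.integrable_coeFn m).abs.mul_const c) ?_
  filter_upwards [hg] with x hx
  rw [Real.norm_eq_abs, abs_mul]
  exact mul_le_mul_of_nonneg_left hx (abs_nonneg _)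

/-- A balance law along a decreasing curve with values in `[0, 1]`, tested with the derivative. -/
lemma balance_estimate {α X : Type*} [MeasurableSpace α] {μ : Measure α} [NormedAddCommGroup X]
    [NormedSpace ℝ X] {Λ : X →L[ℝ] Lp ℝ 2 μ} {m : Lp ℝ 1 μ} (hm : ∀ᵐ x ∂μ, 0 ≤ m x)
    {P : X →L[ℝ] ℝ} {z : ℝ → X} {z' : X} {t T : ℝ} (ht : t < T) (hz : HasDerivAt z z' t)
    (h01 : ∀ s ∈ Icc t T, ∀ᵐ x ∂μ, Λ (z s) x ∈ Icc (0 : ℝ) 1)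
    (hanti : ∀ s ∈ Icc t T, ∀ᵐ x ∂μ, Λ (z s) x ≤ Λ (z t) x)
    (hbal : ∀ s ∈ Icc t T, P (z s) + ∫ x, m x * Λ (z s) x ∂μ = 0) :
    Integrable (fun x => m x * Λ z' x) μ ∧ 0 ≤ (∫ x, m x * Λ z' x ∂μ) + P z' ∧
      ∀ K : ℝ, (∀ w : X, ∀ᵐ x ∂μ, |Λ w x| ≤ K * ‖w‖) → |P z'| ≤ ‖m‖ * K * ‖z'‖ := by
  have htI : t ∈ Icc t T := ⟨le_rfl, ht.le⟩
  have hi : ∀ s ∈ Icc t T, Integrable (fun x => m x * Λ (z s) x) μ := by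
    intro s hs
    refine (L1.integrable_coeFn m).mul_bdd (c := 1) (Lp.aestronglyMeasurable _) ?_
    filter_upwards [h01 s hs] with x h2
    rw [Real.norm_eq_abs, abs_of_nonneg h2.1]
    exact h2.2
  have hint : ∀ s ∈ Ioc t T, Integrable (fun x => m x * (Λ (z s) x - Λ (z t) x)) μ := by
    intro s hs
    simp only [mul_sub]
    exact (hi s (Ioc_subset_Icc_self hs)).sub (hi t htI)
  have hPbal : ∀ s ∈ Ioc t T, P (z s - z t) + ∫ x, m x * (Λ (z s) x - Λ (z t) x) ∂μ = 0 := by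
    intro s hs
    have h1 := hbal s (Ioc_subset_Icc_self hs)
    have h2 := hbal t htI
    simp only [mul_sub]
    rw [integral_sub (hi s (Ioc_subset_Icc_self hs)) (hi t htI), map_sub]
    linarith
  have key := integrable_and_nonneg_of_hasDerivAt (Λ := Λ) hm ht hz
    (fun s hs => hanti s (Ioc_subset_Icc_self hs)) hint hPbal
  refine ⟨key.1, key.2, fun K hK => ?_⟩
  -- On increments the balance identifies `P` with minus a weighted integral, which an `L^∞` bound
  -- controls by `‖m‖ K`; the estimate passes to the derivative through difference quotients.
  refine abs_clm_le_of_hasDerivAt P ht hz fun s hs => ?_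
  rw [eq_neg_of_add_eq_zero_left (hPbal s hs), abs_neg, mul_assoc]
  refine abs_integral_mul_le m ?_
  filter_upwards [hK (z s - z t), Lp.coeFn_sub (Λ (z s)) (Λ (z t))] with x h1 h5
  have e : Λ (z s - z t) x = Λ (z s) x - Λ (z t) x := by
    rw [map_sub]; exact h5
  rw [← e]; exact h1

section DamageEstimate

variable {n : ℕ} {Ω : Set (Eu n)} {p : ℝ≥0∞} [Fact (1 ≤ p)] {T : ℝ}
  {Λ : W1 Ω p ℝ →L[ℝ] Lp ℝ 2 (volume.restrict Ω)}
  {C : Tensor4 n} {h f H H' F F' : ℝ → ℝ} {B B' : ℝ}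

lemma norm_weight_le (hH : IsBoundedC1 H H' B) {z : Lp ℝ 2 (volume.restrict Ω)}
    {a m : Lp ℝ 1 (volume.restrict Ω)}
    (hm : m =ᵐ[volume.restrict Ω] fun x => 1 / 2 * H' (z x) * a x) : ‖m‖ ≤ 1 / 2 * B * ‖a‖ := by
  rw [← integral_abs_eq_norm, ← integral_abs_eq_norm, ← integral_const_mul]
  refine integral_mono_ae (L1.integrable_coeFn m).abs ((L1.integrable_coeFn a).abs.const_mul _) ?_
  filter_upwards [hm] with x hx
  rw [hx, abs_mul, abs_mul, abs_of_pos (show (0 : ℝ) < 1 / 2 by norm_num)]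
  have := hH.bound_deriv (z x)
  gcongr

lemma damageBalance_eq_add {u : W1 Ω 2 (Eu n)} {z zt : W1 Ω p ℝ} {ξ φ : Lp ℝ 2 (volume.restrict Ω)}
    {m : Lp ℝ 1 (volume.restrict Ω)}
    (hm : m =ᵐ[volume.restrict Ω] fun x => 1 / 2 * H' (Λ z x) * energyForm Ω C u u x)
    (ζ : W1 Ω p ℝ) :
    damageResidual Λ F' z zt ξ φ ζ + ∫ x in Ω, m x * Λ ζ x
      = damageBalance Λ C H' F' u z zt ξ φ ζ := by
  have e : ∫ x in Ω, m x * Λ ζ x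
      = ∫ x in Ω, 1 / 2 * H' (Λ z x) * energyForm Ω C u u x * Λ ζ x := by
    refine integral_congr_ae ?_
    filter_upwards [hm] with x h1
    rw [h1]
  simp only [damageBalance, e]

/-- The damage law at a fixed time at which `z` is differentiable, tested with the derivative. -/
lemma damage_estimate [IsFiniteMeasure (volume.restrict Ω)] (hp1 : 1 < p) (hp : p ≠ ⊤)
    (hΛ : ∀ w : W1 Ω p ℝ, Λ w =ᵐ[volume.restrict Ω] w.toLp)
    (hC : IsStiffnessTensor C) (hH : IsBoundedC1 H H' B) (hH0 : ∀ s ∈ Icc (0 : ℝ) 1, 0 ≤ H' s)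
    (hF : IsBoundedC1 F F' B') {u : W1 Ω 2 (Eu n)} {z : ℝ → W1 Ω p ℝ} {zt : W1 Ω p ℝ}
    {ξ φ : Lp ℝ 2 (volume.restrict Ω)} {t : ℝ} (ht : t < T) (hzt : HasDerivAt z zt t)
    (hz : ∀ s ∈ Icc t T, ∀ᵐ x ∂(volume.restrict Ω), (z s).toLp x ∈ Icc (0 : ℝ) 1)
    (hanti : ∀ s ∈ Icc t T, ∀ᵐ x ∂(volume.restrict Ω), (z s).toLp x ≤ (z t).toLp x)
    (hlaw : ∀ s ∈ Icc t T, damageBalance Λ C H' F' u (z t) zt ξ φ (z s) = 0) :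
    ∃ m : Lp ℝ 1 (volume.restrict Ω),
      (m =ᵐ[volume.restrict Ω] fun x => 1 / 2 * H' (Λ (z t) x) * energyForm Ω C u u x) ∧
      Integrable (fun x => m x * Λ zt x) (volume.restrict Ω) ∧
      0 ≤ (∫ x in Ω, m x * Λ zt x) + damageResidual Λ F' (z t) zt ξ φ zt ∧
      ∀ K : ℝ, (∀ w : W1 Ω p ℝ, ∀ᵐ x ∂(volume.restrict Ω), |w.toLp x| ≤ K * ‖w‖) →
        |damageResidual Λ F' (z t) zt ξ φ zt|
          ≤ ‖m‖ * K * ‖zt‖ := by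
  obtain ⟨P, hP⟩ := exists_clm_damageResidual (Λ := Λ) hp1 hp hF (z t) zt ξ φ
  obtain ⟨m, hm⟩ := exists_weight hH (Λ (z t)) (energyForm Ω C u u)
  have htI : t ∈ Icc t T := ⟨le_rfl, ht.le⟩
  have h01 : ∀ s ∈ Icc t T, ∀ᵐ x ∂(volume.restrict Ω), Λ (z s) x ∈ Icc (0 : ℝ) 1 := by
    intro s hs
    filter_upwards [hΛ (z s), hz s hs] with x h1 h2
    rwa [h1]
  have hm0 : ∀ᵐ x ∂(volume.restrict Ω), 0 ≤ m x := by
    filter_upwards [hm, h01 t htI, energyForm_ae C u u] with x h1 h2 h4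
    rw [h1, h4]
    exact mul_nonneg (mul_nonneg (by norm_num) (hH0 _ h2)) (energyForm_nonneg hC u x)
  have hbal : ∀ s ∈ Icc t T, P (z s) + ∫ x in Ω, m x * Λ (z s) x = 0 := by
    intro s hs
    exact (hP (z s) ▸ damageBalance_eq_add hm (z s)).trans (hlaw s hs)
  have hanti' : ∀ s ∈ Icc t T, ∀ᵐ x ∂(volume.restrict Ω), Λ (z s) x ≤ Λ (z t) x := by
    intro s hs
    filter_upwards [hΛ (z s), hΛ (z t), hanti s hs] with x h1 h2 h3
    rwa [h1, h2]
  have key := balance_estimate hm0 ht hzt h01 hanti' hbal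
  refine ⟨m, hm, key.1, (hP zt) ▸ key.2.1, fun K hK => (hP zt) ▸ key.2.2 K fun w => ?_⟩
  filter_upwards [hK w, hΛ w] with x h1 h2
  rwa [h2]

end DamageEstimate


/-- Young's inequality absorbs the last term: `2 γ a ≤ a² + γ²` gives `a² ≤ 2 β + γ²`. -/
lemma integrable_sq_of_le {α : Type*} [MeasurableSpace α] {μ : Measure α} {a β γ : α → ℝ}
    (ha : AEStronglyMeasurable a μ) (hβ : Integrable β μ) (hγ : MemLp γ 2 μ)
    (h : ∀ᵐ s ∂μ, a s ^ 2 ≤ β s + γ s * a s) : Integrable (fun s => a s ^ 2) μ := by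
  refine ((hβ.const_mul 2).add hγ.integrable_sq).mono (ha.pow 2) ?_
  filter_upwards [h] with s hs
  have h1 : a s ^ 2 ≤ 2 * β s + γ s ^ 2 := by nlinarith [sq_nonneg (a s - γ s)]
  rw [Real.norm_eq_abs, abs_of_nonneg (sq_nonneg _), Real.norm_eq_abs]
  exact h1.trans (le_abs_self _)

/-! ### Lower bounds for energy increments along decreasing curves. -/

section EnergyEstimate

variable {α : Type*} [MeasurableSpace α] {μ : Measure α}
variable {X Y : Type*} [NormedAddCommGroup X] [NormedSpace ℝ X] [NormedAddCommGroup Y]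
  [NormedSpace ℝ Y] {Λ : X →L[ℝ] Lp ℝ 2 μ} {A : Y →L[ℝ] Y →L[ℝ] Lp ℝ 1 μ}
  {H H' F F' : ℝ → ℝ} {B B' T : ℝ} {g g' : ℝ → X × Y}

lemma norm_form_le (A : Y →L[ℝ] Y →L[ℝ] Lp ℝ 1 μ) {u v : Y} {R : ℝ} (hu : ‖u‖ ≤ R) :
    ‖A u v‖ ≤ ‖A‖ * R * ‖v‖ := by
  refine (A.le_opNorm₂ _ _).trans ?_
  gcongr

lemma norm_form_prod_le {X : Type*} [NormedAddCommGroup X] (A : Y →L[ℝ] Y →L[ℝ] Lp ℝ 1 μ)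
    {w v : X × Y} {R : ℝ} (hw : ‖w‖ ≤ R) :
    ‖A w.2 v.2‖ ≤ ‖A‖ * R * ‖v‖ :=
  (norm_form_le A ((norm_snd_le w).trans hw)).trans
    (mul_le_mul_of_nonneg_left (norm_snd_le v)
      (mul_nonneg (norm_nonneg A) ((norm_nonneg w).trans hw)))

lemma intervalIntegrable_truncPairing [CompleteSpace X] [CompleteSpace Y]
    (hH : IsBoundedC1 H H' B) {ε : ℝ} (hε : 0 ≤ ε)
    (hg : IsW1InTime T 1 g g') (hT : 0 ≤ T) :
    IntervalIntegrable (fun s => truncPairing Λ A H ε (g s).1 (g s).2 (g' s).2) volume 0 T := by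
  rw [intervalIntegrable_iff_timeMeasure hT]
  obtain ⟨R, hR0, hR⟩ := hg.exists_bound le_rfl
  have m1 : AEStronglyMeasurable (fun s => ((g s).1, (g s).2, (g' s).2)) (timeMeasure T) :=
    (hg.aestronglyMeasurable le_rfl).fst.prodMk
      ((hg.aestronglyMeasurable le_rfl).snd.prodMk hg.memLp.1.snd)
  refine (((hg.integrable le_rfl).norm.const_mul (B * (‖A‖ * R)))).mono
    ((continuous_truncPairing Λ A hH hε).comp_aestronglyMeasurable m1) ?_
  filter_upwards [ae_mem_timeMeasure T] with s hs
  refine (abs_truncPairing_le hH hε _ _ _).trans ?_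
  have := mul_le_mul_of_nonneg_left (norm_form_prod_le A (v := g' s) (hR s (Ioo_subset_Icc_self hs))) hH.nonneg
  refine this.trans (le_of_eq_of_le ?_ (le_abs_self _))
  ring

lemma tendsto_integral_truncPairing [CompleteSpace X] [CompleteSpace Y]
    (hH : IsBoundedC1 H H' B) (hg : IsW1InTime T 1 g g') (hT : 0 ≤ T) {t : ℝ} (ht : t ∈ Icc 0 T) :
    Tendsto (fun k : ℕ => ∫ s in (0 : ℝ)..t,
        truncPairing Λ A H (1 / ((k : ℝ) + 1)) (g s).1 (g s).2 (g' s).2) atTop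
      (𝓝 (∫ s in (0 : ℝ)..t, pairing Λ A H (g s).1 (g s).2 (g' s).2)) := by
  have hε : ∀ k : ℕ, (0 : ℝ) ≤ 1 / ((k : ℝ) + 1) := fun k => by positivity
  obtain ⟨R, hR0, hR⟩ := hg.exists_bound le_rfl
  refine intervalIntegral.tendsto_integral_filter_of_dominated_convergence
    (fun s => B * (‖A‖ * R * ‖g' s‖)) (Eventually.of_forall fun k => ?_)
    (Eventually.of_forall fun k => ?_) ?_ ?_
  · exact ((intervalIntegrable_truncPairing hH (hε k) hg hT).mono_Icc ⟨le_rfl, hT⟩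
      ht).def'.aestronglyMeasurable
  · refine ae_uIoc_of_timeMeasure ht ?_
    filter_upwards [ae_mem_timeMeasure T] with s hs
    exact (abs_truncPairing_le hH (hε k) _ _ _).trans
      (mul_le_mul_of_nonneg_left (norm_form_prod_le A (v := g' s) (hR s (Ioo_subset_Icc_self hs))) hH.nonneg)
  · exact ((((hg.intervalIntegrable le_rfl hT).norm.const_mul _).const_mul _).mono_Icc
      ⟨le_rfl, hT⟩ ht)
  · exact Eventually.of_forall fun s _ => tendsto_truncPairing hH _ _ _

lemma intervalIntegrable_pairing [CompleteSpace X] [CompleteSpace Y] (hH : IsBoundedC1 H H' B)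
    {q r : ℝ≥0∞} {z z' : ℝ → X} {u u' v : ℝ → Y} (hz : IsW1InTime T q z z') (hq : 1 ≤ q)
    (hu : IsW1InTime T r u u') (hr : 1 ≤ r) (hv : Integrable v (timeMeasure T)) (hT : 0 ≤ T) :
    IntervalIntegrable (fun s => pairing Λ A H (z s) (u s) (v s)) volume 0 T := by
  rw [intervalIntegrable_iff_timeMeasure hT]
  obtain ⟨R, hR0, hR⟩ := hu.exists_bound hr
  refine (hv.norm.const_mul (B * (‖A‖ * R))).mono
    ((continuous_pairing Λ A hH).comp_aestronglyMeasurable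
      ((hz.aestronglyMeasurable hq).prodMk ((hu.aestronglyMeasurable hr).prodMk hv.1))) ?_
  filter_upwards [ae_mem_timeMeasure T] with s hs
  have h1 := norm_form_le A (v := v s) (hR s (Ioo_subset_Icc_self hs))
  refine (abs_pairing_le hH _ _ _).trans ?_
  refine (mul_le_mul_of_nonneg_left h1 hH.nonneg).trans (le_of_eq_of_le ?_ (le_abs_self _))
  ring

lemma pairing_sub (hH : IsBoundedC1 H H' B) (z : X) (u v w : Y) :
    pairing Λ A H z u (v - w) = pairing Λ A H z u v - pairing Λ A H z u w := by
  rw [pairing, pairing, pairing, ← integral_sub (integrable_pairing hH _ _)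
    (integrable_pairing hH _ _)]
  refine integral_congr_ae ?_
  filter_upwards [Lp.coeFn_sub (A u v) (A u w)] with x hx
  rw [map_sub, hx, Pi.sub_apply, mul_sub]

/-- Lower bound for the increments of the energy along a curve that decreases in its first
component. -/
lemma integral_le_fullEnergy_sub [IsFiniteMeasure μ] [CompleteSpace X] [CompleteSpace Y]
    (hH : IsBoundedC1 H H' B) (hF : IsBoundedC1 F F' B')
    (hA : ∀ v, ∀ᵐ x ∂μ, 0 ≤ A v v x) (hsymm : ∀ u v, A u v = A v u)
    (hg : IsW1InTime T 1 g g') (hT : 0 ≤ T) {d : ℝ → ℝ} (hd : IntervalIntegrable d volume 0 T)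
    (hH0 : ∀ᵐ s ∂(timeMeasure T), ∀ᵐ x ∂μ, 0 ≤ H' (Λ (g s).1 x))
    (hdt : ∀ᵐ s ∂(timeMeasure T), ∀ᵐ x ∂μ, Λ (g' s).1 x ≤ 0)
    (hest : ∀ᵐ s ∂(timeMeasure T), ∃ m : Lp ℝ 1 μ,
      (m =ᵐ[μ] fun x => 1 / 2 * H' (Λ (g s).1 x) * A (g s).2 (g s).2 x) ∧
      Integrable (fun x => m x * Λ (g' s).1 x) μ ∧
      0 ≤ (∫ x, m x * Λ (g' s).1 x ∂μ) + (∫ x, F' (Λ (g s).1 x) * Λ (g' s).1 x ∂μ) + d s)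
    {t : ℝ} (ht : t ∈ Icc 0 T) :
    (∫ s in (0 : ℝ)..t, pairing Λ A H (g s).1 (g s).2 (g' s).2) - (∫ s in (0 : ℝ)..t, d s)
      ≤ fullEnergy μ Λ A H F (g t) - fullEnergy μ Λ A H F (g 0) := by
  have hε : ∀ k : ℕ, (0 : ℝ) < 1 / ((k : ℝ) + 1) := fun k => by positivity
  -- The inequality is proved for each truncation parameter `1 / (k + 1)`, with a term `d` that does
  -- not depend on `k`, and both sides converge.
  refine le_of_tendsto_of_tendsto'
    ((tendsto_integral_truncPairing hH hg hT ht).sub_const (∫ s in (0 : ℝ)..t, d s))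
    ((tendsto_truncEnergy hH hF hA (g t)).sub (tendsto_truncEnergy hH hF hA (g 0))) fun k => ?_
  obtain ⟨hD, hchain⟩ := hg.chain_rule le_rfl hT (lipschitzOnWith_truncEnergy hH hF (hε k) hA)
    (Eventually.of_forall fun s => hasDerivAt_truncEnergy hH hF (hε k) hA hsymm (g s) (g' s))
  have hP := intervalIntegrable_truncPairing (Λ := Λ) (A := A) hH (hε k).le hg hT
  rw [hchain t ht, ← intervalIntegral.integral_sub (hP.mono_Icc ⟨le_rfl, hT⟩ ht)
    (hd.mono_Icc ⟨le_rfl, hT⟩ ht)]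
  refine intervalIntegral_mono_timeMeasure ht (hP.sub hd) hD ?_
  filter_upwards [hH0, hdt, hest] with s h1 h2 ⟨m, hm, hi, hle⟩
  have := le_truncEnergyDeriv (Λ := Λ) hH hF (hε k) hA h1 h2 hm hi
  linarith

lemma IsW1InTime.exists_bound_form {q : ℝ≥0∞} {u u' : ℝ → Y} (hu : IsW1InTime T q u u') (hq : 1 ≤ q)
    (A : Y →L[ℝ] Y →L[ℝ] Lp ℝ 1 μ) : ∃ R, 0 ≤ R ∧ ∀ t ∈ Icc 0 T, ‖A (u t) (u t)‖ ≤ R := by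
  obtain ⟨R, hR0, hR⟩ := hu.exists_bound hq
  refine ⟨‖A‖ * R * R, by positivity, fun t ht => (A.le_opNorm₂ _ _).trans ?_⟩
  have := hR t ht
  gcongr

/-- Lower bound for the increments of `G(z) + ∫ ½ H(z) A(u, u) + F(z)` when `z` decreases. -/
lemma integral_le_energy_increment [IsFiniteMeasure μ] [CompleteSpace X] [CompleteSpace Y]
    (hH : IsBoundedC1 H H' B) (hF : IsBoundedC1 F F' B')
    (hA : ∀ v, ∀ᵐ x ∂μ, 0 ≤ A v v x) (hsymm : ∀ u v, A u v = A v u)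
    {q r : ℝ≥0∞} {z z' : ℝ → X} {u u' : ℝ → Y} (hz : IsW1InTime T q z z') (hq : 1 ≤ q)
    (hu : IsW1InTime T r u u') (hr : 1 ≤ r) (hT : 0 ≤ T) {G : X → ℝ} {d e : ℝ → ℝ}
    (hd : IntervalIntegrable d volume 0 T) (he : IntervalIntegrable e volume 0 T)
    (hG : ∀ t ∈ Icc 0 T, G (z t) - G (z 0) = ∫ s in (0 : ℝ)..t, e s)
    (hH0 : ∀ᵐ s ∂(timeMeasure T), ∀ᵐ x ∂μ, 0 ≤ H' (Λ (z s) x))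
    (hdt : ∀ᵐ s ∂(timeMeasure T), ∀ᵐ x ∂μ, Λ (z' s) x ≤ 0)
    (hest : ∀ᵐ s ∂(timeMeasure T), ∃ m : Lp ℝ 1 μ,
      (m =ᵐ[μ] fun x => 1 / 2 * H' (Λ (z s) x) * A (u s) (u s) x) ∧
      Integrable (fun x => m x * Λ (z' s) x) μ ∧
      0 ≤ (∫ x, m x * Λ (z' s) x ∂μ) + (∫ x, F' (Λ (z s) x) * Λ (z' s) x ∂μ) + (d s + e s))
    {t : ℝ} (ht : t ∈ Icc 0 T) :
    (∫ s in (0 : ℝ)..t, pairing Λ A H (z s) (u s) (u' s)) - (∫ s in (0 : ℝ)..t, d s)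
      ≤ (G (z t) + fullEnergy μ Λ A H F (z t, u t))
        - (G (z 0) + fullEnergy μ Λ A H F (z 0, u 0)) := by
  have key := integral_le_fullEnergy_sub (g := fun s => (z s, u s)) (g' := fun s => (z' s, u' s))
    hH hF hA hsymm (hz.prodMk hq hu hr) hT (hd.add he) hH0 hdt hest ht
  rw [intervalIntegral.integral_add (hd.mono_Icc ⟨le_rfl, hT⟩ ht)
    (he.mono_Icc ⟨le_rfl, hT⟩ ht)] at key
  have := hG t ht
  linarith

end EnergyEstimate


/-! ### The lower bound for the free energy. -/

section DamageEnergy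

variable {n : ℕ} {Ω : Set (Eu n)} {p : ℝ≥0∞} [Fact (1 ≤ p)] {T : ℝ}
  {Λ : W1 Ω p ℝ →L[ℝ] Lp ℝ 2 (volume.restrict Ω)}
  {C : Tensor4 n} {h f H H' F F' : ℝ → ℝ} {B B' : ℝ} {ΓD : Set (Eu n)}
  {u₀ : W1 Ω 2 (Eu n)} {v₀ : Lp (Eu n) 2 (volume.restrict Ω)} {z₀ : W1 Ω p ℝ}
  {ℓ : ℝ → Lp (Eu n) 2 (volume.restrict Ω)} {b u : HypPath Ω T} {z : W1InTime T p (W1 Ω p ℝ)}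
  {ξ φ : ℝ → Lp ℝ 2 (volume.restrict Ω)}

lemma ae_damage_estimate [IsFiniteMeasure (volume.restrict Ω)] (hp1 : 1 < p) (hp : p ≠ ⊤)
    (hΛ : ∀ w : W1 Ω p ℝ, Λ w =ᵐ[volume.restrict Ω] w.toLp)
    (hC : IsStiffnessTensor C) (hH : IsBoundedC1 H H' B)
    (hHh : ∀ s ∈ Icc (0 : ℝ) 1, H' s = deriv01 h s) (hH0 : ∀ s ∈ Icc (0 : ℝ) 1, 0 ≤ H' s)
    (hF : IsBoundedC1 F F' B') (hFf : ∀ s ∈ Icc (0 : ℝ) 1, F' s = deriv01 f s)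
    (hz : ∀ t ∈ Icc 0 T, ∀ᵐ x ∂(volume.restrict Ω), (z.val t).toLp x ∈ Icc (0 : ℝ) 1)
    (hw : WeakConditions ΓD C h f u₀ v₀ z₀ ℓ b u z ξ φ) :
    ∀ᵐ t ∂(timeMeasure T), ∃ m : Lp ℝ 1 (volume.restrict Ω),
      (m =ᵐ[volume.restrict Ω]
        fun x => 1 / 2 * H' (Λ (z.val t) x) * energyForm Ω C (u.val t) (u.val t) x) ∧
      Integrable (fun x => m x * Λ (z.dt t) x) (volume.restrict Ω) ∧
      0 ≤ (∫ x in Ω, m x * Λ (z.dt t) x)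
        + damageResidual Λ F' (z.val t) (z.dt t) (ξ t) (φ t) (z.dt t) ∧
      ∀ K : ℝ, (∀ w : W1 Ω p ℝ, ∀ᵐ x ∂(volume.restrict Ω), |w.toLp x| ≤ K * ‖w‖) →
        |damageResidual Λ F' (z.val t) (z.dt t) (ξ t) (φ t) (z.dt t)| ≤ ‖m‖ * K * ‖z.dt t‖ := by
  filter_upwards [ae_damage_law hp1 hp hΛ hH hHh hF hFf hz hw.damage_law,
    z.isW1.ae_hasDerivAt Fact.out, ae_mem_timeMeasure T] with t h1 h2 ht
  have hsub : ∀ s ∈ Icc t T, s ∈ Icc 0 T := fun s hs => ⟨ht.1.le.trans hs.1, hs.2⟩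
  exact damage_estimate hp1 hp hΛ hC hH hH0 hF ht.2 h2 (fun s hs => hz s (hsub s hs))
    (fun s hs => ae_le_of_dt_nonpos z hw.dt_z_nonpos (Ioo_subset_Icc_self ht) (hsub s hs) hs.1)
    fun s hs => h1 _ (hz s (hsub s hs))

/-- The chain rule for the gradient energy `1/p ∫ |∇z|^p`. -/
lemma gradient_chain_rule (hp1 : 1 < p) (hp : p ≠ ⊤) (z : W1InTime T p (W1 Ω p ℝ)) (hT : 0 ≤ T) :
    IntervalIntegrable (fun s => pLaplace (gradL Ω p (z.val s)) (gradL Ω p (z.dt s))) volume 0 T ∧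
      ∀ t ∈ Icc 0 T, 1 / p.toReal * ‖gradL Ω p (z.val t)‖ ^ p.toReal
        - 1 / p.toReal * ‖gradL Ω p (z.val 0)‖ ^ p.toReal
        = ∫ s in (0 : ℝ)..t, pLaplace (gradL Ω p (z.val s)) (gradL Ω p (z.dt s)) := by
  have hg := z.isW1.comp_clm Fact.out (gradL Ω p)
  refine hg.chain_rule (J := fun g => 1 / p.toReal * ‖g‖ ^ p.toReal) Fact.out hT (fun R => ?_)
    (Eventually.of_forall fun s => (hasDerivAt_norm_rpow_Lp hp1 hp _ _).2)
  exact lipschitzOnWith_norm_rpow (one_lt_toReal hp1 hp).le (ContinuousLinearMap.id ℝ _) R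

lemma abs_integral_deriv_mul_le [IsFiniteMeasure (volume.restrict Ω)] (hF : IsBoundedC1 F F' B') :
    ∃ c, 0 ≤ c ∧ ∀ a g : Lp ℝ 2 (volume.restrict Ω), |∫ x in Ω, F' (a x) * g x| ≤ c * ‖g‖ := by
  obtain ⟨c, hc0, hc⟩ := integral_abs_le_norm_Lp (μ := volume.restrict Ω) (p := 2)
  refine ⟨B' * c, mul_nonneg hF.nonneg hc0, fun a g => ?_⟩
  have h1 : |∫ x in Ω, F' (a x) * g x| ≤ ∫ x in Ω, B' * |g x| := by
    rw [← Real.norm_eq_abs]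
    refine norm_integral_le_of_norm_le ((Lp.integrable_two g).abs.const_mul B')
      (Eventually.of_forall fun x => ?_)
    rw [Real.norm_eq_abs, abs_mul]
    exact mul_le_mul_of_nonneg_right (hF.bound_deriv _) (abs_nonneg _)
  rw [integral_const_mul] at h1
  refine h1.trans ?_
  rw [mul_assoc]
  exact mul_le_mul_of_nonneg_left (hc g) hF.nonneg

/-- Tested with `zt`, the residual contains `‖Λ zt‖²`; the other terms are linear in `‖Λ zt‖`, apart
from the `p`-Laplacian, which is integrable in time by the chain rule. -/
lemma sq_norm_le_of_damageResidual {z zt : W1 Ω p ℝ} {ξ φ : Lp ℝ 2 (volume.restrict Ω)} {r c : ℝ}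
    (h : |damageResidual Λ F' z zt ξ φ zt| ≤ r)
    (hc : |∫ x in Ω, F' (Λ z x) * Λ zt x| ≤ c * ‖Λ zt‖) :
    ‖Λ zt‖ ^ 2 ≤ (r + |pLaplace (gradL Ω p z) (gradL Ω p zt)|)
      + (c + ‖ξ‖ + ‖φ‖) * ‖Λ zt‖ := by
  have h1 := (abs_le.1 h).2
  have h2 := (abs_le.1 hc).1
  have h3 := (abs_le.1 (abs_real_inner_le_norm ξ (Λ zt))).1
  have h4 := (abs_le.1 (abs_real_inner_le_norm φ (Λ zt))).1
  have h5 := neg_abs_le (pLaplace (gradL Ω p z) (gradL Ω p zt))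
  simp only [damageResidual, real_inner_self_eq_norm_sq] at h1
  linarith

/-- Both multiplier terms have a favourable sign and are dropped. -/
lemma le_add_of_damageResidual {z zt : W1 Ω p ℝ} {ξ φ : Lp ℝ 2 (volume.restrict Ω)} {r : ℝ}
    (h : 0 ≤ r + damageResidual Λ F' z zt ξ φ zt) (hφ : inner ℝ φ (Λ zt) ≤ (0 : ℝ))
    (hξ : inner ℝ ξ (Λ zt) ≤ (0 : ℝ)) :
    0 ≤ r + (∫ x in Ω, F' (Λ z x) * Λ zt x)
      + (‖Λ zt‖ ^ 2 + pLaplace (gradL Ω p z) (gradL Ω p zt)) := by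
  simp only [damageResidual, real_inner_self_eq_norm_sq] at h
  linarith

lemma ae_energyForm_nonneg (hC : IsStiffnessTensor C) (v : W1 Ω 2 (Eu n)) :
    ∀ᵐ x ∂(volume.restrict Ω), 0 ≤ energyForm Ω C v v x := by
  filter_upwards [energyForm_ae C v v] with x hx
  rw [hx]
  exact energyForm_nonneg hC v x

/-- Without integrability the dissipation integral would take the default value 0. For `p ≥ 2` it
follows from `∂ₜz ∈ L^p(0,T; W^{1,p})`. In the other case the damage law bounds `‖Λ ∂ₜz‖²` by an
integrable function plus a square integrable multiple of `‖Λ ∂ₜz‖`. -/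
lemma integrable_dissipation [IsFiniteMeasure (volume.restrict Ω)] (hp1 : 1 < p) (hp : p ≠ ⊤)
    (hT : 0 ≤ T)
    (hdich : 2 ≤ p ∨ ∃ K, 0 ≤ K ∧ ∀ w : W1 Ω p ℝ, ∀ᵐ x ∂(volume.restrict Ω), |w.toLp x| ≤ K * ‖w‖)
    (hH : IsBoundedC1 H H' B) (hF : IsBoundedC1 F F' B')
    (hξ : MemLp ξ 2 (timeMeasure T)) (hφ : MemLp φ 2 (timeMeasure T))
    (hest : ∀ᵐ t ∂(timeMeasure T), ∃ m : Lp ℝ 1 (volume.restrict Ω),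
      (m =ᵐ[volume.restrict Ω]
        fun x => 1 / 2 * H' (Λ (z.val t) x) * energyForm Ω C (u.val t) (u.val t) x) ∧
      ∀ K : ℝ, (∀ w : W1 Ω p ℝ, ∀ᵐ x ∂(volume.restrict Ω), |w.toLp x| ≤ K * ‖w‖) →
        |damageResidual Λ F' (z.val t) (z.dt t) (ξ t) (φ t) (z.dt t)| ≤ ‖m‖ * K * ‖z.dt t‖) :
    Integrable (fun s => ‖Λ (z.dt s)‖ ^ 2) (timeMeasure T) := by
  rcases hdich with h2 | ⟨K, hK0, hK⟩
  · exact ((Λ.comp_memLp' (z.isW1.memLp.mono_exponent h2)).norm).integrable_sq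
  obtain ⟨R, hR0, hR⟩ := u.isW1_val.exists_bound_form one_le_two (energyForm Ω C)
  obtain ⟨c, hc0, hc⟩ := abs_integral_deriv_mul_le (Ω := Ω) hF
  have hpl := (intervalIntegrable_iff_timeMeasure hT).1 (gradient_chain_rule hp1 hp z hT).1
  have hzt := (z.isW1.integrable Fact.out).norm
  have hmeas : AEStronglyMeasurable (fun s => ‖Λ (z.dt s)‖) (timeMeasure T) :=
    (Λ.continuous.comp_aestronglyMeasurable z.isW1.memLp.1).norm
  -- The factor `½ B R` bounds the `L¹` norm of the weight uniformly in time, as `u` is bounded in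
  -- `H¹`.
  have hβ := (hzt.const_mul (1 / 2 * B * R * K)).add hpl.abs
  have hγ := ((memLp_const (μ := timeMeasure T) (p := 2) c).add hξ.norm).add hφ.norm
  refine integrable_sq_of_le hmeas hβ hγ (hest.mp ((ae_mem_timeMeasure T).mono fun s hs h => ?_))
  obtain ⟨m, hm, hle⟩ := h
  have hle' := (hle K hK).trans (b := ‖m‖ * K * ‖z.dt s‖) (c := 1 / 2 * B * R * K * ‖z.dt s‖) ?_
  · exact sq_norm_le_of_damageResidual hle' (hc _ _)
  have h1 := norm_weight_le hH hm
  have h4 := hR s (Ioo_subset_Icc_self hs)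
  have h5 : ‖m‖ ≤ 1 / 2 * B * R :=
    h1.trans (mul_le_mul_of_nonneg_left h4 (mul_nonneg (by norm_num) hH.nonneg))
  gcongr

/-- The increments of the free energy are bounded from below by the work of the stress minus the
dissipation. -/
lemma freeEnergy_increment_ge [IsFiniteMeasure (volume.restrict Ω)] (hp1 : 1 < p) (hp : p ≠ ⊤)
    (hT : 0 ≤ T) (hΛ : ∀ w : W1 Ω p ℝ, Λ w =ᵐ[volume.restrict Ω] w.toLp)
    (hdich : 2 ≤ p ∨ ∃ K, 0 ≤ K ∧ ∀ w : W1 Ω p ℝ, ∀ᵐ x ∂(volume.restrict Ω), |w.toLp x| ≤ K * ‖w‖)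
    (hC : IsStiffnessTensor C) (hH : IsBoundedC1 H H' B)
    (hHh : ∀ s ∈ Icc (0 : ℝ) 1, H' s = deriv01 h s) (hH0 : ∀ s ∈ Icc (0 : ℝ) 1, 0 ≤ H' s)
    (hF : IsBoundedC1 F F' B') (hFf : ∀ s ∈ Icc (0 : ℝ) 1, F' s = deriv01 f s)
    (hξ : MemLp ξ 2 (timeMeasure T)) (hφ : MemLp φ 2 (timeMeasure T))
    (hz : ∀ t ∈ Icc 0 T, ∀ᵐ x ∂(volume.restrict Ω), (z.val t).toLp x ∈ Icc (0 : ℝ) 1)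
    (hw : WeakConditions ΓD C h f u₀ v₀ z₀ ℓ b u z ξ φ) {t : ℝ} (ht : t ∈ Icc 0 T) :
    (∫ s in (0 : ℝ)..t, pairing Λ (energyForm Ω C) H (z.val s) (u.val s) (u.dt s))
      - (∫ s in (0 : ℝ)..t, ‖Λ (z.dt s)‖ ^ 2)
      ≤ (1 / p.toReal * ‖gradL Ω p (z.val t)‖ ^ p.toReal
          + fullEnergy (volume.restrict Ω) Λ (energyForm Ω C) H F (z.val t, u.val t))
        - (1 / p.toReal * ‖gradL Ω p (z.val 0)‖ ^ p.toReal
          + fullEnergy (volume.restrict Ω) Λ (energyForm Ω C) H F (z.val 0, u.val 0)) := by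
  have hest := ae_damage_estimate hp1 hp hΛ hC hH hHh hH0 hF hFf hz hw
  have hest' := hest.mono fun t ht => ht.imp fun m hm => (⟨hm.1, hm.2.2.2⟩ : _ ∧ _)
  have hint : Integrable (fun s => ‖Λ (z.dt s)‖ ^ 2) (timeMeasure T) :=
    integrable_dissipation hp1 hp hT hdich hH hF hξ hφ hest'
  have hdiss : IntervalIntegrable (fun s => ‖Λ (z.dt s)‖ ^ 2) volume 0 T :=
    (intervalIntegrable_iff_timeMeasure hT).2 hint
  obtain ⟨hpl, hgrad⟩ := gradient_chain_rule hp1 hp z hT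
  have hp1' : 1 ≤ p := Fact.out
  have hA := ae_energyForm_nonneg (Ω := Ω) hC
  have hsymm := energyForm_comm (Ω := Ω) hC
  have hzW := z.isW1
  have huW := u.isW1_val
  refine integral_le_energy_increment (T := T) (Λ := Λ) (A := energyForm Ω C) (z := z.val)
    (z' := z.dt) (u := u.val) (u' := u.dt) (d := fun s => ‖Λ (z.dt s)‖ ^ 2)
    (e := fun s => pLaplace (gradL Ω p (z.val s)) (gradL Ω p (z.dt s)))
    (G := fun w => 1 / p.toReal * ‖gradL Ω p w‖ ^ p.toReal) hH hF hA hsymm hzW hp1' huW one_le_two hT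
    hdiss hpl hgrad ?_ ?_ ?_ ht
  · filter_upwards [ae_mem_timeMeasure T] with s hs
    filter_upwards [hΛ (z.val s), hz s (Ioo_subset_Icc_self hs)] with x h1 h2
    exact hH0 _ (h1 ▸ h2)
  · filter_upwards [hw.dt_z_nonpos] with s hs
    filter_upwards [hΛ (z.dt s), hs] with x h1 h2
    exact h1 ▸ h2
  · have hφ' := ae_inner_phi_dt_nonpos hp hΛ hw.phi_le hw.dt_z_nonpos
    have hξ' := ae_inner_xi_dt_nonpos hp hΛ hw.xi_le hz
    refine hest.mp (hφ'.mp (hξ'.mono fun s h5 h4 h => ?_))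
    obtain ⟨m, h1, h2, h3, -⟩ := h
    have h6 := le_add_of_damageResidual h3 h4 h5
    exact ⟨m, h1, h2, h6⟩

end DamageEnergy


/-! ### The kinetic energy balance. -/

section Kinetic

variable {E : Type*} [NormedAddCommGroup E] [InnerProductSpace ℝ E] {T : ℝ} {q r : ℝ≥0∞}
  {g g' k k' : ℝ → E}

lemma lipschitzOnWith_inner (R : ℝ) : ∃ K, LipschitzOnWith K (fun w : E × E => inner ℝ w.1 w.2)
    (Metric.closedBall 0 R) := by
  refine ⟨Real.toNNReal (2 * R), LipschitzOnWith.of_dist_le' fun w hw v hv => ?_⟩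
  rw [mem_closedBall_zero_iff] at hw hv
  rw [Real.dist_eq, dist_eq_norm]
  have e : inner ℝ w.1 w.2 - inner ℝ v.1 v.2
      = (inner ℝ (w - v).1 w.2 + inner ℝ v.1 (w - v).2 : ℝ) := by
    simp only [Prod.fst_sub, Prod.snd_sub, inner_sub_left, inner_sub_right]; ring
  have h1 := abs_real_inner_le_norm (w - v).1 w.2
  have h2 := abs_real_inner_le_norm v.1 (w - v).2
  have h3 : ‖(w - v).1‖ * ‖w.2‖ ≤ ‖w - v‖ * R :=
    mul_le_mul (norm_fst_le _) ((norm_snd_le w).trans hw) (norm_nonneg _) (norm_nonneg _)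
  have h4 : ‖v.1‖ * ‖(w - v).2‖ ≤ R * ‖w - v‖ :=
    mul_le_mul ((norm_fst_le v).trans hv) (norm_snd_le _) (norm_nonneg _)
      ((norm_nonneg _).trans hv)
  rw [e]
  refine (abs_add_le _ _).trans ?_
  linarith

lemma hasDerivAt_inner_add_smul (w v : E × E) :
    HasDerivAt (fun δ : ℝ => (inner ℝ (w + δ • v).1 (w + δ • v).2 : ℝ))
      (inner ℝ w.1 v.2 + inner ℝ v.1 w.2) 0 := by
  have h : ∀ a b : E, HasDerivAt (fun δ : ℝ => a + δ • b) b 0 := fun a b => by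
    simpa using ((hasDerivAt_id (0 : ℝ)).smul_const b).const_add a
  simpa using (h w.1 v.1).inner ℝ (h w.2 v.2)

namespace IsW1InTime

lemma inner_chain_rule [CompleteSpace E] (hg : IsW1InTime T q g g') (hq : 1 ≤ q)
    (hk : IsW1InTime T r k k') (hr : 1 ≤ r) (hT : 0 ≤ T) {t : ℝ} (ht : t ∈ Icc 0 T) :
    (inner ℝ (g t) (k t) - inner ℝ (g 0) (k 0) : ℝ)
      = ∫ s in (0 : ℝ)..t, (inner ℝ (g s) (k' s) + inner ℝ (g' s) (k s)) :=
  ((hg.prodMk hq hk hr).chain_rule (J := fun w : E × E => inner ℝ w.1 w.2) le_rfl hT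
    lipschitzOnWith_inner (Eventually.of_forall fun _ => hasDerivAt_inner_add_smul _ _)).2 t ht

lemma intervalIntegrable_inner (hg : IsW1InTime T q g g') (hq : 1 ≤ q) (hT : 0 ≤ T) {v : ℝ → E}
    (hv : Integrable v (timeMeasure T)) :
    IntervalIntegrable (fun s => (inner ℝ (v s) (g s) : ℝ)) volume 0 T := by
  rw [intervalIntegrable_iff_timeMeasure hT]
  obtain ⟨R, hR0, hR⟩ := hg.exists_bound hq
  refine (hv.norm.mul_const R).mono (hv.1.inner (hg.aestronglyMeasurable hq)) ?_
  filter_upwards [ae_mem_timeMeasure T] with s hs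
  refine (norm_inner_le_norm _ _).trans (le_trans ?_ (le_abs_self _))
  exact mul_le_mul_of_nonneg_left (hR s (Ioo_subset_Icc_self hs)) (norm_nonneg _)

end IsW1InTime

/-- The balance of kinetic energy and power for a motion with velocity `v`, force `l` and
prescribed boundary velocity `w`, where `P` and `Q` are the stress powers of `v` and `w`. -/
lemma kinetic_balance [CompleteSpace E] {v a w c l : ℝ → E} {P Q : ℝ → ℝ}
    (hv : IsW1InTime T q v a) (hq : 1 ≤ q) (hw : IsW1InTime T q w c)
    (hT : 0 ≤ T) (hP : IntervalIntegrable P volume 0 T)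
    (hQ : IntervalIntegrable Q volume 0 T)
    (hforce : ∀ᵐ s ∂(timeMeasure T),
      inner ℝ (a s) (v s - w s) + (P s - Q s) = inner ℝ (l s) (v s - w s))
    {t : ℝ} (ht : t ∈ Icc 0 T) :
    1 / 2 * ‖v t‖ ^ 2 - 1 / 2 * ‖v 0‖ ^ 2 + (∫ s in (0 : ℝ)..t, P s)
      = (∫ s in (0 : ℝ)..t, Q s) - (∫ s in (0 : ℝ)..t, inner ℝ (v s) (c s))
        + inner ℝ (v t) (w t) - inner ℝ (v 0) (w 0)
        + ∫ s in (0 : ℝ)..t, inner ℝ (l s) (v s - w s) := by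
  have h0 : (0 : ℝ) ∈ Icc 0 T := ⟨le_rfl, hT⟩
  have i1 := (hv.intervalIntegrable_inner hq hT (hv.integrable hq)).mono_Icc h0 ht
  have i2 := (hw.intervalIntegrable_inner hq hT (hv.integrable hq)).mono_Icc h0 ht
  have i3 := (hv.intervalIntegrable_inner hq hT (hw.integrable hq)).mono_Icc h0 ht
  have hPt := hP.mono_Icc h0 ht
  have hQt := hQ.mono_Icc h0 ht
  have c1 := hv.inner_chain_rule hq hv hq hT ht
  -- Integration by parts in time trades `∫ ⟨a, w⟩` for the boundary terms and `∫ ⟨v, c⟩` in the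
  -- external work.
  have c2 := hv.inner_chain_rule hq hw hq hT ht
  have e3 : ∫ s in (0 : ℝ)..t, (inner ℝ (v s) (a s) + inner ℝ (a s) (v s) : ℝ)
      = 2 * ∫ s in (0 : ℝ)..t, inner ℝ (a s) (v s) := by
    rw [← intervalIntegral.integral_const_mul]
    refine intervalIntegral.integral_congr fun s _ => ?_
    simp only [real_inner_comm]
    ring
  simp only [real_inner_comm (c _)] at c2 ⊢
  rw [intervalIntegral.integral_add i3 i2] at c2
  rw [e3, real_inner_self_eq_norm_sq, real_inner_self_eq_norm_sq] at c1
  have c3 : ∫ s in (0 : ℝ)..t, inner ℝ (l s) (v s - w s)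
      = ∫ s in (0 : ℝ)..t, (inner ℝ (a s) (v s) - inner ℝ (a s) (w s) + (P s - Q s) : ℝ) := by
    refine intervalIntegral_congr_timeMeasure ht ?_
    filter_upwards [hforce] with s hs
    rw [← hs, inner_sub_right]
  rw [intervalIntegral.integral_add (i1.sub i2) (hPt.sub hQt), intervalIntegral.integral_sub i1 i2,
    intervalIntegral.integral_sub hPt hQt] at c3
  linarith

end Kinetic

/-- The stress power `P` of the full velocity enters the kinetic identity and the free energy
estimate in such a way that it cancels. -/
lemma energy_add_le {Ft F0 Kt K0 D W ft f0 kt k0 d w P : ℝ} (h1 : Ft = ft) (h2 : F0 = f0)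
    (h3 : Kt = kt) (h4 : K0 = k0) (h5 : D = d) (h6 : W = w) (hkin : kt - k0 + P = w)
    (hfree : P - d ≤ ft - f0) : F0 + K0 + W ≤ Ft + Kt + D := by
  linarith

/-! ### The energies in terms of the abstract forms, and the test with `∂ₜ(u - b)`. -/

section Energies

variable {n : ℕ} {Ω : Set (Eu n)} {p : ℝ≥0∞} [Fact (1 ≤ p)] {T : ℝ}
  {Λ : W1 Ω p ℝ →L[ℝ] Lp ℝ 2 (volume.restrict Ω)}
  {C : Tensor4 n} {h f H H' F F' : ℝ → ℝ} {B B' : ℝ} {ΓD : Set (Eu n)}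
  {u₀ : W1 Ω 2 (Eu n)} {v₀ : Lp (Eu n) 2 (volume.restrict Ω)} {z₀ : W1 Ω p ℝ}
  {ℓ : ℝ → Lp (Eu n) 2 (volume.restrict Ω)} {b u : HypPath Ω T} {z : W1InTime T p (W1 Ω p ℝ)}
  {ξ φ : ℝ → Lp ℝ 2 (volume.restrict Ω)}

lemma freeEnergy_eq [IsFiniteMeasure (volume.restrict Ω)] (hp : p ≠ ⊤)
    (hΛ : ∀ w : W1 Ω p ℝ, Λ w =ᵐ[volume.restrict Ω] w.toLp)
    (hH : IsBoundedC1 H H' B) (hHh : ∀ s ∈ Icc (0 : ℝ) 1, H s = h s)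
    (hF : IsBoundedC1 F F' B') (hFf : ∀ s ∈ Icc (0 : ℝ) 1, F s = f s) (u : W1 Ω 2 (Eu n))
    {z : W1 Ω p ℝ} (hz : ∀ᵐ x ∂(volume.restrict Ω), z.toLp x ∈ Icc (0 : ℝ) 1) :
    freeEnergy C h f u z = 1 / p.toReal * ‖gradL Ω p z‖ ^ p.toReal
      + fullEnergy (volume.restrict Ω) Λ (energyForm Ω C) H F (z, u) := by
  have i1 := (MemLp.integrable_norm_rpow_toReal Fact.out hp (Lp.memLp (gradL Ω p z))).const_mul
    (1 / p.toReal)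
  have i2 : Integrable (fun x => 1 / 2 * H (Λ z x) * energyForm Ω C u u x + F (Λ z x))
      (volume.restrict Ω) := by
    refine Integrable.add ?_ (integrable_comp_isBoundedC1 hF (Lp.aestronglyMeasurable (Λ z)))
    simp only [mul_assoc]
    exact (integrable_pairing hH (Λ z) (energyForm Ω C u u)).const_mul (1 / 2)
  rw [Lp.norm_rpow_eq_integral hp, ← integral_const_mul, fullEnergy, ← integral_add i1 i2, freeEnergy]
  refine integral_congr_ae ?_
  filter_upwards [hΛ z, hz, gradL_ae z, energyForm_ae C u u] with x h1 h2 h3 h4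
  simp only [h1, h3, h4, hHh _ h2, hFf _ h2, elasticW]
  ring

lemma kineticEnergy_eq (v : Lp (Eu n) 2 (volume.restrict Ω)) :
    kineticEnergy v = 1 / 2 * ‖v‖ ^ 2 := by
  rw [kineticEnergy, integral_const_mul, ← real_inner_self_eq_norm_sq, L2.inner_def]
  simp only [real_inner_self_eq_norm_sq]

lemma dissipation_eq (hΛ : ∀ w : W1 Ω p ℝ, Λ w =ᵐ[volume.restrict Ω] w.toLp)
    (z : W1InTime T p (W1 Ω p ℝ)) (t : ℝ) :
    dissipation z t = ∫ s in (0 : ℝ)..t, ‖Λ (z.dt s)‖ ^ 2 := by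
  refine intervalIntegral.integral_congr fun s _ => ?_
  rw [← integral_sq_eq_norm]
  refine integral_congr_ae ?_
  filter_upwards [hΛ (z.dt s)] with x hx
  rw [hx]

lemma externalWork_eq (hΛ : ∀ w : W1 Ω p ℝ, Λ w =ᵐ[volume.restrict Ω] w.toLp)
    (hHh : ∀ s ∈ Icc (0 : ℝ) 1, H s = h s)
    (hz : ∀ t ∈ Icc 0 T, ∀ᵐ x ∂(volume.restrict Ω), (z.val t).toLp x ∈ Icc (0 : ℝ) 1)
    {t : ℝ} (ht : t ∈ Icc 0 T) :
    externalWork C h ℓ b u z t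
      = (∫ s in (0 : ℝ)..t, pairing Λ (energyForm Ω C) H (z.val s) (u.val s) (b.dt s))
        - (∫ s in (0 : ℝ)..t, inner ℝ (u.vel s) (b.acc s))
        + inner ℝ (u.vel t) (b.vel t) - inner ℝ (u.vel 0) (b.vel 0)
        + ∫ s in (0 : ℝ)..t, inner ℝ (ℓ s) (u.vel s - b.vel s) := by
  have e1 : ∫ s in (0 : ℝ)..t, ∫ x in Ω,
        frob (elasticWe C h (strain (u.val s) x) ((z.val s).toLp x)) (strain (b.dt s) x)
      = ∫ s in (0 : ℝ)..t, pairing Λ (energyForm Ω C) H (z.val s) (u.val s) (b.dt s) := by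
    refine intervalIntegral_congr_timeMeasure ht ?_
    filter_upwards [ae_mem_timeMeasure T] with s hs
    exact integral_elasticWe_eq_pairing hΛ hHh (hz s (Ioo_subset_Icc_self hs)) _ _
  have e2 : ∀ s, ∫ x in Ω, inner ℝ (ℓ s x) (u.vel s x - b.vel s x)
      = inner ℝ (ℓ s) (u.vel s - b.vel s) := fun s => by
    rw [L2.inner_def]
    refine integral_congr_ae ?_
    filter_upwards [Lp.coeFn_sub (u.vel s) (b.vel s)] with x hx
    rw [hx, Pi.sub_apply]
  simp only [externalWork, e1, e2, L2.inner_def]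

/-- The force balance tested with `∂ₜ(u - b)`. -/
lemma ae_force_balance_dt (hT : 0 < T)
    (hΛ : ∀ w : W1 Ω p ℝ, Λ w =ᵐ[volume.restrict Ω] w.toLp)
    (hH : IsBoundedC1 H H' B) (hHh : ∀ s ∈ Icc (0 : ℝ) 1, H s = h s)
    (hz : ∀ t ∈ Icc 0 T, ∀ᵐ x ∂(volume.restrict Ω), (z.val t).toLp x ∈ Icc (0 : ℝ) 1)
    (hw : WeakConditions ΓD C h f u₀ v₀ z₀ ℓ b u z ξ φ) :
    ∀ᵐ s ∂(timeMeasure T),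
      inner ℝ (u.acc s) (u.vel s - b.vel s)
        + (pairing Λ (energyForm Ω C) H (z.val s) (u.val s) (u.dt s)
          - pairing Λ (energyForm Ω C) H (z.val s) (u.val s) (b.dt s))
        = inner ℝ (ℓ s) (u.vel s - b.vel s) := by
  have hd := u.isW1_val.sub one_le_two b.isW1_val
  -- The zero trace of `u - b` extends from almost every time to every time by continuity, and then
  -- passes to `∂ₜ(u - b)`, because the subspace is closed.
  have hmem := hd.mem_of_ae_mem one_le_two hT isClosed_vanishing hw.dirichlet
  have hdt := hd.ae_dt_mem one_le_two _ isClosed_vanishing hmem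
  filter_upwards [ae_force_balance hΛ hH hHh hz hw.force_balance, hdt, u.dt_eq_vel,
    b.dt_eq_vel] with s h1 h2 h3 h4
  have h5 := h1 _ h2
  have e : W1.toLpL Ω 2 (Eu n) (u.dt s - b.dt s) = u.vel s - b.vel s := by
    rw [← h3, ← h4]; exact map_sub _ _ _
  rwa [e, pairing_sub hH] at h5

end Energies

end Damage

end

/-! ### The energy-dissipation balance. -/

theorem mainTheorem4 (n : ℕ) (hn : 1 ≤ n ∧ n ≤ 3) (p : ℝ≥0∞) [Fact (1 ≤ p)]
    (hnp : (n : ℝ≥0∞) < p) (hp : p ≠ ⊤)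
    (Ω ΓD ΓN : Set (Eu n)) (hΩ : IsBoundedLipschitzDomain Ω) (hΓ : IsBoundarySplitting Ω ΓD ΓN)
    (T : ℝ) (hT : 0 < T)
    (C : Tensor4 n) (hC : IsStiffnessTensor C)
    (h f : ℝ → ℝ) (hh : IsDegradation h) (hf : IsDamagePotential f)
    (u₀ : W1 Ω 2 (Eu n)) (v₀ : Lp (Eu n) 2 (volume.restrict Ω)) (z₀ : W1 Ω p ℝ)
    (hz₀ : ∀ᵐ x ∂(volume.restrict Ω), 0 ≤ z₀.toLp x ∧ z₀.toLp x ≤ 1)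
    (ℓ : ℝ → Lp (Eu n) 2 (volume.restrict Ω)) (hℓ : MemLp ℓ 2 (timeMeasure T))
    (b : HypPath Ω T)
    (u : HypPath Ω T) (hu : MemLqW2 T 2 u.val)
    (z : W1InTime T p (W1 Ω p ℝ)) (hz : MemLqW2 T p z.val)
    (ξ φ : ℝ → Lp ℝ 2 (volume.restrict Ω))
    (hξ : MemLp ξ 2 (timeMeasure T)) (hφ : MemLp φ 2 (timeMeasure T))
    (hweak : WeakConditions ΓD C h f u₀ v₀ z₀ ℓ b u z ξ φ)
    (hineq : ∀ᵐ t ∂(timeMeasure T),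
      freeEnergy C h f (u.val t) (z.val t) + kineticEnergy (u.vel t) + dissipation z t
        ≤ freeEnergy C h f (u.val 0) (z.val 0) + kineticEnergy (u.vel 0)
          + externalWork C h ℓ b u z t) :
    ∀ᵐ t ∂(timeMeasure T),
      freeEnergy C h f (u.val t) (z.val t) + kineticEnergy (u.vel t) + dissipation z t
        = freeEnergy C h f (u.val 0) (z.val 0) + kineticEnergy (u.vel 0)
          + externalWork C h ℓ b u z t := by
  have hp1 : 1 < p := lt_of_le_of_lt (by exact_mod_cast hn.1) hnp
  have hT0 : 0 ≤ T := hT.le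
  have := hΩ.isFiniteMeasure
  obtain ⟨Λ, hΛ, hdich⟩ := exists_embedding hn.1 hnp hΩ
  obtain ⟨H, H', B, hH, hHh⟩ := exists_isBoundedC1_extension hh.contDiffOn
  obtain ⟨F, F', B', hF, hFf⟩ := exists_isBoundedC1_extension hf.contDiffOn
  have hH1 : ∀ s ∈ Icc (0 : ℝ) 1, H s = h s := fun s hs => (hHh s hs).1
  have hH2 : ∀ s ∈ Icc (0 : ℝ) 1, H' s = deriv01 h s := fun s hs => (hHh s hs).2
  have hF1 : ∀ s ∈ Icc (0 : ℝ) 1, F s = f s := fun s hs => (hFf s hs).1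
  have hF2 : ∀ s ∈ Icc (0 : ℝ) 1, F' s = deriv01 f s := fun s hs => (hFf s hs).2
  have hH0 : ∀ s ∈ Icc (0 : ℝ) 1, 0 ≤ H' s := fun s hs => (hH2 s hs).symm ▸ hh.deriv_nonneg s hs
  have hz1 : ∀ t ∈ Icc 0 T, ∀ᵐ x ∂(volume.restrict Ω), (z.val t).toLp x ∈ Icc (0 : ℝ) 1 := by
    have h0 : ∀ᵐ x ∂(volume.restrict Ω), (z.val 0).toLp x ≤ 1 := by
      rw [hweak.initial_z]
      exact hz₀.mono fun x hx => hx.2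
    exact fun t ht => ae_mem_Icc z hT hweak.dt_z_nonpos hweak.z_nonneg h0 ht
  have hp1' : 1 ≤ p := hp1.le
  have hP := intervalIntegrable_pairing (Λ := Λ) (A := energyForm Ω C) hH z.isW1 hp1' u.isW1_val
    one_le_two (u.isW1_val.integrable one_le_two) hT0
  have hQ := intervalIntegrable_pairing (Λ := Λ) (A := energyForm Ω C) hH z.isW1 hp1' u.isW1_val
    one_le_two (b.isW1_val.integrable one_le_two) hT0
  filter_upwards [hineq, ae_mem_timeMeasure T] with t hle ht
  have htI : t ∈ Icc 0 T := Ioo_subset_Icc_self ht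
  have hkin := kinetic_balance u.isW1_vel one_le_two b.isW1_vel hT0 hP hQ
    (ae_force_balance_dt hT hΛ hH hH1 hz1 hweak) htI
  have hfree := freeEnergy_increment_ge hp1 hp hT0 hΛ hdich hC hH hH2 hH0 hF hF2 hξ hφ hz1 hweak htI
  have e1 := freeEnergy_eq (C := C) hp hΛ hH hH1 hF hF1 (u.val t) (hz1 t htI)
  have e2 := freeEnergy_eq (C := C) hp hΛ hH hH1 hF hF1 (u.val 0) (hz1 0 ⟨le_rfl, hT0⟩)
  have e3 := externalWork_eq (C := C) (ℓ := ℓ) (b := b) (u := u) hΛ hH1 hz1 htI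
  -- The assumed inequality is one half; the kinetic identity and the lower bound for the free
  -- energy add up to the other.
  exact le_antisymm hle (energy_add_le e1 e2 (kineticEnergy_eq _) (kineticEnergy_eq _)
    (dissipation_eq hΛ z t) e3 hkin hfree)
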